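/- Let $\mathbb K$ be $\mathbb R$ or $\mathbb C$, and let $M$ be a smooth manifold. A Lie algebroid over $\mathbb K$ on $M$ is a smooth $\mathbb K$-vector bundle $L\to M$ with a Lie bracket on $\Gamma(L)$ and a bundle map $\rho\colon L\to T_M\otimes_{\mathbb R}\mathbb K$ (the anchor) that is a morphism of Lie algebras on sections and satisfies $[u,fv]=f[u,v]+(\rho(u)f)v$. A matched Lie pair $L=A\bowtie B$ is a Lie algebroid $L$ with a decomposition of vector bundles $L=A\oplus B$ into two Lie subalgebroids $A$ and $B$; write $\mathrm{pr}_A,\mathrm{pr}_B$ for the projections and put $\nabla_a b=\mathrm{pr}_B[a,b]$, $\nabla_b a=\mathrm{pr}_A[b,a]$ for $a\in\Gamma(A)$, $b\in\Gamma(B)$. On $\Omega_A^\bullet(B)=\Gamma(\Lambda^\bullet A^*\otimes B)$ let $d$ be the Chevalley–Eilenberg differential of the $A$-module $(B,\nabla)$, and for $X\in\Omega^p_A(B)$, $Y\in\Omega_A^q(B)$ let $$[X,Y](a_1,\dots,a_{p+q})=\sum_{\sigma\in \mathrm{Sh}(p,q)}\mathrm{sgn}(\sigma)\Big([X(a'),Y(a'')]-\sum_{l=1}^{q}Y(a''_1,\dots,\nabla_{X(a')}a''_l,\dots,a''_q)+\sum_{l=1}^{p}X(a'_1,\dots,\nabla_{Y(a'')}a'_l,\dots,a'_p)\Big),$$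 where $a'=(a_{\sigma(1)},\dots,a_{\sigma(p)})$ and $a''=(a_{\sigma(p+1)},\dots,a_{\sigma(p+q)})$. Let $\mathbf{Art}$ be the category of local Artinian commutative $\mathbb K$-algebras $R$ with residue field $\mathbb K$; let $\mathfrak m$ be the maximal ideal of $R$ and $\mathrm{ev}\colon R\to R/\mathfrak m=\mathbb K$, and write $C^\infty(M_R)=C^\infty(M,\mathbb K)\otimes_{\mathbb K} R$, $\Gamma(E_R)=\Gamma(E)\otimes_{\mathbb K} R$ for a vector bundle $E$, and $T_R$ for $E_R$ with $E=T_M\otimes_{\mathbb R}\mathbb K$. An $R$-ringed Lie algebroid structure on $E_R$ is an $R$-bilinear Lie bracket on $\Gamma(E_R)$ together with a $C^\infty(M_R)$-linear anchor $\Gamma(E_R)\to\Gamma(T_R)$ satisfying the Leibniz rule over $C^\infty(M_R)$; for a Lie algebroid $E$, $E^0_R$ denotes the one given by $R$-linear extension of the bracket and the anchor. A morphism $(\Pi,\lambda)\colon F_R\to E_R$ is an $R$-linear map $\Pi\colon\Gamma(F_R)\to\Gamma(E_R)$ preserving brackets, together with an $R$-algebra endomorphism $\lambda$ of $C^\infty(M_R)$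 with $\mathrm{ev}\circ\lambda=\mathrm{id}$ on $C^\infty(M,\mathbb K)$, such that $\Pi(fs)=\lambda(f)\Pi(s)$ and $\lambda(\rho(s)f)=\rho(\Pi(s))\lambda(f)$. The centre of such a structure or morphism is obtained by applying $\mathrm{ev}$. An infinitesimal deformation of $(L,A)$ parametrized by $R$ is an $R$-ringed Lie algebroid structure $A_R$ with centre the Lie algebroid $A$, together with a morphism $(I,\lambda)\colon A_R\to L_R^0$ whose centre is the inclusion $A\hookrightarrow L$. Two of them, $(A_R,I,\lambda)$ and $(A_R',I',\lambda')$, are isomorphic if there are $b\in\Gamma(B)\otimes\mathfrak m$ and a morphism $(\Pi_A,\lambda_A)\colon A'_R\to A_R$ whose centre is $\mathrm{id}_A$ such that $\exp([b,-])\circ I'=I\circ\Pi_A$ and $\exp(\rho(b))\circ\lambda'=\lambda\circ\lambda_A$. Let $\mathrm{hDef}_{A\bowtie B}\colon\mathbf{Art}\to\mathbf{Set}$ be the functor that sends $R$ to the set of isomorphism classes of infinitesimal deformations parametrized by $R$ and a morphism $R\to S$ to extension of scalars. For a dg Lie algebra $\mathfrak g$, let $\mathrm{Def}_{\mathfrak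 g}\colon\mathbf{Art}\to\mathbf{Set}$ be the functor that sends $R$ to the set of $\xi\in\mathfrak g^1\otimes\mathfrak m$ with $d\xi+\frac12[\xi,\xi]=0$ modulo gauge equivalence $\xi\sim e^b*\xi=\xi-\sum_{k\ge 0}\frac{1}{(k+1)!}\,\mathrm{ad}_b^{k}(db+[\xi,b])$, $b\in\mathfrak g^0\otimes\mathfrak m$. **Theorem.** For every matched Lie pair $L=A\bowtie B$, $(\Omega_A^\bullet(B),d,[-,-])$ is a (well-defined) dg Lie algebra, and the functor $\mathrm{hDef}_{A\bowtie B}$ is naturally isomorphic to the deformation functor $\mathrm{Def}_{\Omega_A^\bullet(B)}$ of this dg Lie algebra. -/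

import Mathlib

open scoped Manifold ContDiff TensorProduct
open Bundle CategoryTheory

universe u v w

noncomputable section

namespace LiePairs

/-! ### Local Artinian algebras -/

section Artin

variable (𝕂 : Type) [Field 𝕂]

/-- Local Artinian (commutative) `𝕂`-algebras with residue field `𝕂`. -/
structure ArtAlg where
  carrier : Type w
  [commRing : CommRing carrier]
  [algebra : Algebra 𝕂 carrier]
  [isLocalRing : IsLocalRing carrier]
  [isArtinianRing : IsArtinianRing carrier]
  residue_surjective : Function.Surjective (algebraMap 𝕂 (IsLocalRing.ResidueField carrier))

attribute [instance] ArtAlg.commRing ArtAlg.algebra ArtAlg.isLocalRing ArtAlg.isArtinianRing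

variable {𝕂}

instance : CoeSort (ArtAlg.{w} 𝕂) (Type w) := ⟨ArtAlg.carrier⟩

/-- The category of local Artinian `𝕂`-algebras; the morphisms are the `𝕂`-algebra homomorphisms
(these are automatically local). -/
instance : Category (ArtAlg.{w} 𝕂) where
  Hom R S := R →ₐ[𝕂] S
  id R := AlgHom.id 𝕂 R
  comp f g := g.comp f

/-- The evaluation `R → R / 𝔪 = 𝕂` at the maximal ideal. -/
def ArtAlg.ev (R : ArtAlg.{w} 𝕂) : R →ₐ[𝕂] 𝕂 :=
  ((AlgEquiv.ofBijective (Algebra.ofId 𝕂 (IsLocalRing.ResidueField R))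
    ⟨(algebraMap 𝕂 (IsLocalRing.ResidueField R)).injective, R.residue_surjective⟩).symm :
      IsLocalRing.ResidueField R →ₐ[𝕂] 𝕂).comp (IsScalarTower.toAlgHom 𝕂 R _)

theorem ArtAlg.ev_eq_zero_iff (R : ArtAlg.{w} 𝕂) (r : R) :
    R.ev r = 0 ↔ r ∈ IsLocalRing.maximalIdeal R := by
  have h : R.ev r = (AlgEquiv.ofBijective (Algebra.ofId 𝕂 (IsLocalRing.ResidueField R))
      ⟨(algebraMap 𝕂 (IsLocalRing.ResidueField R)).injective, R.residue_surjective⟩).symm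
        (IsLocalRing.residue R r) := rfl
  rw [h, map_eq_zero_iff _ (AlgEquiv.injective _), IsLocalRing.residue_eq_zero_iff]

theorem ArtAlg.ev_unique (R : ArtAlg.{w} 𝕂) (ε : R →ₐ[𝕂] 𝕂) (r : R) : ε r = R.ev r := by
  have h1 : R.ev (r - algebraMap 𝕂 R (R.ev r)) = 0 := by simp
  rw [R.ev_eq_zero_iff, IsLocalRing.mem_maximalIdeal] at h1
  by_contra h
  apply h1
  have h2 : ε (r - algebraMap 𝕂 R (R.ev r)) ≠ 0 := by
    simpa [sub_eq_zero] using h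
  by_contra h3
  have h4 : IsNilpotent (r - algebraMap 𝕂 R (R.ev r)) := by
    have h5 : IsNilpotent (IsLocalRing.maximalIdeal R) := by
      rw [← IsLocalRing.jacobson_eq_maximalIdeal (⊥ : Ideal R) bot_ne_top]
      exact IsArtinianRing.isNilpotent_jacobson_bot
    obtain ⟨N, hN⟩ := h5
    refine ⟨N, ?_⟩
    have := Ideal.pow_mem_pow ((IsLocalRing.mem_maximalIdeal _).2 h3) N
    rwa [hN] at this
  exact h2 (h4.map ε).eq_zero

theorem ArtAlg.ev_hom {R S : ArtAlg.{w} 𝕂} (ϑ : R →ₐ[𝕂] S) (r : R) : S.ev (ϑ r) = R.ev r :=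
  R.ev_unique (S.ev.comp ϑ) r

theorem ArtAlg.isNilpotent_maximalIdeal (R : ArtAlg.{w} 𝕂) :
    IsNilpotent (IsLocalRing.maximalIdeal R) := by
  rw [← IsLocalRing.jacobson_eq_maximalIdeal (⊥ : Ideal R) bot_ne_top]
  exact IsArtinianRing.isNilpotent_jacobson_bot

end Artin

/-! ### Extension of scalars along local Artinian algebras -/

section Extension

variable {𝕂 : Type} [Field 𝕂] (R : ArtAlg.{w} 𝕂) {S T : ArtAlg.{w} 𝕂}
  {X Y Z : Type*} [AddCommGroup X] [Module 𝕂 X] [AddCommGroup Y] [Module 𝕂 Y]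
  [AddCommGroup Z] [Module 𝕂 Z]

variable (X) in
/-- The evaluation `R ⊗ X → X`, `r ⊗ x ↦ ev(r) x`. -/
def evMap : R ⊗[𝕂] X →ₗ[𝕂] X :=
  TensorProduct.lift ((LinearMap.lsmul 𝕂 X).comp R.ev.toLinearMap)

variable (X) in
/-- `𝔪 · (R ⊗ X)`, that is, the (isomorphic) image of `X ⊗ 𝔪` in `R ⊗ X`. -/
def maxPart : Submodule R (R ⊗[𝕂] X) := IsLocalRing.maximalIdeal R • ⊤

/-- The `R`-bilinear extension of a `𝕂`-bilinear map:
`(r ⊗ x, s ⊗ y) ↦ r s ⊗ β(x, y)`. -/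
def extBilin (β : X →ₗ[𝕂] Y →ₗ[𝕂] Z) : R ⊗[𝕂] X →ₗ[R] R ⊗[𝕂] Y →ₗ[R] R ⊗[𝕂] Z :=
  LinearMap.liftBaseChange R (LinearMap.baseChangeHom 𝕂 R Y Z ∘ₗ β)

/-- The exponential `∑ φ^k / k!` of a nilpotent endomorphism `φ`. -/
def nilExp {V : Type*} [AddCommGroup V] [Module R V] [Module 𝕂 V] [SMulCommClass R 𝕂 V]
    (φ : Module.End R V) : Module.End R V :=
  ∑ k ∈ Finset.range (nilpotencyClass φ), ((k.factorial : 𝕂)⁻¹) • φ ^ k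

variable {R}

variable (X) in
/-- The map `ϑ ⊗ id : R ⊗ X → S ⊗ X`. -/
def push (ϑ : R →ₐ[𝕂] S) : R ⊗[𝕂] X →ₗ[𝕂] S ⊗[𝕂] X := ϑ.toLinearMap.rTensor X

/-- The extension of scalars of an `R`-linear map `R ⊗ X → R ⊗ Y` along `ϑ : R → S`. -/
def pushHom (ϑ : R →ₐ[𝕂] S) :
    (R ⊗[𝕂] X →ₗ[R] R ⊗[𝕂] Y) →ₗ[𝕂] (S ⊗[𝕂] X →ₗ[S] S ⊗[𝕂] Y) where
  toFun φ := LinearMap.liftBaseChange S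
    (push Y ϑ ∘ₗ φ.restrictScalars 𝕂 ∘ₗ TensorProduct.mk 𝕂 R X 1)
  map_add' φ ψ := by
    ext x
    simp
  map_smul' c φ := by
    ext x
    simp

/-- The extension of scalars of an `R`-bilinear map along `ϑ : R → S`. -/
def pushBilin (ϑ : R →ₐ[𝕂] S) (β : R ⊗[𝕂] X →ₗ[R] R ⊗[𝕂] Y →ₗ[R] R ⊗[𝕂] Z) :
    S ⊗[𝕂] X →ₗ[S] S ⊗[𝕂] Y →ₗ[S] S ⊗[𝕂] Z :=
  LinearMap.liftBaseChange S
    (pushHom ϑ ∘ₗ β.restrictScalars 𝕂 ∘ₗ TensorProduct.mk 𝕂 R X 1)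

/-- The extension of scalars of an algebra endomorphism along `ϑ : R → S`. -/
def pushAlg {C : Type*} [CommRing C] [Algebra 𝕂 C] (ϑ : R →ₐ[𝕂] S)
    (lam : R ⊗[𝕂] C →ₐ[R] R ⊗[𝕂] C) : S ⊗[𝕂] C →ₐ[S] S ⊗[𝕂] C :=
  Algebra.TensorProduct.lift (Algebra.ofId S _)
    ((Algebra.TensorProduct.map ϑ (AlgHom.id 𝕂 C)).comp
      ((lam.restrictScalars 𝕂).comp Algebra.TensorProduct.includeRight))
    fun _ _ => .all _ _

@[simp] theorem extBilin_tmul (β : X →ₗ[𝕂] Y →ₗ[𝕂] Z) (r s : R) (x : X) (y : Y) :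
    extBilin R β (r ⊗ₜ x) (s ⊗ₜ y) = (r * s) ⊗ₜ β x y := by
  simp [extBilin, TensorProduct.smul_tmul']

@[simp] theorem evMap_tmul (r : R) (x : X) : evMap R X (r ⊗ₜ x) = R.ev r • x := rfl

@[simp] theorem push_tmul (ϑ : R →ₐ[𝕂] S) (r : R) (x : X) :
    push X ϑ (r ⊗ₜ x) = ϑ r ⊗ₜ x := rfl

theorem push_smul (ϑ : R →ₐ[𝕂] S) (r : R) (z : R ⊗[𝕂] X) :
    push X ϑ (r • z) = ϑ r • push X ϑ z := by
  induction z with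
  | zero => simp
  | tmul s x => simp [TensorProduct.smul_tmul']
  | add a b ha hb => simp [smul_add, ha, hb]

theorem pushHom_one_tmul (ϑ : R →ₐ[𝕂] S) (φ : R ⊗[𝕂] X →ₗ[R] R ⊗[𝕂] Y) (x : X) :
    pushHom ϑ φ (1 ⊗ₜ x) = push Y ϑ (φ (1 ⊗ₜ x)) := by
  simp [pushHom]

theorem tmul_eq_smul (r : R) (x : X) : (r ⊗ₜ[𝕂] x : R ⊗[𝕂] X) = r • (1 ⊗ₜ x) := by
  simp [TensorProduct.smul_tmul']

theorem pushHom_push (ϑ : R →ₐ[𝕂] S) (φ : R ⊗[𝕂] X →ₗ[R] R ⊗[𝕂] Y) (z : R ⊗[𝕂] X) :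
    pushHom ϑ φ (push X ϑ z) = push Y ϑ (φ z) := by
  induction z with
  | zero => simp
  | tmul s x =>
    rw [tmul_eq_smul, push_smul, push_tmul, map_one, map_smul, map_smul, push_smul,
      pushHom_one_tmul]
  | add a b ha hb => simp [ha, hb]

theorem pushBilin_push (ϑ : R →ₐ[𝕂] S) (β : R ⊗[𝕂] X →ₗ[R] R ⊗[𝕂] Y →ₗ[R] R ⊗[𝕂] Z)
    (z : R ⊗[𝕂] X) (t : R ⊗[𝕂] Y) :
    pushBilin ϑ β (push X ϑ z) (push Y ϑ t) = push Z ϑ (β z t) := by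
  induction z with
  | zero => simp
  | tmul s x =>
    rw [tmul_eq_smul, push_smul, push_tmul, map_one, map_smul, map_smul, LinearMap.smul_apply,
      LinearMap.smul_apply, push_smul, ← pushHom_push]
    congr 1
    simp [pushBilin]
  | add a b ha hb => simp [ha, hb]

theorem pushAlg_push {C : Type*} [CommRing C] [Algebra 𝕂 C] (ϑ : R →ₐ[𝕂] S)
    (lam : R ⊗[𝕂] C →ₐ[R] R ⊗[𝕂] C) (z : R ⊗[𝕂] C) :
    pushAlg ϑ lam (push C ϑ z) = push C ϑ (lam z) := by
  induction z with
  | zero => simp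
  | tmul s x =>
    rw [tmul_eq_smul, push_smul, push_tmul, map_one, map_smul, map_smul, push_smul]
    congr 1
    simp only [pushAlg, Algebra.TensorProduct.lift_tmul, map_one, one_mul]
    rfl
  | add a b ha hb => simp [ha, hb]

theorem extBilin_push (ϑ : R →ₐ[𝕂] S) (β : X →ₗ[𝕂] Y →ₗ[𝕂] Z)
    (z : R ⊗[𝕂] X) (t : R ⊗[𝕂] Y) :
    extBilin S β (push X ϑ z) (push Y ϑ t) = push Z ϑ (extBilin R β z t) := by
  induction z with
  | zero => simp
  | tmul s x =>
    induction t with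
    | zero => simp
    | tmul r y => simp
    | add a b ha hb => simp only [map_add, ha, hb]
  | add a b ha hb => simp [ha, hb]

theorem baseChange_push (ϑ : R →ₐ[𝕂] S) (φ : X →ₗ[𝕂] Y) (z : R ⊗[𝕂] X) :
    φ.baseChange S (push X ϑ z) = push Y ϑ (φ.baseChange R z) := by
  induction z with
  | zero => simp
  | tmul s x => simp
  | add a b ha hb => simp [ha, hb]

theorem evMap_push (ϑ : R →ₐ[𝕂] S) (z : R ⊗[𝕂] X) : evMap S X (push X ϑ z) = evMap R X z := by
  induction z with
  | zero => simp
  | tmul s x => simp [ArtAlg.ev_hom]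
  | add a b ha hb => simp [ha, hb]

theorem evMap_smul (r : R) (z : R ⊗[𝕂] X) : evMap R X (r • z) = R.ev r • evMap R X z := by
  induction z with
  | zero => simp
  | tmul s x => simp [TensorProduct.smul_tmul', mul_smul]
  | add a b ha hb => simp [ha, hb]

theorem push_id (z : R ⊗[𝕂] X) : push X (AlgHom.id 𝕂 R) z = z := by
  induction z with
  | zero => simp
  | tmul s x => simp
  | add a b ha hb => simp [ha, hb]

theorem push_comp (ϑ : R →ₐ[𝕂] S) (η : S →ₐ[𝕂] T) (z : R ⊗[𝕂] X) :
    push X (η.comp ϑ) z = push X η (push X ϑ z) := by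
  induction z with
  | zero => simp
  | tmul s x => simp
  | add a b ha hb => simp [ha, hb]

/-- Induction principle: an `S`-submodule of `S ⊗ X` containing the image of `R ⊗ X` is `⊤`. -/
theorem push_induction (ϑ : R →ₐ[𝕂] S) {P : S ⊗[𝕂] X → Prop} (h0 : P 0)
    (hadd : ∀ a b, P a → P b → P (a + b)) (hsmul : ∀ (s : S) a, P a → P (s • a))
    (hpush : ∀ z : R ⊗[𝕂] X, P (push X ϑ z)) (z : S ⊗[𝕂] X) : P z := by
  induction z with
  | zero => exact h0
  | tmul s x =>
    rw [tmul_eq_smul]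
    refine hsmul _ _ ?_
    simpa using hpush (1 ⊗ₜ x)
  | add a b ha hb => exact hadd _ _ ha hb

/-- Induction principle for `R ⊗ X`. -/
theorem one_tmul_induction {P : R ⊗[𝕂] X → Prop} (h0 : P 0)
    (hadd : ∀ a b, P a → P b → P (a + b)) (hsmul : ∀ (s : R) a, P a → P (s • a))
    (h1 : ∀ x : X, P (1 ⊗ₜ x)) (z : R ⊗[𝕂] X) : P z := by
  induction z with
  | zero => exact h0
  | tmul s x =>
    rw [tmul_eq_smul]
    exact hsmul _ _ (h1 x)
  | add a b ha hb => exact hadd _ _ ha hb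

theorem push_mem_maxPart (ϑ : R →ₐ[𝕂] S) {z : R ⊗[𝕂] X} (hz : z ∈ maxPart R X) :
    push X ϑ z ∈ maxPart S X := by
  refine Submodule.smul_induction_on hz (fun r hr m _ => ?_) fun a b ha hb => ?_
  · rw [push_smul]
    refine Submodule.smul_mem_smul ?_ trivial
    rw [← ArtAlg.ev_eq_zero_iff] at hr ⊢
    rw [ArtAlg.ev_hom, hr]
  · rw [map_add]
    exact add_mem ha hb

theorem map_mem_maxPart (φ : R ⊗[𝕂] X →ₗ[R] R ⊗[𝕂] Y) {z : R ⊗[𝕂] X}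
    (hz : z ∈ maxPart R X) : φ z ∈ maxPart R Y := by
  refine Submodule.smul_induction_on hz (fun r hr m _ => ?_) fun a b ha hb => ?_
  · rw [map_smul]
    exact Submodule.smul_mem_smul hr trivial
  · rw [map_add]
    exact add_mem ha hb

theorem isNilpotent_extBilin (β : X →ₗ[𝕂] Y →ₗ[𝕂] Y) {b : R ⊗[𝕂] X} (hb : b ∈ maxPart R X) :
    IsNilpotent (extBilin R β b : Module.End R (R ⊗[𝕂] Y)) := by
  obtain ⟨N, hN⟩ := R.isNilpotent_maximalIdeal
  have key : ∀ (k : ℕ) (y : R ⊗[𝕂] Y),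
      ((extBilin R β b : Module.End R (R ⊗[𝕂] Y)) ^ k) y ∈
        (IsLocalRing.maximalIdeal R ^ k • ⊤ : Submodule R (R ⊗[𝕂] Y)) := by
    intro k
    induction k with
    | zero => intro y; simp
    | succ k ih =>
      intro y
      have hk := ih y
      rw [pow_succ' (extBilin R β b : Module.End R (R ⊗[𝕂] Y)), pow_succ'
        (IsLocalRing.maximalIdeal R), Submodule.mul_smul]
      change extBilin R β b (((extBilin R β b : Module.End R (R ⊗[𝕂] Y)) ^ k) y) ∈ _
      generalize ((extBilin R β b : Module.End R (R ⊗[𝕂] Y)) ^ k) y = t at hk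
      refine Submodule.smul_induction_on hb (fun r hr m _ => ?_) fun c d hc hd => ?_
      · rw [map_smul, LinearMap.smul_apply]
        refine Submodule.smul_mem_smul hr ?_
        have h2 : (IsLocalRing.maximalIdeal R ^ k • ⊤ : Submodule R (R ⊗[𝕂] Y)) ≤
            Submodule.comap (extBilin R β m) (IsLocalRing.maximalIdeal R ^ k • ⊤) := by
          rw [← Submodule.map_le_iff_le_comap, Submodule.map_smul'']
          exact Submodule.smul_mono le_rfl le_top
        exact h2 hk
      · rw [map_add, LinearMap.add_apply]
        exact add_mem hc hd
  refine ⟨N, LinearMap.ext fun y => ?_⟩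
  have := key N y
  rw [hN] at this
  simpa using this

theorem nilExp_eq_sum {V : Type*} [AddCommGroup V] [Module R V] [Module 𝕂 V]
    [SMulCommClass R 𝕂 V] (φ : Module.End R V) {N : ℕ} (hN : φ ^ N = 0) :
    nilExp R φ = ∑ k ∈ Finset.range N, ((k.factorial : 𝕂)⁻¹) • φ ^ k := by
  refine Finset.sum_subset (Finset.range_mono (csInf_le' hN)) fun k _ hk => ?_
  rw [pow_eq_zero_of_le (by simpa using hk) (pow_nilpotencyClass ⟨N, hN⟩), smul_zero]

/-- Powers and hence exponentials are compatible with extension of scalars. -/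
theorem pow_push (ϑ : R →ₐ[𝕂] S) (φ : Module.End R (R ⊗[𝕂] X)) (ψ : Module.End S (S ⊗[𝕂] X))
    (h : ∀ z, ψ (push X ϑ z) = push X ϑ (φ z)) (k : ℕ) (z : R ⊗[𝕂] X) :
    (ψ ^ k) (push X ϑ z) = push X ϑ ((φ ^ k) z) := by
  induction k with
  | zero => simp
  | succ k ih =>
    rw [pow_succ', pow_succ', Module.End.mul_apply, Module.End.mul_apply, ih, h]

theorem nilExp_push (ϑ : R →ₐ[𝕂] S) (φ : Module.End R (R ⊗[𝕂] X))
    (ψ : Module.End S (S ⊗[𝕂] X)) (hφ : IsNilpotent φ) (hψ : IsNilpotent ψ)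
    (h : ∀ z, ψ (push X ϑ z) = push X ϑ (φ z)) (z : R ⊗[𝕂] X) :
    nilExp S ψ (push X ϑ z) = push X ϑ (nilExp R φ z) := by
  obtain ⟨N, hN⟩ := hφ
  obtain ⟨N', hN'⟩ := hψ
  rw [nilExp_eq_sum φ (N := N + N') (by rw [pow_add, hN, zero_mul]),
    nilExp_eq_sum ψ (N := N + N') (by rw [pow_add, hN', mul_zero])]
  simp only [LinearMap.sum_apply, LinearMap.smul_apply, map_sum, map_smul, pow_push ϑ φ ψ h]

end Extension

/-! ### Dg Lie algebras and their deformation functors -/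

section DGLie

variable (𝕂 : Type) [Field 𝕂]

/-- A (non-negatively graded) dg Lie algebra over `𝕂` with graded pieces `V 0, V 1, V 2, …`: a
differential of degree `1` and a bracket of degree `0`, which maps `V p × V q` to `V r` whenever
`p + q = r`. -/
structure DGLieAlgebra (V : ℕ → Type v) [∀ k, AddCommGroup (V k)] [∀ k, Module 𝕂 (V k)] where
  d : ∀ p, V p →ₗ[𝕂] V (p + 1)
  br : ∀ {p q r : ℕ}, p + q = r → V p →ₗ[𝕂] V q →ₗ[𝕂] V r
  d_d : ∀ p (x : V p), d (p + 1) (d p x) = 0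
  skew : ∀ {p q r : ℕ} (h : p + q = r) (h' : q + p = r) (x : V p) (y : V q),
    br h x y = -((-1 : 𝕂) ^ (p * q) • br h' y x)
  leibniz : ∀ {p q r : ℕ} (h : p + q = r) (h₁ : (p + 1) + q = r + 1) (h₂ : p + (q + 1) = r + 1)
    (x : V p) (y : V q),
    d r (br h x y) = br h₁ (d p x) y + (-1 : 𝕂) ^ p • br h₂ x (d q y)
  jacobi : ∀ {p q r s pq qr pr : ℕ} (hqr : q + r = qr) (h₁ : p + qr = s) (hpq : p + q = pq)
    (h₂ : pq + r = s) (hpr : p + r = pr) (h₃ : q + pr = s) (x : V p) (y : V q) (z : V r),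
    br h₁ x (br hqr y z) = br h₂ (br hpq x y) z + (-1 : 𝕂) ^ (p * q) • br h₃ y (br hpr x z)

namespace DGLieAlgebra

variable {𝕂} {V : ℕ → Type v} [∀ k, AddCommGroup (V k)] [∀ k, Module 𝕂 (V k)]
  (g : DGLieAlgebra 𝕂 V)

/-- Maurer-Cartan elements of `g ⊗ 𝔪`: the `ξ ∈ g¹ ⊗ 𝔪` with `d ξ + ½ [ξ, ξ] = 0`. -/
def MC (R : ArtAlg.{w} 𝕂) : Type (max v w) :=
  {ξ : R ⊗[𝕂] V 1 // ξ ∈ maxPart R (V 1) ∧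
    (g.d 1).baseChange R ξ +
      (2 : 𝕂)⁻¹ • extBilin R (g.br (show 1 + 1 = 2 from rfl)) ξ ξ = 0}

/-- `ad_b = [b, -]` on `g¹ ⊗ R`, for `b ∈ g⁰ ⊗ R`. -/
def ad (R : ArtAlg.{w} 𝕂) (b : R ⊗[𝕂] V 0) : Module.End R (R ⊗[𝕂] V 1) :=
  extBilin R (g.br (zero_add 1)) b

/-- The exponential gauge action `e^b * ξ = ξ - ∑_{k ≥ 1} e^k / k!`, where `e^1 = d b + [ξ, b]`
and `e^{k + 1} = [b, e^k]` (a finite sum as `ad_b` is nilpotent). -/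
def gauge (R : ArtAlg.{w} 𝕂) (b : R ⊗[𝕂] V 0) (ξ : R ⊗[𝕂] V 1) : R ⊗[𝕂] V 1 :=
  ξ - ∑ k ∈ Finset.range (nilpotencyClass (g.ad R b)), (((k + 1).factorial : 𝕂)⁻¹) •
    (g.ad R b ^ k) ((g.d 0).baseChange R b + extBilin R (g.br (add_zero 1)) ξ b)

/-- Gauge equivalence of Maurer-Cartan elements of `g ⊗ 𝔪`. -/
def GaugeEquiv (R : ArtAlg.{w} 𝕂) (ξ η : g.MC R) : Prop :=
  ∃ b ∈ maxPart R (V 0), η.1 = g.gauge R b ξ.1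

variable {R S T : ArtAlg.{w} 𝕂}

/-- The map on Maurer-Cartan elements induced by `ϑ : R → S`. -/
def MC.map (ϑ : R →ₐ[𝕂] S) (ξ : g.MC R) : g.MC S :=
  ⟨push (V 1) ϑ ξ.1, push_mem_maxPart ϑ ξ.2.1, by
    rw [baseChange_push, extBilin_push, ← map_smul, ← map_add, ξ.2.2, map_zero]⟩

theorem gauge_push (ϑ : R →ₐ[𝕂] S) {b : R ⊗[𝕂] V 0} (hb : b ∈ maxPart R (V 0))
    (ξ : R ⊗[𝕂] V 1) :
    g.gauge S (push (V 0) ϑ b) (push (V 1) ϑ ξ) = push (V 1) ϑ (g.gauge R b ξ) := by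
  have hψ : IsNilpotent (g.ad S (push (V 0) ϑ b)) :=
    isNilpotent_extBilin _ (push_mem_maxPart ϑ hb)
  have hφ : IsNilpotent (g.ad R b) := isNilpotent_extBilin _ hb
  have h : ∀ z, g.ad S (push (V 0) ϑ b) (push (V 1) ϑ z) = push (V 1) ϑ (g.ad R b z) :=
    fun z => extBilin_push ϑ _ b z
  have aux : ∀ {Q : ArtAlg.{w} 𝕂} (φ : Module.End Q (Q ⊗[𝕂] V 1)) (_ : IsNilpotent φ) (N : ℕ)
      (_ : nilpotencyClass φ ≤ N) (y : Q ⊗[𝕂] V 1),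
      ∑ k ∈ Finset.range (nilpotencyClass φ), (((k + 1).factorial : 𝕂)⁻¹) • (φ ^ k) y =
        ∑ k ∈ Finset.range N, (((k + 1).factorial : 𝕂)⁻¹) • (φ ^ k) y := by
    intro Q φ hφ N hN y
    refine Finset.sum_subset (Finset.range_mono hN) fun k _ hk => ?_
    rw [pow_eq_zero_of_le (by simpa using hk) (pow_nilpotencyClass hφ), LinearMap.zero_apply,
      smul_zero]
  unfold gauge
  rw [aux _ hφ _ (le_max_left _ (nilpotencyClass (g.ad S (push (V 0) ϑ b)))),
    aux _ hψ _ (le_max_right (nilpotencyClass (g.ad R b)) _), baseChange_push, extBilin_push,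
    ← map_add]
  simp only [map_sub, map_sum, map_smul, pow_push ϑ _ _ h]

/-- The deformation functor of the dg Lie algebra `g`: it sends `R` to the set of gauge
equivalence classes of Maurer-Cartan elements of `g ⊗ 𝔪`. -/
def Def : ArtAlg.{w} 𝕂 ⥤ Type (max v w) where
  obj R := Quot (g.GaugeEquiv R)
  map {R S} ϑ := TypeCat.ofHom (Quot.map (MC.map g (show R →ₐ[𝕂] S from ϑ)) (by
    rintro ξ η ⟨b, hb, h⟩
    refine ⟨push (V 0) (show R →ₐ[𝕂] S from ϑ) b, push_mem_maxPart _ hb, ?_⟩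
    change push (V 1) _ η.1 = g.gauge S _ (push (V 1) _ ξ.1)
    rw [gauge_push g _ hb, h]))
  map_id R := by
    ext x
    obtain ⟨ξ, rfl⟩ := Quot.exists_rep x
    exact congrArg (Quot.mk _) (Subtype.ext (push_id ξ.1))
  map_comp {R S T} ϑ η := by
    ext x
    obtain ⟨ξ, rfl⟩ := Quot.exists_rep x
    exact congrArg (Quot.mk _) (Subtype.ext
      (push_comp (show R →ₐ[𝕂] S from ϑ) (show S →ₐ[𝕂] T from η) ξ.1))

end DGLieAlgebra

end DGLie

/-! ### Smooth functions, vector bundles and vector fields -/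

section Geometry

variable (𝕂 : Type) [RCLike 𝕂] (n : ℕ) (M : Type u) [TopologicalSpace M]
  [ChartedSpace (EuclideanSpace ℝ (Fin n)) M]

/-- The `𝕂`-algebra `C^∞(M, 𝕂)` of smooth `𝕂`-valued functions on the manifold `M`. -/
def smoothFunctions : Subalgebra 𝕂 (M → 𝕂) where
  carrier := {f | ContMDiff (𝓡 n) 𝓘(ℝ, 𝕂) ∞ f}
  mul_mem' hf hg := (ContinuousLinearMap.mul ℝ 𝕂).isBoundedBilinearMap.contDiff.comp_contMDiff
    (hf.prodMk_space hg)
  add_mem' hf hg := ContMDiff.add hf hg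
  algebraMap_mem' c := (contMDiff_const : ContMDiff (𝓡 n) 𝓘(ℝ, 𝕂) ∞ fun _ : M => c)

/-- `C^∞(M, 𝕂)` as a type. -/
def SmoothFun : Type u := smoothFunctions 𝕂 n M

instance : CommRing (SmoothFun 𝕂 n M) := inferInstanceAs (CommRing (smoothFunctions 𝕂 n M))

instance : Algebra 𝕂 (SmoothFun 𝕂 n M) := inferInstanceAs (Algebra 𝕂 (smoothFunctions 𝕂 n M))

/-- A smooth `𝕂`-vector bundle of finite rank on the (real) manifold `M`: a vector bundle whose
local trivializations are `𝕂`-linear on the fibres and whose transition functions are smooth. -/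
structure SmoothVectorBundle where
  rank : ℕ
  Fiber : M → Type v
  [addCommGroup : ∀ x, AddCommGroup (Fiber x)]
  [moduleReal : ∀ x, Module ℝ (Fiber x)]
  [module : ∀ x, Module 𝕂 (Fiber x)]
  [topFiber : ∀ x, TopologicalSpace (Fiber x)]
  [topTotal : TopologicalSpace (TotalSpace (Fin rank → 𝕂) Fiber)]
  [fiberBundle : FiberBundle (Fin rank → 𝕂) Fiber]
  [vectorBundleReal : VectorBundle ℝ (Fin rank → 𝕂) Fiber]
  [vectorBundle : VectorBundle 𝕂 (Fin rank → 𝕂) Fiber]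
  [smooth : ContMDiffVectorBundle ∞ (Fin rank → 𝕂) Fiber (𝓡 n)]

attribute [instance] SmoothVectorBundle.addCommGroup SmoothVectorBundle.moduleReal
  SmoothVectorBundle.module SmoothVectorBundle.topFiber SmoothVectorBundle.topTotal
  SmoothVectorBundle.fiberBundle SmoothVectorBundle.vectorBundleReal
  SmoothVectorBundle.vectorBundle SmoothVectorBundle.smooth

variable {𝕂 n M}

/-- `x ↦ s x` is a smooth section of `E`. -/
def IsSmoothSection (E : SmoothVectorBundle.{u, v} 𝕂 n M) (s : ∀ x, E.Fiber x) : Prop :=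
  ContMDiff (𝓡 n) ((𝓡 n).prod 𝓘(ℝ, Fin E.rank → 𝕂)) ∞
    fun x => (⟨x, s x⟩ : TotalSpace (Fin E.rank → 𝕂) E.Fiber)

theorem IsSmoothSection.smul {E : SmoothVectorBundle.{u, v} 𝕂 n M} {s : ∀ x, E.Fiber x}
    (hs : IsSmoothSection E s) {f : M → 𝕂} (hf : ContMDiff (𝓡 n) 𝓘(ℝ, 𝕂) ∞ f) :
    IsSmoothSection E fun x => f x • s x := by
  intro x₀
  have h := hs x₀
  rw [contMDiffAt_section] at h ⊢
  have h2 : ContMDiffAt (𝓡 n) 𝓘(ℝ, Fin E.rank → 𝕂) ∞ (fun x => f x •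
      (trivializationAt (Fin E.rank → 𝕂) E.Fiber x₀ ⟨x, s x⟩).2) x₀ :=
    (isBoundedBilinearMap_smul (𝕜 := ℝ) (A := 𝕂)
      (E := Fin E.rank → 𝕂)).contDiff.contDiffAt.comp_contMDiffAt ((hf x₀).prodMk_space h)
  refine h2.congr_of_eventuallyEq ?_
  filter_upwards [(trivializationAt (Fin E.rank → 𝕂) E.Fiber x₀).open_baseSet.mem_nhds
    (mem_baseSet_trivializationAt (Fin E.rank → 𝕂) E.Fiber x₀)] with x hx
  exact ((trivializationAt (Fin E.rank → 𝕂) E.Fiber x₀).linear 𝕂 hx).2 _ _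

/-- The space `Γ(E)` of smooth global sections of `E`. -/
def smoothSections (E : SmoothVectorBundle.{u, v} 𝕂 n M) : Submodule 𝕂 (∀ x, E.Fiber x) where
  carrier := {s | IsSmoothSection E s}
  add_mem' hs ht := ContMDiff.add_section hs ht
  zero_mem' := contMDiff_zeroSection ℝ E.Fiber
  smul_mem' c _ hs := IsSmoothSection.smul hs (contMDiff_const (c := c))

/-- `Γ(E)` as a type. -/
def Sec (E : SmoothVectorBundle.{u, v} 𝕂 n M) : Type (max u v) := smoothSections E

instance (E : SmoothVectorBundle.{u, v} 𝕂 n M) : AddCommGroup (Sec E) :=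
  inferInstanceAs (AddCommGroup (smoothSections E))

instance (E : SmoothVectorBundle.{u, v} 𝕂 n M) : Module 𝕂 (Sec E) :=
  inferInstanceAs (Module 𝕂 (smoothSections E))

/-- `Γ(E)` is a module over `C^∞(M, 𝕂)` by pointwise multiplication. -/
instance (E : SmoothVectorBundle.{u, v} 𝕂 n M) : Module (SmoothFun 𝕂 n M) (Sec E) where
  smul f s := Subtype.mk (fun x => f.1 x • s.1 x) (IsSmoothSection.smul s.2 f.2)
  one_smul s := Subtype.ext (funext fun x => one_smul 𝕂 (s.1 x))
  mul_smul f g s := Subtype.ext (funext fun x => mul_smul (f.1 x) (g.1 x) (s.1 x))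
  smul_zero f := Subtype.ext (funext fun x => smul_zero (f.1 x))
  smul_add f s t := Subtype.ext (funext fun x => smul_add (f.1 x) (s.1 x) (t.1 x))
  add_smul f g s := Subtype.ext (funext fun x => add_smul (f.1 x) (g.1 x) (s.1 x))
  zero_smul s := Subtype.ext (funext fun x => zero_smul 𝕂 (s.1 x))

instance (E : SmoothVectorBundle.{u, v} 𝕂 n M) :
    IsScalarTower 𝕂 (SmoothFun 𝕂 n M) (Sec E) where
  smul_assoc c f s := Subtype.ext (funext fun x => mul_smul c (f.1 x) (s.1 x))

/-- A morphism `E → F` of smooth `𝕂`-vector bundles over the identity of `M`. -/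
structure BundleHom (E F : SmoothVectorBundle.{u, v} 𝕂 n M) where
  toFun : ∀ x, E.Fiber x →ₗ[𝕂] F.Fiber x
  smooth : ContMDiff ((𝓡 n).prod 𝓘(ℝ, Fin E.rank → 𝕂)) ((𝓡 n).prod 𝓘(ℝ, Fin F.rank → 𝕂)) ∞
    fun p : TotalSpace (Fin E.rank → 𝕂) E.Fiber =>
      (⟨p.proj, toFun p.proj p.snd⟩ : TotalSpace (Fin F.rank → 𝕂) F.Fiber)

/-- The `C^∞(M, 𝕂)`-linear map `Γ(E) → Γ(F)` induced by a bundle morphism. -/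
def BundleHom.onSec {E F : SmoothVectorBundle.{u, v} 𝕂 n M} (φ : BundleHom E F) :
    Sec E →ₗ[SmoothFun 𝕂 n M] Sec F where
  toFun s := Subtype.mk (fun x => φ.toFun x (s.1 x)) (φ.smooth.comp s.2)
  map_add' s t := Subtype.ext (funext fun x => (φ.toFun x).map_add (s.1 x) (t.1 x))
  map_smul' f s := Subtype.ext (funext fun x => (φ.toFun x).map_smul (f.1 x) (s.1 x))

variable (𝕂 n) in
/-- The fibre `T_x M ⊗ 𝕂` of the bundle `T_M^𝕂 = T_M ⊗_ℝ 𝕂`. -/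
abbrev TangentFiber (x : M) : Type := 𝕂 ⊗[ℝ] TangentSpace (𝓡 n) x

/-- The derivative `X f` of `f : M → 𝕂` along `X ∈ T_x M ⊗ 𝕂`: it sends `c ⊗ X` to
`c * df_x(X)`. -/
def dirDeriv (f : M → 𝕂) (x : M) : TangentFiber 𝕂 n x →ₗ[𝕂] 𝕂 :=
  LinearMap.liftBaseChange 𝕂 (mvfderiv (𝓡 n) f x).toLinearMap

variable (𝕂 n M) in
/-- The space `Γ(T_M^𝕂)` of smooth `𝕂`-valued vector fields on `M`: the fields that send smooth
functions to smooth functions. -/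
def vectorFields : Submodule 𝕂 (∀ x : M, TangentFiber 𝕂 n x) where
  carrier := {X | ∀ f : SmoothFun 𝕂 n M, (fun x => dirDeriv f.1 x (X x)) ∈ smoothFunctions 𝕂 n M}
  add_mem' {X Y} hX hY f := by
    have h := (smoothFunctions 𝕂 n M).add_mem (hX f) (hY f)
    convert h using 1
    funext x
    exact (dirDeriv f.1 x).map_add _ _
  zero_mem' f := by
    convert (smoothFunctions 𝕂 n M).zero_mem using 1
    funext x
    exact (dirDeriv f.1 x).map_zero
  smul_mem' c X hX f := by
    convert (smoothFunctions 𝕂 n M).smul_mem (hX f) c using 1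
    funext x
    exact (dirDeriv f.1 x).map_smul _ _

variable (𝕂 n M) in
/-- `Γ(T_M^𝕂)` as a type. -/
def VF : Type u := vectorFields 𝕂 n M

instance : AddCommGroup (VF 𝕂 n M) := inferInstanceAs (AddCommGroup (vectorFields 𝕂 n M))

instance : Module 𝕂 (VF 𝕂 n M) := inferInstanceAs (Module 𝕂 (vectorFields 𝕂 n M))

/-- A family of tangent vectors that is smooth, as an element of `Γ(T_M^𝕂)`. -/
def VF.mk {X : ∀ x : M, TangentFiber 𝕂 n x} (h : X ∈ vectorFields 𝕂 n M) : VF 𝕂 n M :=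
  Subtype.mk X h

instance : Module (SmoothFun 𝕂 n M) (VF 𝕂 n M) where
  smul f X := Subtype.mk (fun x => f.1 x • X.1 x) (fun g => by
    convert (smoothFunctions 𝕂 n M).mul_mem f.2 (X.2 g) using 1
    funext x
    exact (dirDeriv g.1 x).map_smul _ _)
  one_smul s := Subtype.ext (funext fun x => one_smul 𝕂 (s.1 x))
  mul_smul f g s := Subtype.ext (funext fun x => mul_smul (f.1 x) (g.1 x) (s.1 x))
  smul_zero f := Subtype.ext (funext fun x => smul_zero (f.1 x))
  smul_add f s t := Subtype.ext (funext fun x => smul_add (f.1 x) (s.1 x) (t.1 x))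
  add_smul f g s := Subtype.ext (funext fun x => add_smul (f.1 x) (g.1 x) (s.1 x))
  zero_smul s := Subtype.ext (funext fun x => zero_smul 𝕂 (s.1 x))

instance : IsScalarTower 𝕂 (SmoothFun 𝕂 n M) (VF 𝕂 n M) where
  smul_assoc c f s := Subtype.ext (funext fun x => mul_smul c (f.1 x) (s.1 x))

theorem dirDeriv_add {f g : M → 𝕂} {x : M} (hf : MDifferentiableAt (𝓡 n) 𝓘(ℝ, 𝕂) f x)
    (hg : MDifferentiableAt (𝓡 n) 𝓘(ℝ, 𝕂) g x) :
    dirDeriv (n := n) (f + g) x = dirDeriv f x + dirDeriv g x := by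
  refine TensorProduct.AlgebraTensorModule.curry_injective (LinearMap.ext fun c =>
    LinearMap.ext fun y => ?_)
  change c * mvfderiv (𝓡 n) (f + g) x y =
    c * mvfderiv (𝓡 n) f x y + c * mvfderiv (𝓡 n) g x y
  rw [mvfderiv_add hf hg, ← mul_add]
  rfl

theorem dirDeriv_smul {f : M → 𝕂} {x : M} (hf : MDifferentiableAt (𝓡 n) 𝓘(ℝ, 𝕂) f x) (k : 𝕂) :
    dirDeriv (n := n) (k • f) x = k • dirDeriv f x := by
  refine TensorProduct.AlgebraTensorModule.curry_injective (LinearMap.ext fun c =>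
    LinearMap.ext fun y => ?_)
  change c * mvfderiv (𝓡 n) (k • f) x y = k * (c * mvfderiv (𝓡 n) f x y)
  have h : HasMFDerivAt (𝓡 n) 𝓘(ℝ, 𝕂) (k • f) x _ :=
    HasMFDerivAt.comp (g := ⇑(ContinuousLinearMap.mul ℝ 𝕂 k)) (f := f) x (ContinuousLinearMap.hasMFDerivAt (ContinuousLinearMap.mul ℝ 𝕂 k))
      hf.hasMFDerivAt
  have h2 : mvfderiv (𝓡 n) (k • f) x y = k * mvfderiv (𝓡 n) f x y := by
    unfold mvfderiv
    rw [h.mfderiv]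
    rfl
  rw [h2]
  ring

/-- The action `⟨X, f⟩ = X f` of vector fields on functions. -/
def vfAct : VF 𝕂 n M →ₗ[𝕂] SmoothFun 𝕂 n M →ₗ[𝕂] SmoothFun 𝕂 n M :=
  LinearMap.mk₂ 𝕂 (fun X f => (Subtype.mk (fun x => dirDeriv f.1 x (X.1 x)) (X.2 f) : SmoothFun 𝕂 n M))
    (fun X Y f => Subtype.ext (funext fun x => (dirDeriv f.1 x).map_add (X.1 x) (Y.1 x)))
    (fun c X f => Subtype.ext (funext fun x => (dirDeriv f.1 x).map_smul c (X.1 x)))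
    (fun X f g => Subtype.ext (funext fun x => congrArg (fun φ => φ (X.1 x))
      (dirDeriv_add ((f.2.mdifferentiable (by simp)) x) ((g.2.mdifferentiable (by simp)) x))))
    (fun c X f => Subtype.ext (funext fun x => congrArg (fun φ => φ (X.1 x))
      (dirDeriv_smul ((f.2.mdifferentiable (by simp)) x) c)))

/-- A Lie algebroid structure over `𝕂` on the vector bundle `E`: a Lie bracket on `Γ(E)` and a
bundle map `E → T_M^𝕂` (the anchor) that is compatible with brackets and satisfies the Leibniz
identity. -/
structure LieAlgebroid (E : SmoothVectorBundle.{u, v} 𝕂 n M) where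
  bracket : Sec E →ₗ[𝕂] Sec E →ₗ[𝕂] Sec E
  lie_self : ∀ a, bracket a a = 0
  jacobi : ∀ a b c, bracket a (bracket b c) = bracket (bracket a b) c + bracket b (bracket a c)
  anchorAt : ∀ x, E.Fiber x →ₗ[𝕂] TangentFiber 𝕂 n x
  anchor_smooth : ∀ a : Sec E, (fun x => anchorAt x (a.1 x)) ∈ vectorFields 𝕂 n M
  anchor_bracket : ∀ (a b : Sec E) (f : SmoothFun 𝕂 n M),
    vfAct (VF.mk (anchor_smooth (bracket a b))) f =
      vfAct (VF.mk (anchor_smooth a)) (vfAct (VF.mk (anchor_smooth b)) f) -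
        vfAct (VF.mk (anchor_smooth b)) (vfAct (VF.mk (anchor_smooth a)) f)
  leibniz : ∀ (a b : Sec E) (f : SmoothFun 𝕂 n M),
    bracket a (f • b) = vfAct (VF.mk (anchor_smooth a)) f • b + f • bracket a b

/-- The anchor of a Lie algebroid on sections. -/
def LieAlgebroid.anchor {E : SmoothVectorBundle.{u, v} 𝕂 n M} (𝓔 : LieAlgebroid E) :
    Sec E →ₗ[SmoothFun 𝕂 n M] VF 𝕂 n M where
  toFun a := VF.mk (𝓔.anchor_smooth a)
  map_add' s t := Subtype.ext (funext fun x => (𝓔.anchorAt x).map_add (s.1 x) (t.1 x))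
  map_smul' f s := Subtype.ext (funext fun x => (𝓔.anchorAt x).map_smul (f.1 x) (s.1 x))

/-- The bundle morphism `φ : E → F` is a morphism of Lie algebroids. -/
structure IsLieAlgebroidHom {E F : SmoothVectorBundle.{u, v} 𝕂 n M} (𝓔 : LieAlgebroid E)
    (𝓕 : LieAlgebroid F) (φ : BundleHom E F) : Prop where
  map_bracket : ∀ a b, φ.onSec (𝓔.bracket a b) = 𝓕.bracket (φ.onSec a) (φ.onSec b)
  map_anchor : ∀ x (e : E.Fiber x), 𝓕.anchorAt x (φ.toFun x e) = 𝓔.anchorAt x e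

variable (𝕂 n M) in
/-- A matched Lie pair `L = A ⋈ B` over `M`: a Lie algebroid `L`, a Lie subalgebroid `i : A → L`
with quotient map `prB : L → B`, and a splitting `j : B → L`, `prA : L → A` of
`0 → A → L → B → 0` such that `j` identifies `B` with a Lie subalgebroid of `L` too. -/
structure MatchedLiePair where
  L : SmoothVectorBundle.{u, v} 𝕂 n M
  A : SmoothVectorBundle.{u, v} 𝕂 n M
  B : SmoothVectorBundle.{u, v} 𝕂 n M
  lieL : LieAlgebroid L
  lieA : LieAlgebroid A
  lieB : LieAlgebroid B
  i : BundleHom A L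
  j : BundleHom B L
  prA : BundleHom L A
  prB : BundleHom L B
  prA_i : ∀ x a, prA.toFun x (i.toFun x a) = a
  prB_j : ∀ x b, prB.toFun x (j.toFun x b) = b
  prA_j : ∀ x b, prA.toFun x (j.toFun x b) = 0
  prB_i : ∀ x a, prB.toFun x (i.toFun x a) = 0
  add_eq : ∀ x l, i.toFun x (prA.toFun x l) + j.toFun x (prB.toFun x l) = l
  i_hom : IsLieAlgebroidHom lieA lieL i
  j_hom : IsLieAlgebroidHom lieB lieL j

end Geometry

/-! ### Ringed Lie algebroids -/

section Ringed

variable {𝕂 : Type} [RCLike 𝕂] {n : ℕ} {M : Type u} [TopologicalSpace M]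
  [ChartedSpace (EuclideanSpace ℝ (Fin n)) M]

/-- The multiplication by functions, as a `𝕂`-bilinear map. -/
def funMul (X : Type*) [AddCommGroup X] [Module 𝕂 X] [Module (SmoothFun 𝕂 n M) X]
    [IsScalarTower 𝕂 (SmoothFun 𝕂 n M) X] : SmoothFun 𝕂 n M →ₗ[𝕂] X →ₗ[𝕂] X :=
  (Algebra.lsmul 𝕂 𝕂 X).toLinearMap

/-- The multiplication of elements of `X ⊗ R` by functions in `C^∞(M_R) = C^∞(M, 𝕂) ⊗ R`, for a
`C^∞(M, 𝕂)`-module `X`. -/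
def fsmul (R : ArtAlg.{w} 𝕂) {X : Type*} [AddCommGroup X] [Module 𝕂 X]
    [Module (SmoothFun 𝕂 n M) X] [IsScalarTower 𝕂 (SmoothFun 𝕂 n M) X] :
    R ⊗[𝕂] SmoothFun 𝕂 n M →ₗ[R] R ⊗[𝕂] X →ₗ[R] R ⊗[𝕂] X :=
  extBilin R (funMul X)

/-- The pairing `⟨X, f⟩` of `Γ(T_R) = Γ(T_M^𝕂) ⊗ R` with `C^∞(M_R)`. -/
def pairing (R : ArtAlg.{w} 𝕂) :
    R ⊗[𝕂] VF 𝕂 n M →ₗ[R] R ⊗[𝕂] SmoothFun 𝕂 n M →ₗ[R] R ⊗[𝕂] SmoothFun 𝕂 n M :=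
  extBilin R (vfAct (𝕂 := 𝕂) (n := n) (M := M))

/-- An `R`-ringed Lie algebroid structure on the `R`-ringed vector bundle `E_R` with centre `E`:
an `R`-bilinear Lie bracket on `Γ(E_R) = Γ(E) ⊗ R` and a `C^∞(M_R)`-linear anchor
`Γ(E_R) → Γ(T_R)` satisfying the Leibniz rule. -/
structure RingedLieAlgebroid (E : SmoothVectorBundle.{u, v} 𝕂 n M) (R : ArtAlg.{w} 𝕂) where
  bracket : R ⊗[𝕂] Sec E →ₗ[R] R ⊗[𝕂] Sec E →ₗ[R] R ⊗[𝕂] Sec E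
  anchor : R ⊗[𝕂] Sec E →ₗ[R] R ⊗[𝕂] VF 𝕂 n M
  anchor_fsmul : ∀ (f : R ⊗[𝕂] SmoothFun 𝕂 n M) (a : R ⊗[𝕂] Sec E), anchor (fsmul R f a) = fsmul R f (anchor a)
  lie_self : ∀ a, bracket a a = 0
  jacobi : ∀ a b c, bracket a (bracket b c) = bracket (bracket a b) c + bracket b (bracket a c)
  leibniz : ∀ a b f,
    bracket a (fsmul R f b) = fsmul R (pairing R (anchor a) f) b + fsmul R f (bracket a b)

/-- A morphism of `R`-ringed Lie algebroids over `M_R`: an `R`-linear map on sections that covers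
a small automorphism `base` of `M_R` and is compatible with brackets and anchors. -/
structure RingedHom {F E : SmoothVectorBundle.{u, v} 𝕂 n M} {R : ArtAlg.{w} 𝕂}
    (𝓕 : RingedLieAlgebroid F R) (𝓔 : RingedLieAlgebroid E R) where
  toFun : R ⊗[𝕂] Sec F →ₗ[R] R ⊗[𝕂] Sec E
  base : R ⊗[𝕂] SmoothFun 𝕂 n M →ₐ[R] R ⊗[𝕂] SmoothFun 𝕂 n M
  ev_base : ∀ f, evMap R _ (base f) = evMap R _ f
  map_fsmul : ∀ f a, toFun (fsmul R f a) = fsmul R (base f) (toFun a)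
  map_bracket : ∀ a b, toFun (𝓕.bracket a b) = 𝓔.bracket (toFun a) (toFun b)
  map_anchor : ∀ a f, base (pairing R (𝓕.anchor a) f) = pairing R (𝓔.anchor (toFun a)) (base f)

/-- The `R`-Cartesian extension `E_R^0` of a Lie algebroid `E`: the `R`-linear extension of its
bracket and anchor. -/
def LieAlgebroid.cartesian {E : SmoothVectorBundle.{u, v} 𝕂 n M} (𝓔 : LieAlgebroid E)
    (R : ArtAlg.{w} 𝕂) : RingedLieAlgebroid E R where
  bracket := extBilin R 𝓔.bracket
  anchor := (𝓔.anchor.restrictScalars 𝕂).baseChange R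
  anchor_fsmul f a := by
    induction f with
    | zero => simp
    | add f g hf hg => simp only [map_add, LinearMap.add_apply, hf, hg]
    | tmul r f =>
      induction a with
      | zero => simp
      | add a b ha hb => simp only [map_add, ha, hb]
      | tmul s a =>
        simp only [fsmul, extBilin_tmul, LinearMap.baseChange_tmul]
        congr 1
        exact 𝓔.anchor.map_smul f a
  lie_self a := by
    have skew : ∀ a b, extBilin R 𝓔.bracket a b + extBilin R 𝓔.bracket b a = 0 := by
      intro a b
      induction a with
      | zero => simp
      | add a a' ha ha' =>
        simp only [map_add, LinearMap.add_apply]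
        rw [add_add_add_comm, ha, ha', add_zero]
      | tmul r a =>
        induction b with
        | zero => simp
        | add b b' hb hb' =>
          simp only [map_add, LinearMap.add_apply]
          rw [add_add_add_comm, hb, hb', add_zero]
        | tmul s b =>
          have h := 𝓔.lie_self (a + b)
          simp only [map_add, LinearMap.add_apply, 𝓔.lie_self, zero_add, add_zero] at h
          rw [extBilin_tmul, extBilin_tmul, mul_comm s r, ← TensorProduct.tmul_add, add_comm, h,
            TensorProduct.tmul_zero]
    induction a with
    | zero => simp
    | tmul r a => rw [extBilin_tmul, 𝓔.lie_self, TensorProduct.tmul_zero]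
    | add a b ha hb =>
      simp only [map_add, LinearMap.add_apply, ha, hb, zero_add, add_zero]
      rw [add_comm, skew]
  jacobi a b c := by
    induction a with
    | zero => simp
    | add a a' ha ha' =>
      simp only [map_add, LinearMap.add_apply, ha, ha']
      abel
    | tmul r a =>
      induction b with
      | zero => simp
      | add b b' hb hb' =>
        simp only [map_add, LinearMap.add_apply, hb, hb']
        abel
      | tmul s b =>
        induction c with
        | zero => simp
        | add c c' hc hc' =>
          simp only [map_add, hc, hc']
          abel
        | tmul t c =>
          simp only [extBilin_tmul]
          rw [𝓔.jacobi, TensorProduct.tmul_add, mul_assoc, mul_left_comm s r t]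
  leibniz a b f := by
    induction a with
    | zero => simp
    | add a a' ha ha' =>
      simp only [map_add, LinearMap.add_apply, ha, ha']
      abel
    | tmul r a =>
      induction b with
      | zero => simp
      | add b b' hb hb' =>
        simp only [map_add, hb, hb']
        abel
      | tmul s b =>
        induction f with
        | zero => simp
        | add f f' hf hf' =>
          simp only [map_add, LinearMap.add_apply, hf, hf']
          abel
        | tmul t f =>
          simp only [fsmul, pairing, extBilin_tmul, LinearMap.baseChange_tmul]
          rw [mul_assoc, mul_left_comm t r s, ← TensorProduct.tmul_add]
          congr 1
          exact 𝓔.leibniz a b f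

variable {E F : SmoothVectorBundle.{u, v} 𝕂 n M} {R S T : ArtAlg.{w} 𝕂}

theorem fsmul_push {X : Type*} [AddCommGroup X] [Module 𝕂 X]
    [Module (SmoothFun 𝕂 n M) X] [IsScalarTower 𝕂 (SmoothFun 𝕂 n M) X] (ϑ : R →ₐ[𝕂] S)
    (f : R ⊗[𝕂] SmoothFun 𝕂 n M) (a : R ⊗[𝕂] X) :
    fsmul S (push _ ϑ f) (push _ ϑ a) = push _ ϑ (fsmul R f a) :=
  extBilin_push ϑ _ f a

theorem pairing_push (ϑ : R →ₐ[𝕂] S) (X : R ⊗[𝕂] VF 𝕂 n M) (f : R ⊗[𝕂] SmoothFun 𝕂 n M) :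
    pairing S (push _ ϑ X) (push _ ϑ f) = push _ ϑ (pairing R X f) :=
  extBilin_push ϑ (vfAct (𝕂 := 𝕂) (n := n) (M := M)) X f

/-- The extension of scalars of a ringed Lie algebroid along `ϑ : R → S`. -/
def RingedLieAlgebroid.push (𝓔 : RingedLieAlgebroid E R) (ϑ : R →ₐ[𝕂] S) :
    RingedLieAlgebroid E S where
  bracket := pushBilin ϑ 𝓔.bracket
  anchor := pushHom ϑ 𝓔.anchor
  anchor_fsmul f a := by
    induction f using push_induction (X := SmoothFun 𝕂 n M) ϑ with
    | h0 => simp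
    | hadd f g hf hg => simp only [map_add, LinearMap.add_apply, hf, hg]
    | hsmul s f hf => simp only [map_smul, LinearMap.smul_apply, hf]
    | hpush f =>
      induction a using push_induction ϑ with
      | h0 => simp
      | hadd f g hf hg => simp only [map_add, hf, hg]
      | hsmul s f hf => simp only [map_smul, hf]
      | hpush a => rw [fsmul_push, pushHom_push, pushHom_push, fsmul_push, 𝓔.anchor_fsmul]
  lie_self a := by
    have skew : ∀ a b, pushBilin ϑ 𝓔.bracket a b + pushBilin ϑ 𝓔.bracket b a = 0 := by
      intro a b
      induction a using push_induction ϑ with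
      | h0 => simp
      | hadd a a' ha ha' =>
        simp only [map_add, LinearMap.add_apply]
        rw [add_add_add_comm, ha, ha', add_zero]
      | hsmul s a ha => simp only [map_smul, LinearMap.smul_apply, ← smul_add, ha, smul_zero]
      | hpush a =>
        induction b using push_induction ϑ with
        | h0 => simp
        | hadd b b' hb hb' =>
          simp only [map_add, LinearMap.add_apply]
          rw [add_add_add_comm, hb, hb', add_zero]
        | hsmul s a ha => simp only [map_smul, LinearMap.smul_apply, ← smul_add, ha, smul_zero]
        | hpush b =>
          have h := 𝓔.lie_self (a + b)
          simp only [map_add, LinearMap.add_apply, 𝓔.lie_self, zero_add, add_zero] at h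
          rw [pushBilin_push, pushBilin_push, ← map_add, add_comm, h, map_zero]
    induction a using push_induction ϑ with
    | h0 => simp
    | hpush a => rw [pushBilin_push, 𝓔.lie_self, map_zero]
    | hsmul s a ha => simp only [map_smul, LinearMap.smul_apply, ha, smul_zero]
    | hadd a b ha hb =>
      simp only [map_add, LinearMap.add_apply, ha, hb, zero_add, add_zero]
      rw [add_comm, skew]
  jacobi a b c := by
    induction a using push_induction ϑ with
    | h0 => simp
    | hadd a a' ha ha' =>
      simp only [map_add, LinearMap.add_apply, ha, ha']
      abel
    | hsmul s a ha => simp only [map_smul, LinearMap.smul_apply, ha, smul_add]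
    | hpush a =>
      induction b using push_induction ϑ with
      | h0 => simp
      | hadd b b' hb hb' =>
        simp only [map_add, LinearMap.add_apply, hb, hb']
        abel
      | hsmul s b hb => simp only [map_smul, LinearMap.smul_apply, hb, smul_add]
      | hpush b =>
        induction c using push_induction ϑ with
        | h0 => simp
        | hadd c c' hc hc' =>
          simp only [map_add, hc, hc']
          abel
        | hsmul s c hc => simp only [map_smul, hc, smul_add]
        | hpush c => simp only [pushBilin_push, 𝓔.jacobi a b c, map_add]
  leibniz a b f := by
    induction a using push_induction ϑ with
    | h0 => simp
    | hadd a a' ha ha' =>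
      simp only [map_add, LinearMap.add_apply, ha, ha']
      abel
    | hsmul s a ha => simp only [map_smul, LinearMap.smul_apply, ha, smul_add]
    | hpush a =>
      induction b using push_induction ϑ with
      | h0 => simp
      | hadd b b' hb hb' =>
        simp only [map_add, hb, hb']
        abel
      | hsmul s b hb => simp only [map_smul, hb, smul_add]
      | hpush b =>
        induction f using push_induction (X := SmoothFun 𝕂 n M) ϑ with
        | h0 => simp
        | hadd c c' hc hc' =>
          simp only [map_add, LinearMap.add_apply, hc, hc']
          abel
        | hsmul s c hc => simp only [map_smul, LinearMap.smul_apply, hc, smul_add]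
        | hpush f =>
          simp only [pushBilin_push, pushHom_push, fsmul_push, pairing_push, 𝓔.leibniz a b f,
            map_add]

end Ringed

/-! ### Infinitesimal deformations of matched Lie pairs -/

section Deformations

variable {𝕂 : Type} [RCLike 𝕂] {n : ℕ} {M : Type u} [TopologicalSpace M]
  [ChartedSpace (EuclideanSpace ℝ (Fin n)) M]

section PushLemmas

variable {R S T : ArtAlg.{w} 𝕂} {X Y Z : Type*} [AddCommGroup X] [Module 𝕂 X] [AddCommGroup Y]
  [Module 𝕂 Y] [AddCommGroup Z] [Module 𝕂 Z]

theorem pushHom_id (φ : R ⊗[𝕂] X →ₗ[R] R ⊗[𝕂] Y) : pushHom (AlgHom.id 𝕂 R) φ = φ :=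
  LinearMap.ext fun z => by
    conv_lhs => rw [← push_id z, pushHom_push, push_id]

theorem pushBilin_id (β : R ⊗[𝕂] X →ₗ[R] R ⊗[𝕂] Y →ₗ[R] R ⊗[𝕂] Z) :
    pushBilin (AlgHom.id 𝕂 R) β = β :=
  LinearMap.ext fun z => LinearMap.ext fun t => by
    conv_lhs => rw [← push_id z, ← push_id t, pushBilin_push, push_id]

theorem pushAlg_id {C : Type*} [CommRing C] [Algebra 𝕂 C] (lam : R ⊗[𝕂] C →ₐ[R] R ⊗[𝕂] C) :
    pushAlg (AlgHom.id 𝕂 R) lam = lam :=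
  AlgHom.ext fun z => by
    conv_lhs => rw [← push_id z, pushAlg_push, push_id]

theorem pushHom_comp (ϑ : R →ₐ[𝕂] S) (η : S →ₐ[𝕂] T) (φ : R ⊗[𝕂] X →ₗ[R] R ⊗[𝕂] Y) :
    pushHom (η.comp ϑ) φ = pushHom η (pushHom ϑ φ) := by
  refine LinearMap.ext fun z => ?_
  induction z using push_induction (X := X) (η.comp ϑ) with
  | h0 => simp
  | hadd a b ha hb => rw [map_add, map_add, ha, hb]
  | hsmul s a ha => rw [map_smul, map_smul, ha]
  | hpush z => rw [pushHom_push, push_comp, push_comp, pushHom_push, pushHom_push]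

theorem pushBilin_comp (ϑ : R →ₐ[𝕂] S) (η : S →ₐ[𝕂] T)
    (β : R ⊗[𝕂] X →ₗ[R] R ⊗[𝕂] Y →ₗ[R] R ⊗[𝕂] Z) :
    pushBilin (η.comp ϑ) β = pushBilin η (pushBilin ϑ β) := by
  refine LinearMap.ext fun z => LinearMap.ext fun t => ?_
  induction z using push_induction (X := X) (η.comp ϑ) with
  | h0 => simp
  | hadd a b ha hb => simp only [map_add, LinearMap.add_apply, ha, hb]
  | hsmul s a ha => simp only [map_smul, LinearMap.smul_apply, ha]
  | hpush z =>
    induction t using push_induction (X := Y) (η.comp ϑ) with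
    | h0 => simp
    | hadd a b ha hb => simp only [map_add, ha, hb]
    | hsmul s a ha => simp only [map_smul, ha]
    | hpush t =>
      rw [pushBilin_push, push_comp, push_comp, push_comp, pushBilin_push, pushBilin_push]

theorem pushAlg_comp {C : Type*} [CommRing C] [Algebra 𝕂 C] (ϑ : R →ₐ[𝕂] S) (η : S →ₐ[𝕂] T)
    (lam : R ⊗[𝕂] C →ₐ[R] R ⊗[𝕂] C) :
    pushAlg (η.comp ϑ) lam = pushAlg η (pushAlg ϑ lam) := by
  refine AlgHom.ext fun z => ?_
  induction z using push_induction (X := C) (η.comp ϑ) with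
  | h0 => simp
  | hadd a b ha hb => rw [map_add, map_add, ha, hb]
  | hsmul s a ha => rw [map_smul, map_smul, ha]
  | hpush z => rw [pushAlg_push, push_comp, push_comp, pushAlg_push, pushAlg_push]

end PushLemmas

variable {E F : SmoothVectorBundle.{u, v} 𝕂 n M} {R S T : ArtAlg.{w} 𝕂}

/-- The extension of scalars of a morphism of ringed Lie algebroids along `ϑ : R → S`; the source
and target are allowed to be given by structures that are equal to the extensions of scalars. -/
def RingedHom.push {𝓕 : RingedLieAlgebroid F R} {𝓔 : RingedLieAlgebroid E R}
    (Φ : RingedHom 𝓕 𝓔) (ϑ : R →ₐ[𝕂] S) (𝓔' : RingedLieAlgebroid E S)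
    (hbr : ∀ a b, 𝓔'.bracket (LiePairs.push _ ϑ a) (LiePairs.push _ ϑ b) =
      LiePairs.push _ ϑ (𝓔.bracket a b))
    (han : ∀ a, 𝓔'.anchor (LiePairs.push _ ϑ a) = LiePairs.push _ ϑ (𝓔.anchor a)) :
    RingedHom (𝓕.push ϑ) 𝓔' where
  toFun := pushHom ϑ Φ.toFun
  base := pushAlg ϑ Φ.base
  ev_base f := by
    induction f using push_induction (X := SmoothFun 𝕂 n M) ϑ with
    | h0 => simp
    | hadd f g hf hg => simp only [map_add, hf, hg]
    | hsmul s f hf => rw [map_smul, evMap_smul, evMap_smul, hf]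
    | hpush f => rw [pushAlg_push, evMap_push, evMap_push, Φ.ev_base]
  map_fsmul f a := by
    induction f using push_induction (X := SmoothFun 𝕂 n M) ϑ with
    | h0 => simp
    | hadd f g hf hg => simp only [map_add, LinearMap.add_apply, hf, hg]
    | hsmul s f hf => simp only [map_smul, LinearMap.smul_apply, hf]
    | hpush f =>
      induction a using push_induction ϑ with
      | h0 => simp
      | hadd f g hf hg => simp only [map_add, hf, hg]
      | hsmul s f hf => simp only [map_smul, hf]
      | hpush a => rw [fsmul_push, pushHom_push, pushHom_push, pushAlg_push, fsmul_push,
          Φ.map_fsmul]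
  map_bracket a b := by
    induction a using push_induction ϑ with
    | h0 => simp
    | hadd f g hf hg => simp only [map_add, LinearMap.add_apply, hf, hg]
    | hsmul s f hf => simp only [map_smul, LinearMap.smul_apply, hf]
    | hpush a =>
      induction b using push_induction ϑ with
      | h0 => simp
      | hadd f g hf hg => simp only [map_add, hf, hg]
      | hsmul s f hf => simp only [map_smul, hf]
      | hpush b =>
        rw [pushHom_push, pushHom_push, hbr, ← Φ.map_bracket, ← pushHom_push]
        congr 1
        exact pushBilin_push ϑ _ a b
  map_anchor a f := by
    induction a using push_induction ϑ with
    | h0 => simp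
    | hadd f g hf hg => simp only [map_add, LinearMap.add_apply, hf, hg]
    | hsmul s f hf => simp only [map_smul, LinearMap.smul_apply, hf]
    | hpush a =>
      induction f using push_induction (X := SmoothFun 𝕂 n M) ϑ with
      | h0 => simp
      | hadd f g hf hg => simp only [map_add, hf, hg]
      | hsmul s f hf => simp only [map_smul, hf]
      | hpush f =>
        rw [pushHom_push, pushAlg_push, han, pairing_push, ← Φ.map_anchor, ← pushAlg_push,
          ← pairing_push]
        congr 3
        exact pushHom_push ϑ _ a

variable (P : MatchedLiePair.{u, v} 𝕂 n M)

/-- An infinitesimal deformation of the Lie pair `(L, A)` parametrized by `R`: an `R`-ringed Lie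
algebroid `A_R` with centre the Lie algebroid `A`, and a morphism of `R`-ringed Lie algebroids
`I : A_R → L_R^0` with centre the inclusion `i : A → L`. -/
structure InfDef (R : ArtAlg.{w} 𝕂) where
  alg : RingedLieAlgebroid P.A R
  center_bracket : ∀ a b : Sec P.A,
    evMap R _ (alg.bracket (1 ⊗ₜ a) (1 ⊗ₜ b)) = P.lieA.bracket a b
  center_anchor : ∀ a : Sec P.A, evMap R _ (alg.anchor (1 ⊗ₜ a)) = P.lieA.anchor a
  I : RingedHom alg (P.lieL.cartesian R)
  center_I : ∀ a : Sec P.A, evMap R _ (I.toFun (1 ⊗ₜ a)) = P.i.onSec a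

variable {P}

theorem InfDef.ext' {D D' : InfDef P R} (h₁ : D.alg.bracket = D'.alg.bracket)
    (h₂ : D.alg.anchor = D'.alg.anchor) (h₃ : D.I.toFun = D'.I.toFun)
    (h₄ : D.I.base = D'.I.base) : D = D' := by
  obtain ⟨⟨b, a, _, _, _, _⟩, _, _, ⟨t, l, _, _, _, _⟩, _⟩ := D
  obtain ⟨⟨b', a', _, _, _, _⟩, _, _, ⟨t', l', _, _, _, _⟩, _⟩ := D'
  simp only at h₁ h₂ h₃ h₄
  subst h₁ h₂ h₃ h₄
  rfl

/-- The extension of scalars of an infinitesimal deformation along `ϑ : R → S`. -/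
def InfDef.push (D : InfDef P R) (ϑ : R →ₐ[𝕂] S) : InfDef P S where
  alg := D.alg.push ϑ
  center_bracket a b := by
    have h := D.center_bracket a b
    rw [← evMap_push ϑ, ← pushBilin_push, push_tmul, push_tmul, map_one] at h
    exact h
  center_anchor a := by
    have h := D.center_anchor a
    rw [← evMap_push ϑ, ← pushHom_push, push_tmul, map_one] at h
    exact h
  I := D.I.push ϑ (P.lieL.cartesian S) (fun a b => extBilin_push ϑ _ a b)
    (fun a => baseChange_push ϑ _ a)
  center_I a := by
    have h := D.center_I a
    rw [← evMap_push ϑ, ← pushHom_push, push_tmul, map_one] at h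
    exact h

variable (P) in
/-- The inclusion `Γ(B) ⊗ R → Γ(L) ⊗ R`. -/
def inclB (R : ArtAlg.{w} 𝕂) : R ⊗[𝕂] Sec P.B →ₗ[R] R ⊗[𝕂] Sec P.L :=
  (P.j.onSec.restrictScalars 𝕂).baseChange R

variable (P) in
/-- The inner derivation `L_b = [b, -]` of `L_R^0`, for `b ∈ Γ(B) ⊗ R`. -/
def innerB (R : ArtAlg.{w} 𝕂) (b : R ⊗[𝕂] Sec P.B) : Module.End R (R ⊗[𝕂] Sec P.L) :=
  (P.lieL.cartesian R).bracket (inclB P R b)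

variable (P) in
/-- The symbol of the inner derivation `L_b`: the derivation of `C^∞(M_R)` given by the anchor of
`b`. -/
def symbolB (R : ArtAlg.{w} 𝕂) (b : R ⊗[𝕂] Sec P.B) :
    Module.End R (R ⊗[𝕂] SmoothFun 𝕂 n M) :=
  pairing R ((P.lieL.cartesian R).anchor (inclB P R b))

/-- Isomorphism of infinitesimal deformations `D = (I, λ)` and `D' = (I', λ')` of the matched Lie
pair `A ⋈ B`: there are `b ∈ Γ(B) ⊗ 𝔪` and a morphism `Π : A_R' → A_R` of ringed Lie algebroids
with centre the identity of `A` such that `(exp(L_b), exp(ρ(b))) ∘ (I', λ') = (I, λ) ∘ Π`. -/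
def InfDef.Iso (D D' : InfDef P R) : Prop :=
  ∃ b ∈ maxPart R (Sec P.B), ∃ Φ : RingedHom D'.alg D.alg,
    (∀ a : Sec P.A, evMap R _ (Φ.toFun (1 ⊗ₜ a)) = a) ∧
    (∀ a, nilExp R (innerB P R b) (D'.I.toFun a) = D.I.toFun (Φ.toFun a)) ∧
    (∀ f, nilExp R (symbolB P R b) (D'.I.base f) = D.I.base (Φ.base f))

theorem inclB_push (ϑ : R →ₐ[𝕂] S) (b : R ⊗[𝕂] Sec P.B) :
    inclB P S (push _ ϑ b) = push _ ϑ (inclB P R b) :=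
  baseChange_push ϑ _ b

theorem innerB_push (ϑ : R →ₐ[𝕂] S) (b : R ⊗[𝕂] Sec P.B) (z : R ⊗[𝕂] Sec P.L) :
    innerB P S (push _ ϑ b) (push _ ϑ z) = push _ ϑ (innerB P R b z) := by
  unfold innerB
  rw [inclB_push]
  exact extBilin_push ϑ _ _ z

theorem symbolB_push (ϑ : R →ₐ[𝕂] S) (b : R ⊗[𝕂] Sec P.B) (f : R ⊗[𝕂] SmoothFun 𝕂 n M) :
    symbolB P S (push _ ϑ b) (push _ ϑ f) = push _ ϑ (symbolB P R b f) := by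
  unfold symbolB
  rw [inclB_push, ← pairing_push]
  congr 2
  exact baseChange_push ϑ _ _

theorem isNilpotent_innerB {b : R ⊗[𝕂] Sec P.B} (hb : b ∈ maxPart R (Sec P.B)) :
    IsNilpotent (innerB P R b) :=
  isNilpotent_extBilin _ (map_mem_maxPart _ hb)

theorem isNilpotent_symbolB {b : R ⊗[𝕂] Sec P.B} (hb : b ∈ maxPart R (Sec P.B)) :
    IsNilpotent (symbolB P R b) :=
  isNilpotent_extBilin _ (map_mem_maxPart _ (map_mem_maxPart _ hb))

theorem InfDef.Iso.push {D D' : InfDef P R} (h : D.Iso D') (ϑ : R →ₐ[𝕂] S) :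
    (D.push ϑ).Iso (D'.push ϑ) := by
  obtain ⟨b, hb, Φ, h₁, h₂, h₃⟩ := h
  refine ⟨LiePairs.push _ ϑ b, push_mem_maxPart ϑ hb,
    Φ.push ϑ (D.alg.push ϑ) (fun a b => pushBilin_push ϑ _ a b) (fun a => pushHom_push ϑ _ a),
    fun a => ?_, fun a => ?_, fun f => ?_⟩
  · have h := h₁ a
    rw [← evMap_push ϑ, ← pushHom_push, push_tmul, map_one] at h
    exact h
  · change nilExp S _ (pushHom ϑ D'.I.toFun a) = pushHom ϑ D.I.toFun (pushHom ϑ Φ.toFun a)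
    induction a using push_induction ϑ with
    | h0 => simp
    | hadd f g hf hg => simp only [map_add, hf, hg]
    | hsmul s f hf => simp only [map_smul, hf]
    | hpush a =>
      rw [pushHom_push, pushHom_push, pushHom_push, ← h₂]
      exact nilExp_push ϑ _ _ (isNilpotent_innerB hb)
        (isNilpotent_innerB (push_mem_maxPart ϑ hb)) (innerB_push ϑ b) _
  · change nilExp S _ (pushAlg ϑ D'.I.base f) = pushAlg ϑ D.I.base (pushAlg ϑ Φ.base f)
    induction f using push_induction (X := SmoothFun 𝕂 n M) ϑ with
    | h0 => simp
    | hadd f g hf hg => simp only [map_add, hf, hg]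
    | hsmul s f hf => simp only [map_smul, hf]
    | hpush f =>
      rw [pushAlg_push, pushAlg_push, pushAlg_push, ← h₃]
      exact nilExp_push ϑ _ _ (isNilpotent_symbolB hb)
        (isNilpotent_symbolB (push_mem_maxPart ϑ hb)) (symbolB_push ϑ b) _

variable (P) in
/-- The deformation functor `hDef_{A ⋈ B}` of the matched Lie pair `A ⋈ B`: it sends `R` to the set
of isomorphism classes of infinitesimal deformations parametrized by `R`. -/
def hDef : ArtAlg.{w} 𝕂 ⥤ Type (max u v w) where
  obj R := Quot (InfDef.Iso (P := P) (R := R))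
  map {R S} ϑ := TypeCat.ofHom (Quot.map (fun D => D.push (show R →ₐ[𝕂] S from ϑ))
    fun _ _ h => h.push _)
  map_id R := by
    ext x
    obtain ⟨D, rfl⟩ := Quot.exists_rep x
    exact congrArg (Quot.mk _) (InfDef.ext' (pushBilin_id _) (pushHom_id _) (pushHom_id _)
      (pushAlg_id _))
  map_comp {R S T} ϑ η := by
    ext x
    obtain ⟨D, rfl⟩ := Quot.exists_rep x
    exact congrArg (Quot.mk _) (InfDef.ext'
      (pushBilin_comp (show R →ₐ[𝕂] S from ϑ) (show S →ₐ[𝕂] T from η) _)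
      (pushHom_comp (show R →ₐ[𝕂] S from ϑ) (show S →ₐ[𝕂] T from η) _)
      (pushHom_comp (show R →ₐ[𝕂] S from ϑ) (show S →ₐ[𝕂] T from η) _)
      (pushAlg_comp (show R →ₐ[𝕂] S from ϑ) (show S →ₐ[𝕂] T from η) _))

/-! ### The basic dg Lie algebra -/

variable (P)

/-- `Ω_A^k(B) = Γ(Λ^k A^* ⊗ B)`, as the space of alternating `C^∞(M, 𝕂)`-multilinear maps
`Γ(A)^k → Γ(B)`. -/
abbrev BasicForm (k : ℕ) : Type (max u v) := Sec P.A [⋀^Fin k]→ₗ[SmoothFun 𝕂 n M] Sec P.B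

/-- The flat `A`-connection on `B`: `∇_a b = prB [a, b]`. -/
def connA (a : Sec P.A) (b : Sec P.B) : Sec P.B :=
  P.prB.onSec (P.lieL.bracket (P.i.onSec a) (P.j.onSec b))

/-- The flat `B`-connection on `A`: `∇_b a = prA [b, a]`. -/
def connB (b : Sec P.B) (a : Sec P.A) : Sec P.A :=
  P.prA.onSec (P.lieL.bracket (P.j.onSec b) (P.i.onSec a))

/-- The Chevalley-Eilenberg differential of `X ∈ Ω_A^k(B)`, evaluated at `a_0, …, a_k`. This is the
usual formula
`∑_i (-1)^i ∇_{a_i} X(…, â_i, …) + ∑_{i < l} (-1)^(i+l) X([a_i, a_l], …, â_i, …, â_l, …)`;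
in the second sum `[a_i, a_l]` has been moved to the place of `a_l`. -/
def ceDiff (k : ℕ) (X : BasicForm P k) (a : Fin (k + 1) → Sec P.A) : Sec P.B :=
  ∑ i : Fin (k + 1), (-1 : 𝕂) ^ (i : ℕ) • (connA P (a i) (X (a ∘ i.succAbove)) -
    ∑ l : Fin k, if i < i.succAbove l then
      X (Function.update (a ∘ i.succAbove) l (P.lieA.bracket (a i) (a (i.succAbove l)))) else 0)

/-- The bracket of `X ∈ Ω_A^p(B)` and `Y ∈ Ω_A^q(B)`, evaluated at `a_1, …, a_{p+q}`: the sum over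
`(p, q)`-shuffles `σ` (written as a sum over all permutations, divided by `p! q!`) of `sgn σ` times
`[X(a'), Y(a'')] - ∑_l Y(…, ∇_{X(a')} a''_l, …) + ∑_l X(…, ∇_{Y(a'')} a'_l, …)`
with `a' = (a_σ(1), …, a_σ(p))` and `a'' = (a_σ(p+1), …, a_σ(p+q))`. -/
def basicBracket (p q : ℕ) (X : BasicForm P p) (Y : BasicForm P q)
    (a : Fin (p + q) → Sec P.A) : Sec P.B :=
  ((p.factorial : 𝕂)⁻¹ * (q.factorial : 𝕂)⁻¹) • ∑ σ : Equiv.Perm (Fin (p + q)),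
    let a₁ : Fin p → Sec P.A := fun l => a (σ (Fin.castAdd q l))
    let a₂ : Fin q → Sec P.A := fun l => a (σ (Fin.natAdd p l))
    ((Equiv.Perm.sign σ : ℤ) : 𝕂) •
      (P.lieB.bracket (X a₁) (Y a₂)
        - ∑ l : Fin q, Y (Function.update a₂ l (connB P (X a₁) (a₂ l)))
        + ∑ l : Fin p, X (Function.update a₁ l (connB P (Y a₂) (a₁ l))))

end Deformations

end LiePairs

end

open LiePairs

namespace LiePairs

/-! ### Alternating forms of all degrees as functions on lists -/

section ListForms

/-! The dg Lie algebra. Alternating maps of `Γ(L)` to itself carry the insertion product `comp`. It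
is a graded right pre-Lie product (`assoc_symm`), so its commutator `nrBracket` satisfies the graded
Jacobi identity (`nrBracket_jacobi`). The bracket of `L` is a sum `D + D'` of two forms of degree
two: `D` is the bracket of the semidirect product of `A` with the `A`-module `B`, taken with zero
bracket, and `D'` is the same with `A` and `B` exchanged. Each of them squares to zero under
insertion, so the Jacobi identity of `L` reduces to `D ∘ D' + D' ∘ D = 0` (`comp_D_D_swap`). The
forms that vanish on `B` and take values in `B` form an abelian subalgebra (`comp_eq_zero`); these
are the elements of `Ω_A(B)`. Up to sign, `d X = [D, X]` and the bracket of `X` and `Y` is the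
derived bracket `[[D', X], Y]`. All dg Lie identities are then formal consequences. What remains is
that `D` and `D'` are linear over `𝕂` only: the anchor terms have to cancel for `d X` and the
bracket to be linear over functions (`dForm_mem`, `brForm_mem`). The explicit formulas are recovered
from Cartan's formula (`dForm_hat`) and from a comparison of sums over splittings of a list with
sums over permutations (`sum_perm_eq_shuffleSum`).

Deformations. A form `ξ` in `Ω_A^1(B) ⊗ 𝔪` has a graph `a ↦ a + ξ(a)` in `L_R`, and the
Maurer-Cartan equation says that this graph is closed under the bracket (`maurerCartan_iff`); a
Maurer-Cartan element thus gives a deformation `graphDef ξ`. Conversely, for a deformation `(A_R, I,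
λ)` the map `pr_A ∘ I` is the identity modulo `𝔪`, hence bijective because `𝔪` is nilpotent. The
image of `I` is therefore a graph, of a form that is linear over functions because `pr_A ∘ I` and
`pr_B ∘ I` are both semilinear along `λ`. Reparametrizing by `(pr_A ∘ I, λ)` identifies the
deformation with that of the graph (`iso_graphDef_mcOf`).

Gauge equivalence. The automorphism `exp([b, -])` carries the graph of `ξ` to the graph of `e^b * ξ`
(`exp_innerB_graphMap`). The action on `ξ` is affine; an extra scalar coordinate makes it linear,
and the claim becomes the exponential of a Leibniz rule (`innerB_affineAct`, `nilExp_bilin`). Hence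
isomorphism of deformations matches gauge equivalence. Since `ξ ↦ graphDef ξ` commutes with
extension of scalars on the nose, the bijection is natural. -/

/-- Alternating multilinear maps from `W` to `U` of all degrees at once, as functions on lists of
vectors. -/
def ListForm (𝕂 W U : Type*) [Field 𝕂] [AddCommGroup W] [Module 𝕂 W] [AddCommGroup U]
    [Module 𝕂 U] : Submodule 𝕂 (List W → U) where
  carrier := {f |
    (∀ l₁ l₂ x y, f (l₁ ++ (x + y) :: l₂) = f (l₁ ++ x :: l₂) + f (l₁ ++ y :: l₂)) ∧
    (∀ l₁ l₂ (c : 𝕂) x, f (l₁ ++ (c • x) :: l₂) = c • f (l₁ ++ x :: l₂)) ∧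
    ∀ l₁ l₂ x, f (l₁ ++ x :: x :: l₂) = 0}
  add_mem' {f g} hf hg := by
    refine ⟨fun l₁ l₂ x y => ?_, fun l₁ l₂ c x => ?_, fun l₁ l₂ x => ?_⟩
    · simp only [Pi.add_apply, hf.1, hg.1]
      abel
    · simp only [Pi.add_apply, hf.2.1, hg.2.1, smul_add]
    · simp only [Pi.add_apply, hf.2.2, hg.2.2, add_zero]
  zero_mem' := by simp
  smul_mem' k f hf := by
    refine ⟨fun l₁ l₂ x y => ?_, fun l₁ l₂ c x => ?_, fun l₁ l₂ x => ?_⟩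
    · simp only [Pi.smul_apply, hf.1, smul_add]
    · simp only [Pi.smul_apply, hf.2.1, smul_comm c k]
    · simp only [Pi.smul_apply, hf.2.2, smul_zero]

namespace ListForm

variable {𝕂 W U : Type*} [Field 𝕂] [AddCommGroup W] [Module 𝕂 W] [AddCommGroup U] [Module 𝕂 U]

instance : CoeFun (ListForm 𝕂 W U) fun _ => List W → U := ⟨Subtype.val⟩

@[ext] theorem ext {f g : ListForm 𝕂 W U} (h : ∀ l, f l = g l) : f = g :=
  Subtype.ext (funext h)

@[simp] theorem eval_add (f g : ListForm 𝕂 W U) (l : List W) : (f + g) l = f l + g l := rfl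
@[simp] theorem eval_sub (f g : ListForm 𝕂 W U) (l : List W) : (f - g) l = f l - g l := rfl
@[simp] theorem eval_neg (f : ListForm 𝕂 W U) (l : List W) : (-f) l = -f l := rfl
@[simp] theorem eval_zero (l : List W) : (0 : ListForm 𝕂 W U) l = 0 := rfl
@[simp] theorem eval_smul (c : 𝕂) (f : ListForm 𝕂 W U) (l : List W) : (c • f) l = c • f l := rfl

theorem neg_one_smul_eq (f : ListForm 𝕂 W U) : (-1 : 𝕂) • f = -f := ext fun l => by simp

theorem map_add_cons (f : ListForm 𝕂 W U) (x y : W) (l : List W) :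
    f ((x + y) :: l) = f (x :: l) + f (y :: l) := f.2.1 [] l x y

theorem map_smul_cons (f : ListForm 𝕂 W U) (c : 𝕂) (x : W) (l : List W) :
    f ((c • x) :: l) = c • f (x :: l) := f.2.2.1 [] l c x

theorem map_cons_cons_self (f : ListForm 𝕂 W U) (x : W) (l : List W) :
    f (x :: x :: l) = 0 := f.2.2.2 [] l x

theorem map_zero_cons (f : ListForm 𝕂 W U) (l : List W) : f (0 :: l) = 0 := by
  simpa using map_smul_cons f 0 0 l

theorem map_neg_cons (f : ListForm 𝕂 W U) (x : W) (l : List W) : f (-x :: l) = -f (x :: l) := by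
  simpa using map_smul_cons f (-1) x l

/-- Contraction `f ↦ f(w, -)` of forms with a vector. -/
def iota : W →ₗ[𝕂] ListForm 𝕂 W U →ₗ[𝕂] ListForm 𝕂 W U :=
  LinearMap.mk₂ 𝕂 (fun w f => ⟨fun l => f (w :: l), fun l₁ l₂ => f.2.1 (w :: l₁) l₂,
    fun l₁ l₂ => f.2.2.1 (w :: l₁) l₂, fun l₁ l₂ => f.2.2.2 (w :: l₁) l₂⟩)
    (fun x y f => ext fun l => map_add_cons f x y l)
    (fun c x f => ext fun l => map_smul_cons f c x l)
    (fun _ _ _ => rfl) (fun _ _ _ => rfl)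

@[simp] theorem iota_apply (w : W) (f : ListForm 𝕂 W U) (l : List W) :
    iota w f l = f (w :: l) := rfl

@[simp] theorem iota_self (w : W) (f : ListForm 𝕂 W U) : iota w (iota w f) = 0 :=
  ext fun l => map_cons_cons_self f w l

theorem iota_comm (x y : W) (f : ListForm 𝕂 W U) : iota x (iota y f) = -iota y (iota x f) := by
  have h := iota_self (x + y) f
  simp only [map_add, LinearMap.add_apply, iota_self, zero_add, add_zero] at h
  rw [eq_neg_iff_add_eq_zero, ← h, add_comm]

theorem map_cons_cons_swap (f : ListForm 𝕂 W U) (x y : W) (l : List W) :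
    f (x :: y :: l) = -f (y :: x :: l) := congrArg (fun g => g.1 l) (iota_comm y x f)

/-- The parity involution: multiplication by `(-1)^k` in degree `k`. -/
def eps : ListForm 𝕂 W U →ₗ[𝕂] ListForm 𝕂 W U where
  toFun f := ⟨fun l => (-1 : 𝕂) ^ l.length • f l, by
    refine ⟨fun l₁ l₂ x y => ?_, fun l₁ l₂ c x => ?_, fun l₁ l₂ x => ?_⟩
    · simp [f.2.1]
    · simp only [f.2.2.1, List.length_append, List.length_cons, smul_comm c]
    · simp [f.2.2.2]⟩
  map_add' f g := ext fun l => smul_add _ _ _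
  map_smul' c f := ext fun l => smul_comm _ _ _

theorem eps_apply (f : ListForm 𝕂 W U) (l : List W) :
    eps f l = (-1 : 𝕂) ^ l.length • f l := rfl

@[simp] theorem eps_nil (f : ListForm 𝕂 W U) : eps f [] = f [] := by simp [eps_apply]

@[simp] theorem eps_eps (f : ListForm 𝕂 W U) : eps (eps f) = f :=
  ext fun l => by simp [eps_apply, smul_smul, ← mul_pow]

theorem iota_eps (w : W) (f : ListForm 𝕂 W U) : iota w (eps f) = -eps (iota w f) :=
  ext fun l => by simp [eps_apply, pow_succ]

/-- The values of the insertion `f ∘ g`. -/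
def compFun : List W → ListForm 𝕂 W U → ListForm 𝕂 W W → U
  | [], f, g => f [g []]
  | w :: l, f, g => compFun l f (iota w g) - compFun l (iota w f) (eps g)

theorem compFun_add_left (l : List W) : ∀ (f f' : ListForm 𝕂 W U) (g : ListForm 𝕂 W W),
    compFun l (f + f') g = compFun l f g + compFun l f' g := by
  induction l with
  | nil => intro f f' g; rfl
  | cons w l ih =>
    intro f f' g
    simp only [compFun, map_add, ih]
    abel

theorem compFun_smul_left (l : List W) : ∀ (c : 𝕂) (f : ListForm 𝕂 W U) (g : ListForm 𝕂 W W),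
    compFun l (c • f) g = c • compFun l f g := by
  induction l with
  | nil => intro c f g; rfl
  | cons w l ih =>
    intro c f g
    simp only [compFun, map_smul, ih, smul_sub]

theorem compFun_add_right (l : List W) : ∀ (f : ListForm 𝕂 W U) (g g' : ListForm 𝕂 W W),
    compFun l f (g + g') = compFun l f g + compFun l f g' := by
  induction l with
  | nil => intro f g g'; exact map_add_cons f _ _ _
  | cons w l ih =>
    intro f g g'
    simp only [compFun, map_add, ih]
    abel

theorem compFun_smul_right (l : List W) : ∀ (c : 𝕂) (f : ListForm 𝕂 W U) (g : ListForm 𝕂 W W),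
    compFun l f (c • g) = c • compFun l f g := by
  induction l with
  | nil => intro c f g; exact map_smul_cons f _ _ _
  | cons w l ih =>
    intro c f g
    simp only [compFun, map_smul, ih, smul_sub]

theorem compFun_zero_left (l : List W) (g : ListForm 𝕂 W W) :
    compFun l (0 : ListForm 𝕂 W U) g = 0 := by
  simpa using compFun_smul_left l (0 : 𝕂) (0 : ListForm 𝕂 W U) g

theorem compFun_zero_right (l : List W) (f : ListForm 𝕂 W U) : compFun l f 0 = 0 := by
  simpa using compFun_smul_right l (0 : 𝕂) f 0

theorem compFun_neg_right (l : List W) (f : ListForm 𝕂 W U) (g : ListForm 𝕂 W W) :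
    compFun l f (-g) = -compFun l f g := by
  rw [← neg_one_smul 𝕂, compFun_smul_right, neg_one_smul]

theorem compFun_mem (f : ListForm 𝕂 W U) (g : ListForm 𝕂 W W) :
    (fun l => compFun l f g) ∈ ListForm 𝕂 W U := by
  refine ⟨fun l₁ l₂ x y => ?_, fun l₁ l₂ c x => ?_, fun l₁ l₂ x => ?_⟩
  · induction l₁ generalizing f g with
    | nil =>
      simp only [List.nil_append, compFun, map_add, LinearMap.add_apply, compFun_add_left,
        compFun_add_right]
      abel
    | cons w l ih =>
      simp only [List.cons_append, compFun, ih]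
      abel
  · induction l₁ generalizing f g with
    | nil =>
      simp only [List.nil_append, compFun, map_smul, LinearMap.smul_apply, compFun_smul_left,
        compFun_smul_right, smul_sub]
    | cons w l ih => simp only [List.cons_append, compFun, ih, smul_sub]
  · induction l₁ generalizing f g with
    | nil =>
      simp only [List.nil_append, compFun, iota_self, iota_eps, compFun_zero_left,
        compFun_zero_right, compFun_neg_right]
      simp
    | cons w l ih => simp only [List.cons_append, compFun, ih, sub_zero]

/-- The insertion `f ∘ g` of the form `g` into the first slot of the form `f`, antisymmetrized. -/
def comp : ListForm 𝕂 W U →ₗ[𝕂] ListForm 𝕂 W W →ₗ[𝕂] ListForm 𝕂 W U :=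
  LinearMap.mk₂ 𝕂 (fun f g => ⟨fun l => compFun l f g, compFun_mem f g⟩)
    (fun f f' g => ext fun l => compFun_add_left l f f' g)
    (fun c f g => ext fun l => compFun_smul_left l c f g)
    (fun f g g' => ext fun l => compFun_add_right l f g g')
    (fun c f g => ext fun l => compFun_smul_right l c f g)

@[simp] theorem comp_nil (f : ListForm 𝕂 W U) (g : ListForm 𝕂 W W) :
    comp f g [] = f [g []] := rfl

theorem comp_cons (f : ListForm 𝕂 W U) (g : ListForm 𝕂 W W) (w : W) (l : List W) :
    comp f g (w :: l) = comp f (iota w g) l - comp (iota w f) (eps g) l := rfl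

/-- The new argument goes either into `g`, or into `f` past the slot of `g` and all arguments of
`g`, whence the sign. Together with `comp_nil` this recursion determines `comp`, and identities for
`comp` follow from it by induction on the list of arguments. -/
theorem iota_comp (w : W) (f : ListForm 𝕂 W U) (g : ListForm 𝕂 W W) :
    iota w (comp f g) = comp f (iota w g) - comp (iota w f) (eps g) := rfl

/-- Insertion uses up one slot: degrees `p` and `q` give `p + q - 1`, which accounts for the minus
sign. -/
theorem eps_comp (f : ListForm 𝕂 W U) (g : ListForm 𝕂 W W) :
    eps (comp f g) = -comp (eps f) (eps g) := by
  ext l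
  induction l generalizing f g with
  | nil => simp [eps_apply]
  | cons w l ih =>
    have h : eps (comp f g) (w :: l) = -eps (iota w (comp f g)) l := by
      simp [eps_apply, pow_succ]
    rw [h, iota_comp, map_sub, eval_sub, ih, ih]
    simp only [eval_neg, comp_cons, iota_eps, map_neg, LinearMap.neg_apply, sub_neg_eq_add]

/-! ### The pre-Lie identity and the Nijenhuis-Richardson bracket. -/

/-- The associator of `comp`. -/
def assoc (f : ListForm 𝕂 W U) (g h : ListForm 𝕂 W W) : ListForm 𝕂 W U :=
  comp (comp f g) h - comp f (comp g h)

/-- Contraction distributes over the three factors of the associator with signs; this drives the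
induction in `assoc_symm`. -/
theorem iota_assoc (w : W) (f : ListForm 𝕂 W U) (g h : ListForm 𝕂 W W) :
    iota w (assoc f g h) =
      assoc f g (iota w h) - assoc f (iota w g) (eps h) + assoc (iota w f) (eps g) (eps h) := by
  simp only [assoc, map_sub, iota_comp, eps_comp, map_neg, LinearMap.sub_apply]
  abel

theorem assoc_smul_mid (c : 𝕂) (f : ListForm 𝕂 W U) (g h : ListForm 𝕂 W W) :
    assoc f (c • g) h = c • assoc f g h := by
  simp only [assoc, map_smul, LinearMap.smul_apply, smul_sub]

theorem assoc_smul_right (c : 𝕂) (f : ListForm 𝕂 W U) (g h : ListForm 𝕂 W W) :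
    assoc f g (c • h) = c • assoc f g h := by
  simp only [assoc, map_smul, smul_sub]

/-- Homogeneity is recorded only as a parity, so the lowered degree can be written `q + 1` instead
of a truncated `q - 1`. -/
theorem eps_iota_of_eps {f : ListForm 𝕂 W U} {q : ℕ} (hf : eps f = (-1 : 𝕂) ^ q • f) (w : W) :
    eps (iota w f) = (-1 : 𝕂) ^ (q + 1) • iota w f := by
  have h := iota_eps w f
  rw [hf, map_smul] at h
  rw [pow_succ', mul_smul, h, neg_one_smul, neg_neg]

theorem eq_zero_of_eps [CharZero 𝕂] {f : ListForm 𝕂 W U} {q : ℕ}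
    (hf : eps f = (-1 : 𝕂) ^ q • f) {l : List W} (hl : ¬ Even (q + l.length)) : f l = 0 := by
  have h := congrArg (fun k => (-1 : 𝕂) ^ q • k.1 l) hf
  simp only [eval_smul, eps_apply, smul_smul, ← pow_add] at h
  rw [(Nat.not_even_iff_odd.1 hl).neg_one_pow, (Even.add_self q).neg_one_pow, one_smul,
    neg_one_smul] at h
  have h2 : (2 : 𝕂) • f l = 0 := by
    rw [two_smul]
    nth_rw 1 [← h]
    exact neg_add_cancel _
  exact (smul_eq_zero.1 h2).resolve_left two_ne_zero

/-- The insertion is a graded (right) pre-Lie product. -/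
theorem assoc_symm [CharZero 𝕂] (f : ListForm 𝕂 W U) (g h : ListForm 𝕂 W W) (q r : ℕ)
    (hg : eps g = (-1 : 𝕂) ^ q • g) (hh : eps h = (-1 : 𝕂) ^ r • h) :
    assoc f g h = (-1 : 𝕂) ^ ((q + 1) * (r + 1)) • assoc f h g := by
  ext l
  induction l generalizing f g h q r with
  | nil =>
    have key : ∀ (g h : ListForm 𝕂 W W), assoc f g h [] = -f [h [], g []] := by
      intro g h
      simp [assoc, comp_cons]
    rw [eval_smul, key, key, map_cons_cons_swap]
    -- On the empty list the claim is the antisymmetry of `f` in the vectors `g []` and `h []`. The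
    -- sign is `-1` exactly if `q` and `r` are even; for an odd parity the corresponding vector is
    -- zero.
    by_cases hq : Even q
    · by_cases hr : Even r
      · rw [(hq.add_one.mul hr.add_one).neg_one_pow]
        simp
      · rw [eq_zero_of_eps (l := []) hh (by simpa using hr), map_cons_cons_swap, map_zero_cons]
        simp
    · rw [eq_zero_of_eps (l := []) hg (by simpa using hq), map_zero_cons]
      simp
  | cons w l ih =>
    rw [← iota_apply, ← iota_apply, map_smul, iota_assoc, iota_assoc]
    simp only [eval_add, eval_sub, eval_smul]
    -- Contraction yields three instances of the claim, with parities `(q, r + 1)`, `(q + 1, r)` and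
    -- `(q, r)`.
    rw [ih _ _ _ _ _ hg (eps_iota_of_eps hh w), hg, hh]
    simp only [assoc_smul_mid, assoc_smul_right, eval_smul]
    rw [ih f (iota w g) h _ _ (eps_iota_of_eps hg w) hh, ih (iota w f) g h _ _ hg hh]
    rcases Nat.even_or_odd q with hq | hq <;> rcases Nat.even_or_odd r with hr | hr <;>
      simp [pow_add, pow_mul, hq.neg_one_pow, hr.neg_one_pow] <;> abel

/-- The Nijenhuis-Richardson bracket of forms of degree `x` and `y` with values in `W`. -/
def nrBracket (x y : ℕ) (f g : ListForm 𝕂 W W) : ListForm 𝕂 W W :=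
  comp f g - (-1 : 𝕂) ^ ((x + 1) * (y + 1)) • comp g f

theorem nrBracket_swap (x y : ℕ) (f g : ListForm 𝕂 W W) :
    nrBracket x y f g = -((-1 : 𝕂) ^ ((x + 1) * (y + 1)) • nrBracket y x g f) := by
  simp only [nrBracket, smul_sub, smul_smul, mul_comm (y + 1) (x + 1), ← pow_add,
    (Even.add_self _).neg_one_pow, one_smul, neg_sub]

/-- The labels enter through a sign only. A bracket of degree `x + y - 1` may therefore be labelled
`x + y + 1`, which avoids subtraction. -/
theorem nrBracket_congr {x x' y y' : ℕ} (hx : Even (x + x')) (hy : Even (y + y'))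
    (f g : ListForm 𝕂 W W) : nrBracket x y f g = nrBracket x' y' f g := by
  rw [nrBracket, nrBracket]
  congr 2
  rw [neg_one_pow_congr]
  simp only [Nat.even_mul, Nat.even_add_one]
  rw [Nat.even_add] at hx hy
  rw [hx, hy]

/-- As for every pre-Lie product, the Jacobi identity of the commutator is a combination of three
symmetries of the associator, one with each of `f`, `g`, `h` as the outer factor. -/
theorem nrBracket_jacobi [CharZero 𝕂] {x y z : ℕ} {f g h : ListForm 𝕂 W W}
    (hf : eps f = (-1 : 𝕂) ^ x • f) (hg : eps g = (-1 : 𝕂) ^ y • g)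
    (hh : eps h = (-1 : 𝕂) ^ z • h) :
    nrBracket x (y + z + 1) f (nrBracket y z g h) =
      nrBracket (x + y + 1) z (nrBracket x y f g) h +
        (-1 : 𝕂) ^ ((x + 1) * (y + 1)) • nrBracket y (x + z + 1) g (nrBracket x z f h) := by
  have h1 := assoc_symm f g h y z hg hh
  have h2 := assoc_symm g f h x z hf hh
  have h3 := assoc_symm h f g x y hf hg
  have e1 : (-1 : 𝕂) ^ ((x + 1) * (y + z + 1 + 1)) =
      (-1) ^ ((x + 1) * (y + 1)) * (-1) ^ ((x + 1) * (z + 1)) := by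
    rw [← pow_add]; congr 1; ring
  have e2 : (-1 : 𝕂) ^ ((x + y + 1 + 1) * (z + 1)) =
      (-1) ^ ((y + 1) * (z + 1)) * (-1) ^ ((x + 1) * (z + 1)) := by
    rw [← pow_add]; congr 1; ring
  have e3 : (-1 : 𝕂) ^ ((y + 1) * (x + z + 1 + 1)) =
      (-1) ^ ((x + 1) * (y + 1)) * (-1) ^ ((y + 1) * (z + 1)) := by
    rw [← pow_add]; congr 1; ring
  have e4 : (-1 : 𝕂) ^ ((x + 1) * (y + 1)) * (-1) ^ ((x + 1) * (y + 1)) = 1 := by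
    rw [← pow_add, (Even.add_self _).neg_one_pow]
  simp only [assoc] at h1 h2 h3
  simp only [nrBracket, map_sub, map_smul, LinearMap.sub_apply, LinearMap.smul_apply, e1, e2, e3]
  -- With the three signs and the twelve double insertions as unknowns, the identity becomes linear
  -- in the latter.
  generalize (-1 : 𝕂) ^ ((x + 1) * (y + 1)) = a at *
  generalize (-1 : 𝕂) ^ ((x + 1) * (z + 1)) = c at *
  generalize (-1 : 𝕂) ^ ((y + 1) * (z + 1)) = b at *
  rw [smul_sub a, smul_smul a (a * b), ← mul_assoc, e4, one_mul]
  generalize comp (comp f g) h = u1 at *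
  generalize comp f (comp g h) = u2 at *
  generalize comp (comp f h) g = u3 at *
  generalize comp f (comp h g) = u4 at *
  generalize comp (comp g f) h = u5 at *
  generalize comp g (comp f h) = u6 at *
  generalize comp (comp g h) f = u7 at *
  generalize comp g (comp h f) = u8 at *
  generalize comp (comp h f) g = u9 at *
  generalize comp h (comp f g) = v1 at *
  generalize comp (comp h g) f = v2 at *
  generalize comp h (comp g f) = v3 at *
  linear_combination (norm := module) -h1 + a • h2 - (b * c) • h3

end ListForm

end ListForms

end LiePairs


namespace LiePairs

/-! ### Shuffle sums and sums over permutations -/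

section Shuffles

variable {𝕂 W U : Type*} [Field 𝕂] [AddCommGroup U] [Module 𝕂 U]

variable (𝕂) in
/-- The signed sum of `F l' l''` over all ways to split the list `l` into two sublists. -/
def shuffleSum : List W → (List W → List W → U) → U
  | [], F => F [] []
  | w :: l, F => shuffleSum l (fun a b => F (w :: a) b) +
      shuffleSum l (fun a b => (-1 : 𝕂) ^ a.length • F a (w :: b))

theorem shuffleSum_add (l : List W) (F G : List W → List W → U) :
    shuffleSum 𝕂 l (fun a b => F a b + G a b) = shuffleSum 𝕂 l F + shuffleSum 𝕂 l G := by
  induction l generalizing F G with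
  | nil => rfl
  | cons w l ih =>
    simp only [shuffleSum, smul_add, ih]
    abel

theorem shuffleSum_smul (l : List W) (c : 𝕂) (F : List W → List W → U) :
    shuffleSum 𝕂 l (fun a b => c • F a b) = c • shuffleSum 𝕂 l F := by
  induction l generalizing F with
  | nil => rfl
  | cons w l ih => simp only [shuffleSum, smul_comm _ c, ih, smul_add]

theorem shuffleSum_neg (l : List W) (F : List W → List W → U) :
    shuffleSum 𝕂 l (fun a b => -F a b) = -shuffleSum 𝕂 l F := by
  simpa using shuffleSum_smul l (-1 : 𝕂) F

theorem shuffleSum_sub (l : List W) (F G : List W → List W → U) :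
    shuffleSum 𝕂 l (fun a b => F a b - G a b) = shuffleSum 𝕂 l F - shuffleSum 𝕂 l G := by
  simp only [sub_eq_add_neg, shuffleSum_add, shuffleSum_neg]

theorem shuffleSum_zero (l : List W) : shuffleSum 𝕂 l (fun _ _ => (0 : U)) = 0 := by
  simpa using shuffleSum_smul l (0 : 𝕂) (fun _ _ => (0 : U))

theorem map_shuffleSum {U' : Type*} [AddCommGroup U'] [Module 𝕂 U'] (φ : U →ₗ[𝕂] U')
    (l : List W) (F : List W → List W → U) :
    φ (shuffleSum 𝕂 l F) = shuffleSum 𝕂 l fun a b => φ (F a b) := by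
  induction l generalizing F with
  | nil => rfl
  | cons w l ih => simp only [shuffleSum, map_add, ih, map_smul]

theorem shuffleSum_congr (l : List W) (F G : List W → List W → U)
    (h : ∀ a b, a.length + b.length = l.length → F a b = G a b) :
    shuffleSum 𝕂 l F = shuffleSum 𝕂 l G := by
  induction l generalizing F G with
  | nil => exact h [] [] rfl
  | cons w l ih =>
    refine congrArg₂ (· + ·) (ih _ _ fun a b hab => h _ _ ?_)
      (ih _ _ fun a b hab => congrArg _ (h _ _ ?_))
    · rw [List.length_cons, List.length_cons, ← hab, add_right_comm]
    · rw [List.length_cons, List.length_cons, ← hab, add_assoc]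

/-- Exchanging the two blocks of a splitting moves every entry of one past every entry of the other.
-/
theorem shuffleSum_flip (l : List W) (F : List W → List W → U) :
    shuffleSum 𝕂 l (fun a b => (-1 : 𝕂) ^ (a.length * b.length) • F b a) =
      shuffleSum 𝕂 l F := by
  induction l generalizing F with
  | nil => simp [shuffleSum]
  | cons w l ih =>
    rw [shuffleSum, shuffleSum, ← ih (fun a b => F (w :: a) b),
      ← ih (fun a b => (-1 : 𝕂) ^ a.length • F a (w :: b)), add_comm]
    congr 2
    · funext a b
      rw [smul_smul, ← pow_add, List.length_cons]
      congr 1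
      rw [neg_one_pow_congr]
      simp only [Nat.even_add, Nat.even_mul, Nat.even_add_one]
      tauto
    · funext a b
      rw [smul_smul, ← pow_add, List.length_cons]
      congr 2
      ring

/-- The closed form of the recursion `comp_cons`: an entry placed in the second block must pass the
value of `g` as well, which turns the minus sign of the recursion into a plus. -/
theorem ListForm.comp_eq_shuffleSum [AddCommGroup W] [Module 𝕂 W] (f : ListForm 𝕂 W U) (g : ListForm 𝕂 W W) (l : List W) :
    ListForm.comp f g l = shuffleSum 𝕂 l fun a b => f (g a :: b) := by
  induction l generalizing f g with
  | nil => rfl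
  | cons w l ih =>
    rw [comp_cons, ih, ih, sub_eq_add_neg, ← shuffleSum_neg, shuffleSum]
    congr 2
    funext a b
    rw [iota_apply, map_cons_cons_swap, eps_apply, map_smul_cons, neg_neg]

/-! ### From sums over permutations to sums over splittings. -/

/-- A function on lists that changes its sign under transpositions of neighbours. -/
def IsSkew (h : List W → U) : Prop :=
  ∀ l₁ x y l₂, h (l₁ ++ x :: y :: l₂) = -h (l₁ ++ y :: x :: l₂)

theorem IsSkew.cons {h : List W → U} (hh : IsSkew h) (y : W) : IsSkew fun l => h (y :: l) :=
  fun l₁ => hh (y :: l₁)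

theorem ListForm.isSkew [AddCommGroup W] [Module 𝕂 W] (f : ListForm 𝕂 W U) : IsSkew f.1 := by
  intro l₁ x y l₂
  induction l₁ generalizing f with
  | nil => exact map_cons_cons_swap f x y l₂
  | cons w l ih => exact ih (iota w f)

theorem IsSkew.map_insertIdx {h : List W → U} (hh : IsSkew h) (i : ℕ) (l : List W)
    (hi : i ≤ l.length) (x : W) : h (l.insertIdx i x) = (-1 : 𝕂) ^ i • h (x :: l) := by
  induction i generalizing h l with
  | zero => simp
  | succ i ih =>
    obtain _ | ⟨y, l⟩ := l
    · simp at hi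
    · rw [List.insertIdx_succ_cons, ih (hh.cons y) l (by simpa using hi), pow_succ,
        mul_neg_one, neg_smul, ← smul_neg]
      congr 1
      exact hh [] y x l

/-- An entry inserted in the first block is moved to the front of that block; `map_insertIdx_of_ge`
does the same for the second block. -/
theorem map_insertIdx_of_le {F : List W → List W → U} (h₁ : ∀ b, IsSkew fun a => F a b)
    (p i : ℕ) (hi : i ≤ p) (l : List W) (hl : p ≤ l.length) (x : W) :
    F ((l.insertIdx i x).take (p + 1)) ((l.insertIdx i x).drop (p + 1)) =
      (-1 : 𝕂) ^ i • F (x :: l.take p) (l.drop p) := by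
  induction i generalizing p l F with
  | zero => simp
  | succ i ih =>
    obtain _ | p := p
    · simp at hi
    obtain _ | ⟨y, l⟩ := l
    · simp at hl
    · rw [List.insertIdx_succ_cons, List.take_succ_cons, List.drop_succ_cons,
        ih (F := fun a b => F (y :: a) b) (fun b => (h₁ b).cons y) p (by simpa using hi) l
          (by simpa using hl), pow_succ, mul_neg_one, neg_smul, ← smul_neg,
          List.take_succ_cons, List.drop_succ_cons]
      congr 1
      exact h₁ _ [] y x _

theorem map_insertIdx_of_ge {F : List W → List W → U} (h₂ : ∀ a, IsSkew (F a))
    (p i : ℕ) (l : List W) (hl : p + i ≤ l.length) (x : W) :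
    F ((l.insertIdx (p + i) x).take p) ((l.insertIdx (p + i) x).drop p) =
      (-1 : 𝕂) ^ i • F (l.take p) (x :: l.drop p) := by
  induction p generalizing l F with
  | zero =>
    simp only [zero_add, List.take_zero, List.drop_zero]
    exact (h₂ []).map_insertIdx i l (by simpa using hl) x
  | succ p ih =>
    obtain _ | ⟨y, l⟩ := l
    · simp at hl
    · rw [show p + 1 + i = (p + i) + 1 by ring, List.insertIdx_succ_cons, List.take_succ_cons,
        List.drop_succ_cons, ih (F := fun a b => F (y :: a) b) (fun a => h₂ _) l
          (by simp at hl; omega), List.take_succ_cons, List.drop_succ_cons]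

theorem ofFn_insertNth {n : ℕ} (i : Fin (n + 1)) (x : W) (v : Fin n → W) :
    List.ofFn (i.insertNth (α := fun _ => W) x v) = (List.ofFn v).insertIdx i x := by
  induction n with
  | zero =>
    obtain rfl : i = 0 := Fin.eq_zero i
    simp
  | succ n ih =>
    refine Fin.cases ?_ (fun i => ?_) i
    · simp
    · rw [← Fin.cons_self_tail v, List.ofFn_cons, Fin.val_succ, List.insertIdx_succ_cons, ← ih]
      rw [← List.ofFn_cons]
      congr 1
      exact Fin.insertNth_succ_cons i x (v 0) (Fin.tail v)

/-- A permutation is determined by the place `i` that it sends to `0` and by what it does to the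
other places. Injectivity suffices, as both sides have `(n + 1)!` elements. -/
theorem bijective_perm_fin_succ (n : ℕ) :
    Function.Bijective fun ie : Fin (n + 1) × Equiv.Perm (Fin n) =>
      Equiv.Perm.decomposeFin.symm (0, ie.2) * ie.1.cycleRange := by
  rw [Fintype.bijective_iff_injective_and_card]
  constructor
  · rintro ⟨i, e⟩ ⟨i', e'⟩ h
    have h0 := congrArg (fun σ : Equiv.Perm (Fin (n + 1)) => σ i) h
    simp only [Equiv.Perm.mul_apply, Fin.cycleRange_self,
      Equiv.Perm.decomposeFin_symm_apply_zero] at h0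
    have h1 : i = i' := by
      apply i'.cycleRange.injective
      apply (Equiv.Perm.decomposeFin.symm (0, e')).injective
      rw [← h0, Fin.cycleRange_self, Equiv.Perm.decomposeFin_symm_apply_zero]
    subst h1
    have h2 := Equiv.Perm.decomposeFin.symm.injective (mul_right_cancel h)
    rw [Prod.mk.injEq] at h2 ⊢
    exact ⟨rfl, h2.2⟩
  · simp [Fintype.card_perm, Nat.factorial_succ]

/-- Sorts the permutations by the place `i` at which `x` ends up. -/
theorem sum_perm_fin_succ {n : ℕ} (G : List W → U) (x : W) (v : Fin n → W) :
    ∑ σ : Equiv.Perm (Fin (n + 1)), ((Equiv.Perm.sign σ : ℤ) : 𝕂) •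
      G (List.ofFn ((Fin.cons x v : Fin (n + 1) → W) ∘ σ)) =
    ∑ i : Fin (n + 1), ∑ e : Equiv.Perm (Fin n), ((Equiv.Perm.sign e : ℤ) : 𝕂) •
      (-1 : 𝕂) ^ (i : ℕ) • G ((List.ofFn (v ∘ e)).insertIdx i x) := by
  rw [← (bijective_perm_fin_succ n).sum_comp, Fintype.sum_prod_type]
  refine Finset.sum_congr rfl fun i _ => Finset.sum_congr rfl fun e _ => ?_
  have h : (Fin.cons x v : Fin (n + 1) → W) ∘ Equiv.Perm.decomposeFin.symm (0, e) =
      Fin.cons x (v ∘ e) := by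
    funext j
    refine Fin.cases ?_ (fun j => ?_) j
    · simp
    · simp
  rw [Equiv.Perm.coe_mul, ← Function.comp_assoc, h, Fin.cons_comp_cycleRange, ofFn_insertNth,
    smul_smul]
  congr 1
  simp [Equiv.Perm.decomposeFin.symm_sign, Fin.sign_cycleRange]

/-- Every splitting into blocks of `p` and `q` entries comes from `p! q!` permutations, with equal
contributions as `F` is skew in each block. The induction follows the first argument, which lands in
one of `p` places of the first block or one of `q` places of the second. -/
theorem sum_perm_eq_shuffleSum {n : ℕ} (p q : ℕ) (h : p + q = n) (F : List W → List W → U)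
    (h₁ : ∀ b, IsSkew fun a => F a b) (h₂ : ∀ a, IsSkew (F a))
    (hp : ∀ a b, a.length ≠ p → F a b = 0) (a : Fin n → W) :
    ∑ σ : Equiv.Perm (Fin n), ((Equiv.Perm.sign σ : ℤ) : 𝕂) •
      F ((List.ofFn (a ∘ σ)).take p) ((List.ofFn (a ∘ σ)).drop p) =
    ((p.factorial : 𝕂) * q.factorial) • shuffleSum 𝕂 (List.ofFn a) F := by
  induction n generalizing p q F with
  | zero =>
    obtain ⟨rfl, rfl⟩ : p = 0 ∧ q = 0 := by omega
    simp [shuffleSum]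
  | succ n ih =>
    obtain ⟨x, v, rfl⟩ : ∃ x v, a = Fin.cons x v := ⟨a 0, Fin.tail a, (Fin.cons_self_tail a).symm⟩
    rw [sum_perm_fin_succ (fun l => F (l.take p) (l.drop p)), List.ofFn_cons, shuffleSum, smul_add]
    -- For `p = 0` the truncated `p - 1` is harmless: the right side has the factor `0` and the left
    -- side vanishes by `hp`.
    have hA : ((p.factorial : 𝕂) * q.factorial) •
          shuffleSum 𝕂 (List.ofFn v) (fun a b => F (x :: a) b) =
        (p : 𝕂) • ∑ e : Equiv.Perm (Fin n), ((Equiv.Perm.sign e : ℤ) : 𝕂) •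
          F (x :: (List.ofFn (v ∘ e)).take (p - 1)) ((List.ofFn (v ∘ e)).drop (p - 1)) := by
      obtain _ | p := p
      · simp [hp, shuffleSum_zero]
      · rw [Nat.add_sub_cancel, ih p q (by omega) (fun a b => F (x :: a) b)
          (fun b => (h₁ b).cons x) (fun a => h₂ _)
          (fun a b hab => hp _ _ (by simpa using hab)) v, smul_smul, Nat.factorial_succ]
        push_cast
        rw [mul_assoc]
    have hB : ((p.factorial : 𝕂) * q.factorial) •
          shuffleSum 𝕂 (List.ofFn v) (fun a b => (-1 : 𝕂) ^ a.length • F a (x :: b)) =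
        (q : 𝕂) • ∑ e : Equiv.Perm (Fin n), ((Equiv.Perm.sign e : ℤ) : 𝕂) • (-1 : 𝕂) ^ p •
          F ((List.ofFn (v ∘ e)).take p) (x :: (List.ofFn (v ∘ e)).drop p) := by
      -- Only first blocks of length `p` contribute, so the sign may be taken constant; this makes
      -- the induction hypothesis applicable.
      have hF : (fun a b => (-1 : 𝕂) ^ a.length • F a (x :: b)) =
          fun a b => (-1 : 𝕂) ^ p • F a (x :: b) := by
        funext a b
        by_cases hab : a.length = p
        · rw [hab]
        · rw [hp _ _ hab, smul_zero, smul_zero]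
      rw [hF]
      obtain _ | q := q
      · rw [shuffleSum_congr _ _ (fun _ _ => 0) fun a b hab => ?_, shuffleSum_zero]
        · simp
        · rw [hp _ _ ?_, smul_zero]
          rw [List.length_ofFn] at hab
          omega
      · rw [ih p q (by omega) (fun a b => (-1 : 𝕂) ^ p • F a (x :: b)) ?_ ?_ ?_ v,
          smul_smul, Nat.factorial_succ]
        · push_cast
          congr 1
          ring
        · intro b l₁ y z l₂
          simp only [h₁ (x :: b) l₁ y z l₂, smul_neg]
        · intro a l₁ y z l₂
          simp only [h₂ a (x :: l₁) y z l₂, smul_neg, ← List.cons_append]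
        · intro a b hab
          simp only [hp _ _ hab, smul_zero]
    rw [hA, hB]
    -- Moving `x` to the front of its block cancels the sign `(-1)^i` in the first block and leaves
    -- `(-1)^p` in the second, so the contribution depends on the block only.
    have hi : ∀ i : Fin (n + 1), ∑ e : Equiv.Perm (Fin n), ((Equiv.Perm.sign e : ℤ) : 𝕂) •
        (-1 : 𝕂) ^ (i : ℕ) • F (((List.ofFn (v ∘ e)).insertIdx i x).take p)
          (((List.ofFn (v ∘ e)).insertIdx i x).drop p) =
        if (i : ℕ) < p then ∑ e : Equiv.Perm (Fin n), ((Equiv.Perm.sign e : ℤ) : 𝕂) •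
          F (x :: (List.ofFn (v ∘ e)).take (p - 1)) ((List.ofFn (v ∘ e)).drop (p - 1))
        else ∑ e : Equiv.Perm (Fin n), ((Equiv.Perm.sign e : ℤ) : 𝕂) • (-1 : 𝕂) ^ p •
          F ((List.ofFn (v ∘ e)).take p) (x :: (List.ofFn (v ∘ e)).drop p) := by
      intro i
      split_ifs with hip
      · refine Finset.sum_congr rfl fun e _ => ?_
        obtain _ | p := p
        · simp at hip
        · rw [map_insertIdx_of_le (𝕂 := 𝕂) h₁ p i (by omega) _ (by simp; omega) x, smul_smul (_ ^ _),
            ← pow_add, (Even.add_self _).neg_one_pow, one_smul, Nat.add_sub_cancel]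
      · refine Finset.sum_congr rfl fun e _ => ?_
        obtain ⟨j, hj⟩ := Nat.exists_eq_add_of_le (not_lt.1 hip)
        rw [hj, map_insertIdx_of_ge (𝕂 := 𝕂) h₂ p j _ (by simp; omega) x, smul_smul (_ ^ _),
          ← pow_add, add_assoc, pow_add, (Even.add_self j).neg_one_pow, mul_one]
    rw [Finset.sum_congr rfl fun i _ => hi i, Finset.sum_ite, Finset.sum_const, Finset.sum_const,
      ← Nat.cast_smul_eq_nsmul 𝕂, ← Nat.cast_smul_eq_nsmul 𝕂]
    have c1 : (Finset.univ.filter fun i : Fin (n + 1) => (i : ℕ) < p).card = p := by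
      rw [Fin.card_filter_val_lt]
      omega
    have c2 : (Finset.univ.filter fun i : Fin (n + 1) => ¬ (i : ℕ) < p).card = q := by
      have := Finset.card_filter_add_card_filter_not (s := Finset.univ)
        (fun i : Fin (n + 1) => (i : ℕ) < p)
      rw [c1, Finset.card_univ, Fintype.card_fin] at this
      omega
    rw [c1, c2]

end Shuffles

end LiePairs


namespace LiePairs

namespace ListForm

/-! ### Homogeneous forms and forms of degree at most two. -/

section Arity

variable {𝕂 W U : Type*} [Field 𝕂] [AddCommGroup W] [Module 𝕂 W] [AddCommGroup U] [Module 𝕂 U]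

/-- The form `f` is homogeneous of degree `p`. -/
def HasDegree (f : ListForm 𝕂 W U) (p : ℕ) : Prop := ∀ l, l.length ≠ p → f l = 0

theorem HasDegree.eps_eq {f : ListForm 𝕂 W U} {p : ℕ} (hf : HasDegree f p) :
    eps f = (-1 : 𝕂) ^ p • f := by
  ext l
  rw [eps_apply, eval_smul]
  by_cases hl : l.length = p
  · rw [hl]
  · rw [hf l hl, smul_zero, smul_zero]

theorem HasDegree.iota {f : ListForm 𝕂 W U} {p : ℕ} (hf : HasDegree f (p + 1)) (w : W) :
    HasDegree (iota w f) p := fun l hl => hf _ (by simpa using hl)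

theorem HasDegree.comp {f : ListForm 𝕂 W U} {g : ListForm 𝕂 W W} {p q r : ℕ}
    (hf : HasDegree f p) (hg : HasDegree g q) (h : p + q = r + 1) :
    HasDegree (ListForm.comp f g) r := by
  intro l hl
  rw [comp_eq_shuffleSum, shuffleSum_congr _ _ (fun _ _ => 0) fun a b hab => ?_, shuffleSum_zero]
  by_cases ha : a.length = q
  · rw [hf]
    rw [List.length_cons]
    omega
  · rw [hg a ha, map_zero_cons]

theorem comp_of_degree_zero (f : ListForm 𝕂 W U) {g : ListForm 𝕂 W W} (hg : HasDegree g 0) :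
    comp f g = iota (g []) f := by
  ext l
  induction l generalizing f with
  | nil => rfl
  | cons w l ih =>
    have h : iota w g = 0 := ext fun l => hg _ (by simp)
    rw [comp_cons, hg.eps_eq, pow_zero, one_smul, ih, h, map_zero, eval_zero, zero_sub,
      iota_apply, iota_apply, iota_apply, map_cons_cons_swap, neg_neg]

/-- The form `f` has no slot left for further arguments, so they all go into `g`. -/
theorem comp_of_degree_one {f : ListForm 𝕂 W U} (hf : HasDegree f 1) (g : ListForm 𝕂 W W)
    (l : List W) : comp f g l = f [g l] := by
  induction l generalizing g with
  | nil => rfl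
  | cons w l ih =>
    rw [comp_cons, ih, iota_apply, comp_eq_shuffleSum,
      shuffleSum_congr _ _ (fun _ _ => 0) fun a b hab => ?_, shuffleSum_zero, sub_zero]
    exact hf _ (by simp)

/-- Insertion of an endomorphism `g` acts as a derivation: `g` is applied to each argument in turn.
-/
theorem comp_cons_of_degree_one (f : ListForm 𝕂 W U) {g : ListForm 𝕂 W W} (hg : HasDegree g 1)
    (w : W) (l : List W) : comp f g (w :: l) = f (g [w] :: l) + comp (iota w f) g l := by
  rw [comp_cons, comp_of_degree_zero f (hg.iota w), hg.eps_eq]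
  simp

/-- The form of degree two given by an alternating bilinear map. -/
def ofBilin (β : W →ₗ[𝕂] W →ₗ[𝕂] U) (hβ : ∀ x, β x x = 0) : ListForm 𝕂 W U :=
  ⟨fun l => match l with
    | [x, y] => β x y
    | _ => 0, by
    refine ⟨fun l₁ l₂ x y => ?_, fun l₁ l₂ c x => ?_, fun l₁ l₂ x => ?_⟩
    · rcases l₁ with _ | ⟨a, _ | ⟨b, l₁⟩⟩ <;> rcases l₂ with _ | ⟨c, _ | ⟨d, l₂⟩⟩ <;> simp
    · rcases l₁ with _ | ⟨a, _ | ⟨b, l₁⟩⟩ <;> rcases l₂ with _ | ⟨c, _ | ⟨d, l₂⟩⟩ <;> simp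
    · rcases l₁ with _ | ⟨a, _ | ⟨b, l₁⟩⟩ <;> rcases l₂ with _ | ⟨c, _ | ⟨d, l₂⟩⟩ <;> simp [hβ]⟩

theorem ofBilin_apply (β : W →ₗ[𝕂] W →ₗ[𝕂] U) (hβ : ∀ x, β x x = 0) (x y : W) :
    ofBilin β hβ [x, y] = β x y := rfl

theorem hasDegree_ofBilin (β : W →ₗ[𝕂] W →ₗ[𝕂] U) (hβ : ∀ x, β x x = 0) :
    HasDegree (ofBilin β hβ) 2 := by
  intro l hl
  rcases l with _ | ⟨a, _ | ⟨b, _ | ⟨c, l⟩⟩⟩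
  · rfl
  · rfl
  · exact absurd rfl hl
  · rfl

/-- The self-insertion of a bracket is its Jacobiator. -/
theorem comp_ofBilin_self (β : W →ₗ[𝕂] W →ₗ[𝕂] W) (hβ : ∀ x, β x x = 0)
    (hj : ∀ x y z, β x (β y z) = β (β x y) z + β y (β x z)) :
    comp (ofBilin β hβ) (ofBilin β hβ) = 0 := by
  have hs : ∀ x y, β x y = -β y x := by
    intro x y
    have h := hβ (x + y)
    simp only [map_add, LinearMap.add_apply, hβ, zero_add, add_zero] at h
    rw [eq_neg_iff_add_eq_zero, ← h, add_comm]
  ext l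
  by_cases hl : l.length = 3
  · obtain ⟨x, y, z, rfl⟩ := List.length_eq_three.1 hl
    rw [comp_eq_shuffleSum]
    -- Of the eight splittings of three arguments, only the three with two entries in the first
    -- block survive.
    have h0 : ∀ w, ofBilin β hβ [w] = 0 := fun w => rfl
    have h1 : ofBilin β hβ [] = 0 := rfl
    have h3 : ∀ x y z, ofBilin β hβ [x, y, z] = 0 := fun x y z => rfl
    have h4 : ∀ x y z w, ofBilin β hβ [x, y, z, w] = 0 := fun x y z w => rfl
    simp only [shuffleSum, h0, h1, h3, h4, ofBilin_apply,
      List.length_cons, List.length_nil, eval_zero]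
    rw [hs (β y z) x, hj, hs (β x z) y]
    simp
  · exact ((hasDegree_ofBilin β hβ).comp (hasDegree_ofBilin β hβ) (r := 3) rfl) l hl

end Arity

/-! ### The operators `[D, -]` for forms `D` of even degree. -/

section Derived

variable {𝕂 W : Type*} [Field 𝕂] [AddCommGroup W] [Module 𝕂 W]

theorem eps_nrBracket {x y : ℕ} {f g : ListForm 𝕂 W W} (hf : eps f = (-1 : 𝕂) ^ x • f)
    (hg : eps g = (-1 : 𝕂) ^ y • g) :
    eps (nrBracket x y f g) = (-1 : 𝕂) ^ (x + y + 1) • nrBracket x y f g := by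
  simp only [nrBracket, map_sub, map_smul, eps_comp, hf, hg, LinearMap.smul_apply, smul_sub,
    smul_neg, smul_smul, pow_add, pow_one]
  module

variable [CharZero 𝕂]

/-- The operator `[D, -]` is a graded derivation: the Jacobi identity with its labels normalized up
to parity. -/
theorem nrBracket_nrBracket {x y : ℕ} {D f g : ListForm 𝕂 W W} (hD : eps D = D)
    (hf : eps f = (-1 : 𝕂) ^ x • f) (hg : eps g = (-1 : 𝕂) ^ y • g) :
    nrBracket 2 (x + y + 1) D (nrBracket x y f g) =
      nrBracket (x + 1) y (nrBracket 2 x D f) g +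
        (-1 : 𝕂) ^ (x + 1) • nrBracket x (y + 1) f (nrBracket 2 y D g) := by
  rw [nrBracket_jacobi (x := 2) (by simpa using hD) hf hg]
  congr 1
  · apply nrBracket_congr
    · rw [show 2 + x + 1 + (x + 1) = 2 * (x + 2) by ring]
      exact even_two_mul _
    · exact Even.add_self _
  · congr 1
    · rw [neg_one_pow_congr]
      simp [Nat.even_mul, Nat.even_add_one]
    · apply nrBracket_congr
      · exact Even.add_self _
      · rw [show 2 + y + 1 + (y + 1) = 2 * (y + 2) by ring]
        exact even_two_mul _

/-- The hypothesis `h` says `[D, m] = 0`, so in the Jacobi identity for `D`, `m`, `f` only the two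
mixed terms remain. -/
theorem nrBracket_anticomm {x : ℕ} {D m f : ListForm 𝕂 W W} (hD : eps D = D) (hm : eps m = m)
    (h : comp D m + comp m D = 0) (hf : eps f = (-1 : 𝕂) ^ x • f) :
    nrBracket 2 (x + 1) D (nrBracket 2 x m f) = -nrBracket 2 (x + 1) m (nrBracket 2 x D f) := by
  have h0 : nrBracket 2 2 D m = 0 := by
    rw [← h, nrBracket, show (-1 : 𝕂) ^ ((2 + 1) * (2 + 1)) = -1 by norm_num, neg_one_smul_eq,
      sub_neg_eq_add]
  have h1 := nrBracket_jacobi (x := 2) (y := 2) (f := D) (g := m) (by simpa using hD)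
    (by simpa using hm) hf
  have h2 : ∀ g k : ListForm 𝕂 W W, nrBracket 2 (2 + x + 1) g k = nrBracket 2 (x + 1) g k := by
    intro g k
    apply nrBracket_congr
    · exact Even.add_self _
    · rw [show 2 + x + 1 + (x + 1) = 2 * (x + 2) by ring]
      exact even_two_mul _
  rw [h0, h2, h2, show (-1 : 𝕂) ^ ((2 + 1) * (2 + 1)) = -1 by norm_num, neg_one_smul_eq] at h1
  rw [h1]
  simp [nrBracket]

/-- The operator `[D, -]` anticommutes with itself, and the characteristic is not two. -/
theorem nrBracket_square_zero {x : ℕ} {D f : ListForm 𝕂 W W} (hD : eps D = D)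
    (h : comp D D = 0) (hf : eps f = (-1 : 𝕂) ^ x • f) :
    nrBracket 2 (x + 1) D (nrBracket 2 x D f) = 0 := by
  have h1 := nrBracket_anticomm hD hD (by rw [h, add_zero]) hf
  rw [eq_neg_iff_add_eq_zero, ← two_smul 𝕂] at h1
  exact (smul_eq_zero.1 h1).resolve_left two_ne_zero

end Derived

end ListForm

end LiePairs


namespace LiePairs

open ListForm

/-! ### The dg Lie algebra of a Lie-Rinehart algebra split into two subalgebras -/

/-- A Lie-Rinehart algebra `L` over `C` (the anchor is not required to be linear over `C` or to
be compatible with brackets) with a decomposition into the images of two projections `pA` and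
`pB`, which are subalgebras. -/
structure SplitLie (𝕂 C L : Type*) [Field 𝕂] [CommRing C] [Algebra 𝕂 C] [AddCommGroup L]
    [Module 𝕂 L] [Module C L] [IsScalarTower 𝕂 C L] where
  bracket : L →ₗ[𝕂] L →ₗ[𝕂] L
  lie_self : ∀ x, bracket x x = 0
  jacobi : ∀ x y z, bracket x (bracket y z) = bracket (bracket x y) z + bracket y (bracket x z)
  anchor : L →ₗ[𝕂] C →ₗ[𝕂] C
  leibniz : ∀ x y c, bracket x (c • y) = anchor x c • y + c • bracket x y
  pA : L →ₗ[C] L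
  pB : L →ₗ[C] L
  add_eq : ∀ x, pA x + pB x = x
  pA_pA : ∀ x, pA (pA x) = pA x
  pB_bracket : ∀ x y, pB (bracket (pA x) (pA y)) = 0
  pA_bracket : ∀ x y, pA (bracket (pB x) (pB y)) = 0

namespace SplitLie

variable {𝕂 C L : Type*} [Field 𝕂] [CommRing C] [Algebra 𝕂 C] [AddCommGroup L]
    [Module 𝕂 L] [Module C L] [IsScalarTower 𝕂 C L] (S : SplitLie 𝕂 C L)

theorem pA_smul (c : 𝕂) (x : L) : S.pA (c • x) = c • S.pA x :=
  (S.pA.restrictScalars 𝕂).map_smul c x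

theorem pB_smul (c : 𝕂) (x : L) : S.pB (c • x) = c • S.pB x :=
  (S.pB.restrictScalars 𝕂).map_smul c x

theorem pB_eq (x : L) : S.pB x = x - S.pA x := eq_sub_of_add_eq' (S.add_eq x)

theorem pB_pA (x : L) : S.pB (S.pA x) = 0 := by rw [pB_eq, pA_pA, sub_self]

theorem pA_pB (x : L) : S.pA (S.pB x) = 0 := by rw [pB_eq, map_sub, pA_pA, sub_self]

theorem pB_pB (x : L) : S.pB (S.pB x) = S.pB x := by rw [pB_eq, pA_pB, sub_zero]

theorem pB_of_pA {x : L} (h : S.pA x = 0) : S.pB x = x := by rw [pB_eq, h, sub_zero]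

theorem skew (x y : L) : S.bracket x y = -S.bracket y x := by
  have h := S.lie_self (x + y)
  simp only [map_add, LinearMap.add_apply, S.lie_self, zero_add, add_zero] at h
  rw [eq_neg_iff_add_eq_zero, ← h, add_comm]

/-- Exchange of the two summands. -/
def swap : SplitLie 𝕂 C L where
  __ := S
  pA := S.pB
  pB := S.pA
  add_eq x := by rw [add_comm, S.add_eq]
  pA_pA := S.pB_pB
  pB_bracket := S.pA_bracket
  pA_bracket := S.pB_bracket

@[simp] theorem swap_bracket : S.swap.bracket = S.bracket := rfl
@[simp] theorem swap_pA : S.swap.pA = S.pB := rfl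
@[simp] theorem swap_pB : S.swap.pB = S.pA := rfl

/-! ### The two semidirect products that make up the bracket. -/

/-- The bracket of the semidirect product of `A` with the `A`-module `B` (with zero bracket). -/
def semi : L →ₗ[𝕂] L →ₗ[𝕂] L :=
  LinearMap.mk₂ 𝕂 (fun x y => S.bracket (S.pA x) (S.pA y) + S.pB (S.bracket (S.pA x) (S.pB y)) +
      S.pB (S.bracket (S.pB x) (S.pA y)))
    (fun x x' y => by simp only [map_add, LinearMap.add_apply]; abel)
    (fun c x y => by simp only [pA_smul, pB_smul, map_smul, LinearMap.smul_apply, smul_add])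
    (fun x y y' => by simp only [map_add]; abel)
    (fun c x y => by simp only [pA_smul, pB_smul, map_smul, smul_add])

theorem semi_apply (x y : L) : S.semi x y = S.bracket (S.pA x) (S.pA y) +
    S.pB (S.bracket (S.pA x) (S.pB y)) + S.pB (S.bracket (S.pB x) (S.pA y)) := rfl

theorem semi_self (x : L) : S.semi x x = 0 := by
  rw [semi_apply, S.lie_self, S.skew (S.pA x) (S.pB x), map_neg]
  simp

theorem pA_semi (x y : L) : S.pA (S.semi x y) = S.bracket (S.pA x) (S.pA y) := by
  rw [semi_apply, map_add, map_add, pA_pB, pA_pB, add_zero, add_zero]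
  have h := S.pB_bracket x y
  rw [pB_eq, sub_eq_zero] at h
  exact h.symm

theorem pB_semi (x y : L) : S.pB (S.semi x y) =
    S.pB (S.bracket (S.pA x) (S.pB y)) + S.pB (S.bracket (S.pB x) (S.pA y)) := by
  rw [semi_apply, map_add, map_add, pB_pB, pB_pB, S.pB_bracket, zero_add]

/-- As `A` is a subalgebra, the `A`-part of `y` does not contribute. Inner projections can thus be
dropped from iterated actions. -/
theorem pB_bracket_pB (x y : L) :
    S.pB (S.bracket (S.pA x) (S.pB y)) = S.pB (S.bracket (S.pA x) y) := by
  conv_rhs => rw [← S.add_eq y, map_add, map_add, S.pB_bracket, zero_add]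

/-- Every term becomes a projection of a double bracket in `L`, to which the Jacobi identity of `L`
applies directly. -/
theorem semi_semi (x y z : L) : S.semi x (S.semi y z) =
    S.bracket (S.pA x) (S.bracket (S.pA y) (S.pA z)) +
      S.pB (S.bracket (S.pA x) (S.bracket (S.pA y) (S.pB z))) +
      S.pB (S.bracket (S.pA x) (S.bracket (S.pB y) (S.pA z))) +
      S.pB (S.bracket (S.pB x) (S.bracket (S.pA y) (S.pA z))) := by
  rw [S.semi_apply x, pA_semi, pB_semi, map_add, map_add, S.pB_bracket_pB x, S.pB_bracket_pB x]
  abel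

/-- The projected Jacobi identities of `L` on the triples with at most one entry in `B`: they
express that `A` is a Lie algebra and that its connection on `B` is flat. -/
theorem semi_jacobi (x y z : L) :
    S.semi x (S.semi y z) = S.semi (S.semi x y) z + S.semi y (S.semi x z) := by
  have hs : S.semi (S.semi x y) z = -S.semi z (S.semi x y) := by
    have h := S.semi_self (S.semi x y + z)
    simp only [map_add, LinearMap.add_apply, semi_self, zero_add, add_zero] at h
    rw [eq_neg_iff_add_eq_zero, ← h, add_comm]
  have e : ∀ u v w, S.bracket u (S.bracket v w) =
      -S.bracket w (S.bracket u v) + S.bracket v (S.bracket u w) := by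
    intro u v w
    rw [S.jacobi, S.skew (S.bracket u v) w]
  rw [hs, semi_semi, semi_semi, semi_semi, e (S.pA x) (S.pA y) (S.pA z),
    e (S.pA x) (S.pA y) (S.pB z), e (S.pA x) (S.pB y) (S.pA z), e (S.pB x) (S.pA y) (S.pA z)]
  simp only [map_add, map_neg]
  abel

theorem semi_add_semi_swap (x y : L) : S.semi x y + S.swap.semi x y = S.bracket x y := by
  rw [semi_apply, semi_apply, swap_bracket, swap_pA, swap_pB]
  conv_rhs => rw [← S.add_eq x, ← S.add_eq y]
  simp only [map_add, LinearMap.add_apply]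
  linear_combination (norm := abel) S.add_eq (S.bracket (S.pA x) (S.pB y)) +
    S.add_eq (S.bracket (S.pB x) (S.pA y))

/-- The form given by `semi`. -/
def D : ListForm 𝕂 L L := ofBilin S.semi S.semi_self

theorem D_apply (x y : L) : S.D [x, y] = S.semi x y := rfl

theorem hasDegree_D : HasDegree S.D 2 := hasDegree_ofBilin _ _

theorem eps_D : eps S.D = S.D := by
  have h := S.hasDegree_D.eps_eq
  ext l
  rw [h, eval_smul]
  simp

theorem comp_D_D : comp S.D S.D = 0 := comp_ofBilin_self _ _ S.semi_jacobi

/-- The sum `D + D'` is the bracket of `L`, whose self-insertion is zero. The two squares vanish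
separately, which leaves the mixed terms. -/
theorem comp_D_D_swap : comp S.D S.swap.D + comp S.swap.D S.D = 0 := by
  have h : S.D + S.swap.D = ofBilin S.bracket S.lie_self := by
    ext l
    rcases l with _ | ⟨a, _ | ⟨b, _ | ⟨c, l⟩⟩⟩
    · exact add_zero _
    · exact add_zero _
    · exact S.semi_add_semi_swap a b
    · exact add_zero _
  have h2 := comp_ofBilin_self S.bracket S.lie_self S.jacobi
  rw [← h] at h2
  simpa only [map_add, LinearMap.add_apply, comp_D_D, zero_add, add_zero, add_comm] using h2

/-! #### Forms on `A` with values in `B` -/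

/-- The form `f` vanishes on vectors in `B`. -/
def KillsB (f : ListForm 𝕂 L L) : Prop := ∀ x, iota (S.pB x) f = 0

/-- The form `f` has values in `B`. -/
def ValuedB (f : ListForm 𝕂 L L) : Prop := ∀ l, S.pA (f l) = 0

variable {S}

theorem ValuedB.pB {f : ListForm 𝕂 L L} (hf : S.ValuedB f) (l : List L) : S.pB (f l) = f l :=
  S.pB_of_pA (hf l)

theorem ValuedB.eps {f : ListForm 𝕂 L L} (hf : S.ValuedB f) : S.ValuedB (eps f) := fun l => by
  rw [eps_apply, S.pA_smul, hf, smul_zero]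

theorem ValuedB.iota {f : ListForm 𝕂 L L} (hf : S.ValuedB f) (x : L) : S.ValuedB (iota x f) :=
  fun _ => hf _

theorem ValuedB.add {f g : ListForm 𝕂 L L} (hf : S.ValuedB f) (hg : S.ValuedB g) :
    S.ValuedB (f + g) := fun l => by rw [eval_add, map_add, hf, hg, add_zero]

theorem ValuedB.sub {f g : ListForm 𝕂 L L} (hf : S.ValuedB f) (hg : S.ValuedB g) :
    S.ValuedB (f - g) := fun l => by rw [eval_sub, map_sub, hf, hg, sub_zero]

theorem ValuedB.neg {f : ListForm 𝕂 L L} (hf : S.ValuedB f) :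
    S.ValuedB (-f) := fun l => by rw [eval_neg, map_neg, hf, neg_zero]

theorem ValuedB.smul {f : ListForm 𝕂 L L} (hf : S.ValuedB f) (c : 𝕂) :
    S.ValuedB (c • f) := fun l => by rw [eval_smul, S.pA_smul, hf, smul_zero]

theorem KillsB.iota {f : ListForm 𝕂 L L} (hf : S.KillsB f) (x : L) : S.KillsB (iota x f) :=
  fun y => by rw [iota_comm, hf, map_zero, neg_zero]

theorem KillsB.eps {f : ListForm 𝕂 L L} (hf : S.KillsB f) : S.KillsB (eps f) :=
  fun y => by rw [iota_eps, hf, map_zero, neg_zero]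

theorem KillsB.map_cons {f : ListForm 𝕂 L L} (hf : S.KillsB f) (x : L) (l : List L) :
    f (x :: l) = f (S.pA x :: l) := by
  have h : f (S.pB x :: l) = 0 := congrArg (fun g => g.1 l) (hf x)
  conv_lhs => rw [← S.add_eq x, map_add_cons, h, add_zero]

/-- The inserted value lies in `B`, where `f` vanishes. Hence the forms on `A` with values in `B`
commute for the Nijenhuis-Richardson bracket. -/
theorem comp_eq_zero {f g : ListForm 𝕂 L L} (hf : S.KillsB f) (hg : S.ValuedB g) :
    comp f g = 0 := by
  ext l
  rw [comp_eq_shuffleSum]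
  have h : ∀ a b, f (g a :: b) = 0 := by
    intro a b
    rw [hf.map_cons, hg, map_zero_cons]
  simp only [h, shuffleSum_zero, eval_zero]

theorem pA_shuffleSum (l : List L) (F : List L → List L → L) :
    S.pA (shuffleSum 𝕂 l F) = shuffleSum 𝕂 l fun a b => S.pA (F a b) :=
  map_shuffleSum (S.pA.restrictScalars 𝕂) l F

theorem ValuedB.comp_left {f : ListForm 𝕂 L L} (hf : S.ValuedB f) (g : ListForm 𝕂 L L) :
    S.ValuedB (comp f g) := by
  intro l
  rw [comp_eq_shuffleSum, pA_shuffleSum]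
  simp only [hf _, shuffleSum_zero]

/-- Only the values of `f` on arguments containing a vector of `B` matter. This applies to forms
such as `D` that do not take values in `B` themselves. -/
theorem valuedB_comp {f g : ListForm 𝕂 L L} (hf : ∀ x, S.ValuedB (iota (S.pB x) f))
    (hg : S.ValuedB g) : S.ValuedB (comp f g) := by
  intro l
  rw [comp_eq_shuffleSum, pA_shuffleSum]
  have h : ∀ a b, S.pA (f (g a :: b)) = 0 := by
    intro a b
    rw [← hg.pB]
    exact hf _ _
  simp only [h, shuffleSum_zero]

/-- In the semidirect product, `B` is an ideal. -/
theorem valuedB_iota_D (x : L) : S.ValuedB (iota (S.pB x) S.D) := by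
  intro l
  obtain _ | ⟨y, _ | ⟨z, l⟩⟩ := l
  · exact map_zero _
  · change S.pA (S.semi (S.pB x) y) = 0
    rw [S.pA_semi, pA_pB, map_zero, LinearMap.zero_apply]
  · exact map_zero _

theorem semi_pB_pB (x y : L) : S.semi (S.pB x) (S.pB y) = 0 := by
  simp [semi_apply, pA_pB]

theorem pA_semi_swap (x y : L) : S.pA (S.swap.semi x y) =
    S.pA (S.bracket (S.pB x) (S.pA y)) + S.pA (S.bracket (S.pA x) (S.pB y)) :=
  S.swap.pB_semi x y

theorem semi_swap_pB_pB (x y : L) :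
    S.swap.semi (S.pB x) (S.pB y) = S.bracket (S.pB x) (S.pB y) := by
  simp [semi_apply, pA_pB, pB_pB]

variable (S)

/-- The space `Ω_A^p(B)`, realized as the space of the forms on `L` of degree `p` that vanish on
`B`, have values in `B` and are linear over `C`. -/
def basic (p : ℕ) : Submodule 𝕂 (ListForm 𝕂 L L) where
  -- Linearity over `C` in the first slot is enough, since `f` is alternating.
  carrier := {f | HasDegree f p ∧ S.KillsB f ∧ S.ValuedB f ∧
    ∀ (c : C) (x : L) (l : List L), f ((c • x) :: l) = c • f (x :: l)}
  add_mem' {f g} hf hg := by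
    refine ⟨fun l hl => ?_, fun x => ?_, hf.2.2.1.add hg.2.2.1, fun c x l => ?_⟩
    · rw [eval_add, hf.1 l hl, hg.1 l hl, add_zero]
    · rw [map_add, hf.2.1, hg.2.1, add_zero]
    · rw [eval_add, eval_add, hf.2.2.2, hg.2.2.2, smul_add]
  zero_mem' := ⟨fun _ _ => rfl, fun _ => map_zero _, fun _ => map_zero _, fun c _ _ => by simp⟩
  smul_mem' k f hf := by
    refine ⟨fun l hl => ?_, fun x => ?_, hf.2.2.1.smul k, fun c x l => ?_⟩
    · rw [eval_smul, hf.1 l hl, smul_zero]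
    · rw [map_smul, hf.2.1, smul_zero]
    · rw [eval_smul, eval_smul, hf.2.2.2, ← smul_algebra_smul_comm]

/-- The Chevalley-Eilenberg differential. -/
def dForm : ListForm 𝕂 L L →ₗ[𝕂] ListForm 𝕂 L L :=
  -(comp S.D ∘ₗ eps) - comp.flip S.D

theorem dForm_apply (X : ListForm 𝕂 L L) : S.dForm X = -comp S.D (eps X) - comp X S.D := rfl

/-- The differential is an inner derivation up to a sign; the sign is that of the usual
Chevalley-Eilenberg formula. -/
theorem dForm_eq_nrBracket {X : ListForm 𝕂 L L} {p : ℕ} (hX : eps X = (-1 : 𝕂) ^ p • X) :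
    S.dForm X = (-1 : 𝕂) ^ (p + 1) • nrBracket 2 p S.D X := by
  have h : (-1 : 𝕂) ^ (p + 1) * (-1 : 𝕂) ^ ((2 + 1) * (p + 1)) = 1 := by
    rw [← pow_add, show p + 1 + (2 + 1) * (p + 1) = 2 * (2 * (p + 1)) by ring, pow_mul]
    simp
  rw [dForm_apply, hX, nrBracket, smul_sub, smul_smul, h, map_smul]
  ext l
  simp [pow_succ]

/-- The bracket of forms of degree `p` and `q`. -/
def brForm (p q : ℕ) : ListForm 𝕂 L L →ₗ[𝕂] ListForm 𝕂 L L →ₗ[𝕂] ListForm 𝕂 L L :=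
  LinearMap.mk₂ 𝕂 (fun X Y => (-1 : 𝕂) ^ (p * q + p) • comp (comp S.swap.D X) Y +
      (-1 : 𝕂) ^ (p * q) • comp (comp X S.swap.D) Y - comp (comp Y S.swap.D) X)
    (fun X X' Y => by
      simp only [map_add, LinearMap.add_apply, smul_add]
      abel)
    (fun c X Y => by
      simp only [map_smul, LinearMap.smul_apply, smul_add, smul_sub, smul_comm c])
    (fun X Y Y' => by
      simp only [map_add, LinearMap.add_apply, smul_add]
      abel)
    (fun c X Y => by
      simp only [map_smul, LinearMap.smul_apply, smul_add, smul_sub, smul_comm c])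

theorem brForm_apply (p q : ℕ) (X Y : ListForm 𝕂 L L) :
    S.brForm p q X Y = (-1 : 𝕂) ^ (p * q + p) • comp (comp S.swap.D X) Y +
      (-1 : 𝕂) ^ (p * q) • comp (comp X S.swap.D) Y - comp (comp Y S.swap.D) X := rfl

variable {S} [CharZero 𝕂] {p q r : ℕ} {X Y Z : ListForm 𝕂 L L}

/-- The bracket is a derived bracket. Of the four terms of `[[D', X], Y]`, the one in which `X ∘ D'`
is inserted into `Y` vanishes because `X` is valued in `B`. -/
theorem brForm_eq_nrBracket (hX : X ∈ S.basic p) (hY : Y ∈ S.basic q) :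
    S.brForm p q X Y =
      (-1 : 𝕂) ^ (p * q + p) • nrBracket (p + 1) q (nrBracket 2 p S.swap.D X) Y := by
  have h1 : comp Y (comp X S.swap.D) = 0 := comp_eq_zero hY.2.1 (hX.2.2.1.comp_left _)
  -- Here the pre-Lie identity applies: the associator of `Y`, `X`, `D'` is zero, so that of `Y`,
  -- `D'`, `X` is zero too.
  have h2 : comp Y (comp S.swap.D X) = comp (comp Y S.swap.D) X := by
    have h := assoc_symm Y S.swap.D X 2 p (by simpa using S.swap.eps_D) hX.1.eps_eq
    rw [assoc, assoc, h1, comp_eq_zero hY.2.1 hX.2.2.1] at h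
    have h' : comp (comp Y S.swap.D) X = comp Y (comp S.swap.D X) := by
      simpa [sub_eq_zero, eq_comm (a := (0 : ListForm 𝕂 L L))] using h.symm
    exact h'.symm
  have e1 : (-1 : 𝕂) ^ (p * q + p) * (-1 : 𝕂) ^ ((2 + 1) * (p + 1)) = -(-1 : 𝕂) ^ (p * q) := by
    rw [← pow_add, show p * q + p + (2 + 1) * (p + 1) = p * q + 1 + 2 * (2 * p + 1) by ring,
      pow_add, pow_mul]
    simp [pow_succ]
  have e2 : (-1 : 𝕂) ^ (p * q + p) * (-1 : 𝕂) ^ ((p + 1 + 1) * (q + 1)) = 1 := by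
    rw [← pow_add, show p * q + p + (p + 1 + 1) * (q + 1) = 2 * (p * q + p + q + 1) by ring,
      pow_mul]
    simp
  simp only [brForm_apply, nrBracket, map_sub, map_smul, LinearMap.sub_apply,
    LinearMap.smul_apply, h1, h2, smul_zero, sub_zero, smul_sub, smul_smul, e1, e2, one_smul]
  ext l
  simp

end SplitLie

end LiePairs


namespace LiePairs

open ListForm

namespace SplitLie

variable {𝕂 C L : Type*} [Field 𝕂] [CommRing C] [Algebra 𝕂 C] [AddCommGroup L]
    [Module 𝕂 L] [Module C L] [IsScalarTower 𝕂 C L] {S : SplitLie 𝕂 C L}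

/-- Multiplication of forms by elements of `C`. -/
def cSmul (c : C) (f : ListForm 𝕂 L L) : ListForm 𝕂 L L :=
  ⟨fun l => c • f l, by
    refine ⟨fun l₁ l₂ x y => ?_, fun l₁ l₂ k x => ?_, fun l₁ l₂ x => ?_⟩
    · simp only [f.2.1, smul_add]
    · simp only [f.2.2.1, smul_algebra_smul_comm]
    · simp only [f.2.2.2, smul_zero]⟩

theorem cSmul_apply (c : C) (f : ListForm 𝕂 L L) (l : List L) : cSmul c f l = c • f l := rfl

theorem comp_cSmul_left (c : C) (f g : ListForm 𝕂 L L) :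
    comp (cSmul c f) g = cSmul c (comp f g) := by
  ext l
  rw [cSmul_apply, comp_eq_shuffleSum, comp_eq_shuffleSum]
  exact (map_shuffleSum (Algebra.lsmul 𝕂 𝕂 L c) l _).symm

/-- The form `f` is linear over `C` in its first argument. -/
def IsLin (f : ListForm 𝕂 L L) : Prop :=
  ∀ (c : C) (x : L) (l : List L), f ((c • x) :: l) = c • f (x :: l)

theorem IsLin.iota {f : ListForm 𝕂 L L} (hf : IsLin (C := C) f) (x : L) :
    IsLin (C := C) (iota x f) := fun c y l => by
  rw [iota_apply, iota_apply, map_cons_cons_swap, hf, map_cons_cons_swap f x, smul_neg]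

theorem IsLin.iota_smul {f : ListForm 𝕂 L L} (hf : IsLin (C := C) f) (c : C) (x : L) :
    ListForm.iota (c • x) f = cSmul c (ListForm.iota x f) :=
  ListForm.ext fun l => hf c x l

/-! #### The differential -/

/-- Cartan's formula: the first two terms are the Lie derivative of `X` along `x`. -/
theorem iota_dForm (x : L) (X : ListForm 𝕂 L L) : iota x (S.dForm X) =
    comp (iota x S.D) X - comp X (iota x S.D) - S.dForm (iota x X) := by
  rw [dForm_apply, dForm_apply, map_sub, map_neg, iota_comp, iota_comp, eps_eps, S.eps_D,
    iota_eps, map_neg]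
  abel

theorem dForm_cons (x : L) (l : List L) (X : ListForm 𝕂 L L) : S.dForm X (x :: l) =
    S.semi x (X l) - comp X (iota x S.D) l - S.dForm (iota x X) l := by
  have h : comp (iota x S.D) X l = S.semi x (X l) :=
    comp_of_degree_one (S.hasDegree_D.iota x) X l
  rw [← h]
  exact congrArg (fun f => f.1 l) (iota_dForm (S := S) x X)

theorem dForm_nil (X : ListForm 𝕂 L L) : S.dForm X [] = 0 := by
  have h : X [S.D []] = 0 := by
    rw [S.hasDegree_D [] (by simp), map_zero_cons]
  rw [dForm_apply, eval_sub, eval_neg, comp_nil, comp_nil, S.hasDegree_D [_] (by simp), h]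
  simp

/-- The wedge product of the one-form `θ` with `Z`. -/
def wedgeFun (θ : L → C) : List L → (List L → L) → L
  | [], _ => 0
  | w :: l, Z => θ w • Z l - wedgeFun θ l fun l' => Z (w :: l')

theorem wedgeFun_neg (θ : L → C) (l : List L) (Z : List L → L) :
    wedgeFun θ l (fun l' => -Z l') = -wedgeFun θ l Z := by
  induction l generalizing Z with
  | nil => exact neg_zero.symm
  | cons w l ih =>
    simp only [wedgeFun, ih, smul_neg]
    abel

theorem semi_smul_right (x y : L) (c : C) (hy : S.pA y = 0) :
    S.semi x (c • y) = S.anchor (S.pA x) c • y + c • S.semi x y := by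
  simp only [semi_apply, map_smul, hy, smul_zero, map_zero, zero_add, add_zero, S.pB_of_pA hy,
    S.leibniz, map_add]

/-- The Leibniz rule `d(cZ) = c dZ + dc ∧ Z`, where `dc` is the one-form given by the anchor of the
`A`-part. Only values in `B` are allowed, as `semi` satisfies a Leibniz rule just for them. -/
theorem dForm_cSmul (c : C) (l : List L) (Z : ListForm 𝕂 L L) (hZ : S.ValuedB Z) :
    S.dForm (cSmul c Z) l = c • S.dForm Z l + wedgeFun (fun w => S.anchor (S.pA w) c) l Z.1 := by
  induction l generalizing Z with
  | nil => simp [dForm_nil, wedgeFun]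
  | cons w l ih =>
    have h := ih (iota w Z) (hZ.iota w)
    rw [dForm_cons, dForm_cons, cSmul_apply, semi_smul_right _ _ _ (hZ l), comp_cSmul_left,
      cSmul_apply, wedgeFun]
    change _ - _ - S.dForm (cSmul c (iota w Z)) l = _
    rw [h]
    simp only [smul_sub]
    change _ - (_ + wedgeFun _ l fun l' => Z (w :: l')) = _
    abel

theorem comp_iota_D_cons (X : ListForm 𝕂 L L) (x w : L) (l : List L) :
    comp X (iota x S.D) (w :: l) = X (S.semi x w :: l) + comp (iota w X) (iota x S.D) l :=
  comp_cons_of_degree_one X (S.hasDegree_D.iota x) w l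

theorem comp_iota_D_nil (X : ListForm 𝕂 L L) (x : L) : comp X (iota x S.D) [] = 0 := by
  rw [comp_nil, S.hasDegree_D.iota x [] (by simp), map_zero_cons]

/-- The bracket `[cx, w]` differs from `c[x, w]` by the derivative of `c` along `w` times `x`.
Summed over the slots, this gives `-dc ∧ X(x, -)`. -/
theorem comp_iota_smul_D (c : C) (x : L) (l : List L) (X : ListForm 𝕂 L L) (hX : S.KillsB X)
    (hX' : IsLin (C := C) X) : comp X (iota (c • x) S.D) l = c • comp X (iota x S.D) l -
      wedgeFun (fun w => S.anchor (S.pA w) c) l (iota x X).1 := by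
  induction l generalizing X with
  | nil => rw [comp_iota_D_nil, comp_iota_D_nil, wedgeFun, smul_zero, sub_zero]
  | cons w l ih =>
    rw [comp_iota_D_cons, comp_iota_D_cons, ih _ (hX.iota w) (hX'.iota w), wedgeFun]
    have h1 : wedgeFun (fun w => S.anchor (S.pA w) c) l (fun l' => (iota x X).1 (w :: l')) =
        -wedgeFun (fun w => S.anchor (S.pA w) c) l (iota x (iota w X)).1 := by
      rw [← wedgeFun_neg]
      congr 1
      funext l'
      exact map_cons_cons_swap X x w l'
    have h2 : X (S.semi (c • x) w :: l) =
        c • X (S.semi x w :: l) - S.anchor (S.pA w) c • X (x :: l) := by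
      rw [hX.map_cons, S.pA_semi, map_smul, S.skew, S.leibniz, neg_add, map_add_cons, map_neg_cons,
        map_neg_cons, hX', hX', ← hX.map_cons, hX.map_cons (S.semi x w), S.pA_semi,
        S.skew (S.pA x), map_neg_cons, smul_neg]
      abel
    rw [h1, h2, iota_apply]
    simp only [smul_add]
    abel

/-- Linearity over `C` comes from Cartan's formula: the term `dc ∧ X(x, -)` arises once from the Lie
derivative and once, with the opposite sign, from the differential of `c X(x, -)`. -/
theorem dForm_mem {p : ℕ} {X : ListForm 𝕂 L L} (hX : X ∈ S.basic p) :
    S.dForm X ∈ S.basic (p + 1) := by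
  obtain ⟨h1, h2, h3, h4⟩ := hX
  refine ⟨fun l hl => ?_, fun x => ?_, ?_, fun c x l => ?_⟩
  · rw [dForm_apply, eval_sub, eval_neg, h1.eps_eq, map_smul, eval_smul,
      S.hasDegree_D.comp h1 (r := p + 1) (by ring) l hl,
      h1.comp S.hasDegree_D (r := p + 1) (by ring) l hl]
    simp
  · rw [iota_dForm, h2, map_zero, sub_zero, comp_eq_zero h2 (valuedB_iota_D x), sub_zero]
    ext l
    rw [comp_of_degree_one (S.hasDegree_D.iota _), ← h3.pB]
    exact semi_pB_pB x _
  · exact ((valuedB_comp valuedB_iota_D h3.eps).neg).sub (h3.comp_left _)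
  · rw [dForm_cons, dForm_cons, comp_iota_smul_D c x l X h2 h4, IsLin.iota_smul h4,
      dForm_cSmul _ _ _ (h3.iota x)]
    -- The anchor term of this bracket is a multiple of the `A`-part of `x` and dies under the
    -- projection to `B`.
    have h : S.semi (c • x) (X l) = c • S.semi x (X l) := by
      simp only [semi_apply, h3 l, map_zero, map_smul, h3.pB, zero_add, add_zero]
      rw [S.skew, S.leibniz, S.skew (S.pA x)]
      simp [S.pB_pA]
    rw [h]
    simp only [smul_sub]
    abel

/-! #### The bracket -/

theorem comp_iota_swap_D_cons (X : ListForm 𝕂 L L) (x w : L) (l : List L) :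
    comp X (iota x S.swap.D) (w :: l) =
      X (S.swap.semi x w :: l) + comp (iota w X) (iota x S.swap.D) l :=
  comp_iota_D_cons (S := S.swap) X x w l

theorem comp_iota_swap_D_nil (X : ListForm 𝕂 L L) (x : L) :
    comp X (iota x S.swap.D) [] = 0 := comp_iota_D_nil (S := S.swap) X x

/-- The bracket of two forms, evaluated on a splitting of the list of arguments. -/
def brSummand (S : SplitLie 𝕂 C L) (X Y : ListForm 𝕂 L L) (a b : List L) : L :=
  S.bracket (X a) (Y b) - comp Y (iota (X a) S.swap.D) b + comp X (iota (Y b) S.swap.D) a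

variable {p q : ℕ} {X Y : ListForm 𝕂 L L}

/-- The outer insertion is the sum over splittings. The inserted value lies in `B`, so in each inner
insertion only one term of the contraction survives; `shuffleSum_flip` absorbs the signs from
exchanging the blocks. -/
theorem brForm_eq_shuffleSum (hX : X ∈ S.basic p) (hY : Y ∈ S.basic q) (l : List L) :
    S.brForm p q X Y l = shuffleSum 𝕂 l (S.brSummand X Y) := by
  obtain ⟨x1, x2, x3, x4⟩ := hX
  obtain ⟨y1, y2, y3, y4⟩ := hY
  have t2 : comp (comp Y S.swap.D) X l =
      shuffleSum 𝕂 l fun a b => comp Y (iota (X a) S.swap.D) b := by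
    rw [comp_eq_shuffleSum]
    congr 1
    funext a b
    rw [← iota_apply, iota_comp, ← x3.pB, y2]
    simp
  have t3 : (-1 : 𝕂) ^ (p * q) • comp (comp X S.swap.D) Y l =
      shuffleSum 𝕂 l fun a b => comp X (iota (Y b) S.swap.D) a := by
    rw [comp_eq_shuffleSum, ← shuffleSum_flip, ← shuffleSum_smul]
    refine shuffleSum_congr l _ _ fun a b _ => ?_
    have h : comp X S.swap.D (Y b :: a) = comp X (iota (Y b) S.swap.D) a := by
      rw [← iota_apply, iota_comp, ← y3.pB, x2]
      simp
    rw [h]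
    by_cases hb : b.length = q
    · by_cases ha : a.length = p
      · rw [ha, hb, smul_smul, ← pow_add, (Even.add_self _).neg_one_pow, one_smul]
      · rw [x1.comp (S.swap.hasDegree_D.iota _) (r := p) rfl a ha, smul_zero, smul_zero]
    · rw [y1 b hb, map_zero, LinearMap.zero_apply, map_zero, eval_zero, smul_zero, smul_zero]
  have t1 : (-1 : 𝕂) ^ (p * q + p) • comp (comp S.swap.D X) Y l =
      shuffleSum 𝕂 l fun a b => S.bracket (X a) (Y b) := by
    rw [comp_eq_shuffleSum, ← shuffleSum_flip, ← shuffleSum_smul]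
    refine shuffleSum_congr l _ _ fun a b _ => ?_
    have h : comp S.swap.D X (Y b :: a) = (-1 : 𝕂) ^ a.length • S.bracket (X a) (Y b) := by
      rw [← y3.pB, ← iota_apply, iota_comp, x2, map_zero, zero_sub, eval_neg,
        comp_of_degree_one (S.swap.hasDegree_D.iota _), eps_apply, map_smul_cons, iota_apply,
        D_apply, ← x3.pB, semi_swap_pB_pB, S.skew (S.pB (X a)), smul_neg]
    rw [h]
    by_cases hb : b.length = q
    · by_cases ha : a.length = p
      · rw [ha, hb, smul_smul, smul_smul, ← pow_add, ← pow_add,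
          show p * q + p + p * q + p = 2 * (p * q + p) by ring, pow_mul]
        simp
      · rw [x1 a ha, map_zero, LinearMap.zero_apply, smul_zero, smul_zero, smul_zero]
    · rw [y1 b hb, map_zero, smul_zero, smul_zero, smul_zero]
  rw [brForm_apply, eval_sub, eval_add, eval_smul, eval_smul, t1, t2, t3, ← shuffleSum_add,
    ← shuffleSum_sub]
  congr 1
  funext a b
  rw [brSummand]
  abel

/-- For `y` in `B`, contracting `D'` with `y` gives the connection `∇_y` on the `A`-parts, and
brackets of two vectors of `B` have no `A`-part. -/
theorem comp_iota_swap_D_pB (hX : S.KillsB X) (x y : L) (hy : S.pA y = 0) (l : List L) :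
    comp X (iota y S.swap.D) (S.pB x :: l) = 0 := by
  rw [comp_iota_swap_D_cons, hX, map_zero, LinearMap.zero_apply, eval_zero, add_zero, hX.map_cons,
    pA_semi_swap, S.pA_pB, hy]
  simp [map_zero_cons]

/-- The extra term comes from the Leibniz rule for `∇_y`; it is cancelled in `brSummand_smul_left`
and `brSummand_smul_right`. -/
theorem comp_iota_swap_D_smul_cons (hX : S.KillsB X) (hX' : IsLin (C := C) X) (c : C) (x y : L)
    (hy : S.pA y = 0) (l : List L) : comp X (iota y S.swap.D) ((c • x) :: l) =
      S.anchor y c • X (x :: l) + c • comp X (iota y S.swap.D) (x :: l) := by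
  rw [comp_iota_swap_D_cons, comp_iota_swap_D_cons, IsLin.iota_smul hX', comp_cSmul_left,
    cSmul_apply, hX.map_cons, hX.map_cons (S.swap.semi y x), pA_semi_swap, pA_semi_swap, hy,
    S.pB_of_pA hy, map_smul, S.leibniz]
  simp only [map_zero, LinearMap.zero_apply, add_zero, map_add, map_smul, S.pA_pA, map_add_cons,
    hX' _ _ _, smul_add, ← hX.map_cons]
  abel

theorem bracket_smul_left (c : C) (x y : L) :
    S.bracket (c • x) y = c • S.bracket x y - S.anchor y c • x := by
  rw [S.skew, S.leibniz, S.skew x, smul_neg]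
  abel

theorem comp_iota_smul_swap_D (hX : S.KillsB X) (hX' : IsLin (C := C) X) (c : C) (y : L)
    (hy : S.pA y = 0) (l : List L) :
    comp X (iota (c • y) S.swap.D) l = c • comp X (iota y S.swap.D) l := by
  induction l generalizing X with
  | nil => rw [comp_iota_swap_D_nil, comp_iota_swap_D_nil, smul_zero]
  | cons w l ih =>
    have hc : S.pA (c • y) = 0 := by rw [map_smul, hy, smul_zero]
    rw [comp_iota_swap_D_cons, comp_iota_swap_D_cons, ih (hX.iota w) (hX'.iota w), smul_add,
      hX.map_cons, hX.map_cons (S.swap.semi y w), pA_semi_swap, pA_semi_swap, hc, hy,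
      S.pB_of_pA hc, S.pB_of_pA hy, bracket_smul_left, ← hX', map_sub, map_smul, map_smul, hy]
    simp

/-- The bracket `[c X, Y]` produces the derivative of `c` along `Y` times `-X`, and the connection
term `∇_Y` in the slot of `x` produces its opposite. -/
theorem brSummand_smul_left (hX : X ∈ S.basic p) (hY : Y ∈ S.basic q) (c : C) (x : L)
    (a b : List L) :
    S.brSummand X Y ((c • x) :: a) b = c • S.brSummand X Y (x :: a) b := by
  obtain ⟨-, x2, x3, x4⟩ := hX
  obtain ⟨-, y2, y3, y4⟩ := hY
  rw [brSummand, brSummand, x4, bracket_smul_left, comp_iota_smul_swap_D y2 y4 _ _ (x3 _),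
    comp_iota_swap_D_smul_cons x2 x4 _ _ _ (y3 _)]
  simp only [smul_sub, smul_add]
  abel

theorem brSummand_smul_right (hX : X ∈ S.basic p) (hY : Y ∈ S.basic q) (c : C) (x : L)
    (a b : List L) :
    S.brSummand X Y a ((c • x) :: b) = c • S.brSummand X Y a (x :: b) := by
  obtain ⟨-, x2, x3, x4⟩ := hX
  obtain ⟨-, y2, y3, y4⟩ := hY
  rw [brSummand, brSummand, y4, S.leibniz, comp_iota_smul_swap_D x2 x4 _ _ (y3 _),
    comp_iota_swap_D_smul_cons y2 y4 _ _ _ (x3 _)]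
  simp only [smul_sub, smul_add]
  abel

theorem brForm_mem {r : ℕ} (h : p + q = r) (hX : X ∈ S.basic p) (hY : Y ∈ S.basic q) :
    S.brForm p q X Y ∈ S.basic r := by
  refine ⟨fun l hl => ?_, fun x => ?_, ?_, fun c x l => ?_⟩
  · have e1 := (S.swap.hasDegree_D.comp hX.1 (r := p + 1) (by ring)).comp hY.1 (r := r) (by omega)
    have e2 := (hX.1.comp S.swap.hasDegree_D (r := p + 1) (by ring)).comp hY.1 (r := r) (by omega)
    have e3 := (hY.1.comp S.swap.hasDegree_D (r := q + 1) (by ring)).comp hX.1 (r := r) (by omega)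
    rw [brForm_apply, eval_sub, eval_add, eval_smul, eval_smul, e1 l hl, e2 l hl, e3 l hl]
    simp
  · ext l
    rw [iota_apply, brForm_eq_shuffleSum hX hY, shuffleSum, eval_zero]
    have e1 : ∀ a b, S.brSummand X Y (S.pB x :: a) b = 0 := by
      intro a b
      have h0 : X (S.pB x :: a) = 0 := congrArg (fun f => f.1 a) (hX.2.1 x)
      rw [brSummand, h0, comp_iota_swap_D_pB hX.2.1 _ _ (hY.2.2.1 _)]
      simp
    have e2 : ∀ a b, S.brSummand X Y a (S.pB x :: b) = 0 := by
      intro a b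
      have h0 : Y (S.pB x :: b) = 0 := congrArg (fun f => f.1 b) (hY.2.1 x)
      rw [brSummand, h0, comp_iota_swap_D_pB hY.2.1 _ _ (hX.2.2.1 _)]
      simp
    simp only [e1, e2, smul_zero, shuffleSum_zero, add_zero]
  -- Only `D' ∘ X` needs an argument: with a vector of `B` inserted, it becomes a bracket of two
  -- elements of `B`, which stays in the subalgebra `B`.
  · refine (((valuedB_comp (fun x => ?_) hY.2.2.1).smul _).add
      (((hX.2.2.1.comp_left _).comp_left _).smul _)).sub ((hY.2.2.1.comp_left _).comp_left _)
    rw [iota_comp, hX.2.1, map_zero, zero_sub]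
    refine ValuedB.neg fun l => ?_
    rw [comp_of_degree_one (S.swap.hasDegree_D.iota _), iota_apply, D_apply,
      ← hX.2.2.1.eps.pB, semi_swap_pB_pB, S.pA_bracket]
  · rw [brForm_eq_shuffleSum hX hY, brForm_eq_shuffleSum hX hY, shuffleSum, shuffleSum, smul_add]
    simp only [brSummand_smul_left hX hY, brSummand_smul_right hX hY]
    congr 1
    · exact (map_shuffleSum (Algebra.lsmul 𝕂 𝕂 L c) l _).symm
    · simp only [← smul_algebra_smul_comm]
      exact (map_shuffleSum (Algebra.lsmul 𝕂 𝕂 L c) l _).symm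

end SplitLie

end LiePairs


namespace LiePairs

open ListForm

/-! ### The dg Lie identities of the derived bracket. -/

namespace SplitLie

section

variable {𝕂 W : Type*} [Field 𝕂] [AddCommGroup W] [Module 𝕂 W]

theorem nrBracket_smul_left (x y : ℕ) (c : 𝕂) (f g : ListForm 𝕂 W W) :
    nrBracket x y (c • f) g = c • nrBracket x y f g := by
  simp only [nrBracket, map_smul, LinearMap.smul_apply, smul_sub, smul_comm c]

theorem nrBracket_smul_right (x y : ℕ) (c : 𝕂) (f g : ListForm 𝕂 W W) :
    nrBracket x y f (c • g) = c • nrBracket x y f g := by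
  simp only [nrBracket, map_smul, LinearMap.smul_apply, smul_sub, smul_comm c]

theorem nrBracket_zero_left (x y : ℕ) (g : ListForm 𝕂 W W) :
    nrBracket x y 0 g = 0 := by simp [nrBracket]

theorem nrBracket_zero_right (x y : ℕ) (g : ListForm 𝕂 W W) :
    nrBracket x y g 0 = 0 := by simp [nrBracket]

theorem nrBracket_neg_left (x y : ℕ) (f g : ListForm 𝕂 W W) :
    nrBracket x y (-f) g = -nrBracket x y f g := by
  rw [← neg_one_smul_eq, nrBracket_smul_left, neg_one_smul_eq]

end

variable {𝕂 C L : Type*} [Field 𝕂] [CharZero 𝕂] [CommRing C] [Algebra 𝕂 C] [AddCommGroup L]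
    [Module 𝕂 L] [Module C L] [IsScalarTower 𝕂 C L] {S : SplitLie 𝕂 C L}
    {p q r : ℕ} {X Y Z : ListForm 𝕂 L L}

theorem dForm_dForm (hX : X ∈ S.basic p) : S.dForm (S.dForm X) = 0 := by
  rw [dForm_eq_nrBracket S (dForm_mem hX).1.eps_eq, dForm_eq_nrBracket S hX.1.eps_eq,
    nrBracket_smul_right, nrBracket_square_zero S.eps_D S.comp_D_D hX.1.eps_eq, smul_zero,
    smul_zero]

theorem eps_ad (hX : X ∈ S.basic p) : eps (nrBracket 2 p S.swap.D X) =
    (-1 : 𝕂) ^ (p + 1) • nrBracket 2 p S.swap.D X := by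
  rw [eps_nrBracket (x := 2) (by simpa using S.swap.eps_D) hX.1.eps_eq,
    show 2 + p + 1 = 2 + (p + 1) by ring, pow_add]
  simp

/-- Apply the derivation `[D', -]` to `[X, Y] = 0`. -/
theorem brForm_skew (hX : X ∈ S.basic p) (hY : Y ∈ S.basic q) :
    S.brForm p q X Y = -((-1 : 𝕂) ^ (p * q) • S.brForm q p Y X) := by
  have h := nrBracket_nrBracket S.swap.eps_D hX.1.eps_eq hY.1.eps_eq
  have h0 : nrBracket p q X Y = 0 := by
    rw [nrBracket, comp_eq_zero hX.2.1 hY.2.2.1, comp_eq_zero hY.2.1 hX.2.2.1]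
    simp
  rw [h0, nrBracket_zero_right, nrBracket_swap p (q + 1)] at h
  rw [brForm_eq_nrBracket hX hY, brForm_eq_nrBracket hY hX]
  ext l
  have hl := congrArg (fun f => f.1 l) h
  simp only [eval_add, eval_smul, eval_zero, eval_neg] at hl ⊢
  generalize (nrBracket (p + 1) q (nrBracket 2 p S.swap.D X) Y).1 l = a at *
  generalize (nrBracket (q + 1) p (nrBracket 2 q S.swap.D Y) X).1 l = b at *
  rcases Nat.even_or_odd p with hp | hp <;> rcases Nat.even_or_odd q with hq | hq <;>
    simp [pow_add, pow_mul, hp.neg_one_pow, hq.neg_one_pow] at hl ⊢ <;>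
    linear_combination (norm := module) -hl

/-- The derivation `[D, -]` anticommutes with `[D', -]`, so it passes through `[[D', X], Y]`; the
rest is a check of signs by parity. -/
theorem dForm_brForm (hX : X ∈ S.basic p) (hY : Y ∈ S.basic q) :
    S.dForm (S.brForm p q X Y) = S.brForm (p + 1) q (S.dForm X) Y +
      (-1 : 𝕂) ^ p • S.brForm p (q + 1) X (S.dForm Y) := by
  have h := nrBracket_nrBracket S.eps_D (eps_ad hX) hY.1.eps_eq
  rw [nrBracket_anticomm S.eps_D S.swap.eps_D S.comp_D_D_swap hX.1.eps_eq,
    nrBracket_neg_left] at h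
  rw [brForm_eq_nrBracket (dForm_mem hX) hY, brForm_eq_nrBracket hX (dForm_mem hY),
    dForm_eq_nrBracket S (brForm_mem rfl hX hY).1.eps_eq, brForm_eq_nrBracket hX hY,
    dForm_eq_nrBracket S hX.1.eps_eq, dForm_eq_nrBracket S hY.1.eps_eq,
    nrBracket_congr (x' := 2) (y' := p + 1 + q + 1) (by decide)
      (by rw [show p + q + (p + 1 + q + 1) = 2 * (p + q + 1) by ring]; exact even_two_mul _)]
  simp only [nrBracket_smul_left, nrBracket_smul_right, h]
  ext l
  simp only [eval_add, eval_smul, eval_neg]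
  generalize (nrBracket (p + 1 + 1) q (nrBracket 2 (p + 1) S.swap.D (nrBracket 2 p S.D X)) Y).1 l
    = a
  generalize (nrBracket (p + 1) (q + 1) (nrBracket 2 p S.swap.D X) (nrBracket 2 q S.D Y)).1 l = b
  rcases Nat.even_or_odd p with hp | hp <;> rcases Nat.even_or_odd q with hq | hq <;>
    simp [pow_add, pow_mul, hp.neg_one_pow, hq.neg_one_pow]

/-- The map `[D', -]` takes the derived bracket to the ordinary one, because its square is zero. -/
theorem ad_brForm (hX : X ∈ S.basic p) (hY : Y ∈ S.basic q) :
    nrBracket 2 (p + q) S.swap.D (nrBracket (p + 1) q (nrBracket 2 p S.swap.D X) Y) =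
      (-1 : 𝕂) ^ p • nrBracket (p + 1) (q + 1) (nrBracket 2 p S.swap.D X)
        (nrBracket 2 q S.swap.D Y) := by
  have h := nrBracket_nrBracket S.swap.eps_D (eps_ad hX) hY.1.eps_eq
  rw [nrBracket_square_zero S.swap.eps_D S.swap.comp_D_D hX.1.eps_eq, nrBracket_zero_left,
    zero_add, nrBracket_congr (x' := 2) (y' := p + q) (by decide)
      (by rw [show p + 1 + q + 1 + (p + q) = 2 * (p + q + 1) by ring]; exact even_two_mul _)] at h
  rw [h, pow_succ, pow_succ]
  simp

/-- This is the Nijenhuis-Richardson Jacobi identity for `[D', X]`, `[D', Y]` and `Z`, rewritten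
with `ad_brForm`. -/
theorem brForm_jacobi (hX : X ∈ S.basic p) (hY : Y ∈ S.basic q) (hZ : Z ∈ S.basic r) :
    S.brForm p (q + r) X (S.brForm q r Y Z) = S.brForm (p + q) r (S.brForm p q X Y) Z +
      (-1 : 𝕂) ^ (p * q) • S.brForm q (p + r) Y (S.brForm p r X Z) := by
  have h := nrBracket_jacobi (eps_ad hX) (eps_ad hY) hZ.1.eps_eq
  rw [nrBracket_congr (x' := p + 1) (y' := q + r) (Even.add_self _)
      (by rw [show q + 1 + r + 1 + (q + r) = 2 * (q + r + 1) by ring]; exact even_two_mul _),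
    nrBracket_congr (x := p + 1 + (q + 1) + 1) (x' := p + q + 1) (y' := r)
      (by rw [show p + 1 + (q + 1) + 1 + (p + q + 1) = 2 * (p + q + 2) by ring]
          exact even_two_mul _) (Even.add_self _),
    nrBracket_congr (x := q + 1) (x' := q + 1) (y := p + 1 + r + 1) (y' := p + r)
      (Even.add_self _)
      (by rw [show p + 1 + r + 1 + (p + r) = 2 * (p + r + 1) by ring]; exact even_two_mul _)] at h
  rw [brForm_eq_nrBracket hX (brForm_mem rfl hY hZ), brForm_eq_nrBracket hY hZ,
    brForm_eq_nrBracket (brForm_mem rfl hX hY) hZ, brForm_eq_nrBracket hX hY,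
    brForm_eq_nrBracket hY (brForm_mem rfl hX hZ), brForm_eq_nrBracket hX hZ]
  simp only [nrBracket_smul_left, nrBracket_smul_right, ad_brForm hX hY, h]
  ext l
  simp only [eval_add, eval_smul]
  generalize (nrBracket (p + q + 1) r (nrBracket (p + 1) (q + 1)
    (nrBracket 2 p S.swap.D X) (nrBracket 2 q S.swap.D Y)) Z).1 l = a
  generalize (nrBracket (q + 1) (p + r) (nrBracket 2 q S.swap.D Y)
    (nrBracket (p + 1) r (nrBracket 2 p S.swap.D X) Z)).1 l = b
  rcases Nat.even_or_odd p with hp | hp <;> rcases Nat.even_or_odd q with hq | hq <;>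
    rcases Nat.even_or_odd r with hr | hr <;>
    simp [pow_add, pow_mul, hp.neg_one_pow, hq.neg_one_pow, hr.neg_one_pow]

end SplitLie

/-- The dg Lie algebra of forms on `A` with values in `B`. -/
def SplitLie.dgLie {𝕂 : Type} {C L : Type*} [Field 𝕂] [CharZero 𝕂] [CommRing C] [Algebra 𝕂 C]
    [AddCommGroup L] [Module 𝕂 L] [Module C L] [IsScalarTower 𝕂 C L] (S : SplitLie 𝕂 C L) :
    DGLieAlgebra 𝕂 fun p => S.basic p where
  d p := S.dForm.restrict fun _ hX => dForm_mem hX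
  br {p q r} h := LinearMap.mk₂ 𝕂
    (fun X Y => ⟨S.brForm p q X Y, brForm_mem h X.2 Y.2⟩)
    (fun X X' Y => Subtype.ext (by
      change S.brForm p q (X.1 + X'.1) Y.1 = _
      rw [map_add]; rfl))
    (fun c X Y => Subtype.ext (by
      change S.brForm p q (c • X.1) Y.1 = _
      rw [map_smul]; rfl))
    (fun X Y Y' => Subtype.ext (by
      change S.brForm p q X.1 (Y.1 + Y'.1) = _
      rw [map_add]; rfl))
    (fun c X Y => Subtype.ext (by
      change S.brForm p q X.1 (c • Y.1) = _
      rw [map_smul]; rfl))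
  d_d p X := Subtype.ext (dForm_dForm X.2)
  skew h h' X Y := Subtype.ext (brForm_skew X.2 Y.2)
  leibniz {p q r} h h₁ h₂ X Y := Subtype.ext (dForm_brForm X.2 Y.2)
  jacobi {p q r s pq qr pr} hqr h₁ hpq h₂ hpr h₃ X Y Z := Subtype.ext (by
    subst hqr hpq hpr
    exact brForm_jacobi X.2 Y.2 Z.2)

/-- Transport of the structure of a dg Lie algebra along linear equivalences. -/
def DGLieAlgebra.transport {𝕂 : Type} [Field 𝕂] {V V' : ℕ → Type*} [∀ k, AddCommGroup (V k)]
    [∀ k, Module 𝕂 (V k)] [∀ k, AddCommGroup (V' k)] [∀ k, Module 𝕂 (V' k)]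
    (g : DGLieAlgebra 𝕂 V) (e : ∀ p, V' p ≃ₗ[𝕂] V p) : DGLieAlgebra 𝕂 V' where
  d p := (e (p + 1)).symm.toLinearMap ∘ₗ g.d p ∘ₗ (e p).toLinearMap
  br {p q r} h := ((g.br h).compl₁₂ (e p).toLinearMap (e q).toLinearMap).compr₂
    (e r).symm.toLinearMap
  d_d p x := by simp [g.d_d]
  skew {p q r} h h' x y := by
    have := congrArg (e r).symm (g.skew h h' (e p x) (e q y))
    simpa using this
  leibniz {p q r} h h₁ h₂ x y := by
    have := congrArg (e (r + 1)).symm (g.leibniz h h₁ h₂ (e p x) (e q y))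
    simpa using this
  jacobi {p q r s pq qr pr} hqr h₁ hpq h₂ hpr h₃ x y z := by
    have := congrArg (e s).symm (g.jacobi hqr h₁ hpq h₂ hpr h₃ (e p x) (e q y) (e r z))
    simpa using this

end LiePairs


namespace LiePairs

open ListForm

/-! ### Alternating maps as forms on lists -/

section Alternating

variable {𝕂 C L : Type*} [Field 𝕂] [CommRing C] [Algebra 𝕂 C] [AddCommGroup L]
    [Module 𝕂 L] [Module C L] [IsScalarTower 𝕂 C L]

/-- The evaluation of an alternating map on a list. -/
def altFun : ∀ p : ℕ, (L [⋀^Fin p]→ₗ[C] L) → List L → L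
  | 0, X, [] => X ![]
  | _ + 1, X, w :: l => altFun _ (X.curryLeft w) l
  -- The value `0` on lists of the wrong length makes the form homogeneous of degree `p`.
  | 0, _, _ :: _ => 0
  | _ + 1, _, [] => 0

theorem altFun_add : ∀ (p : ℕ) (X Y : L [⋀^Fin p]→ₗ[C] L) (l : List L),
    altFun p (X + Y) l = altFun p X l + altFun p Y l
  | 0, _, _, [] => rfl
  | p + 1, X, Y, w :: l => by
    simp only [altFun, AlternatingMap.curryLeft_add, LinearMap.add_apply, altFun_add p]
  | 0, _, _, _ :: _ => (add_zero _).symm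
  | _ + 1, _, _, [] => (add_zero _).symm

theorem altFun_smul (c : C) : ∀ (p : ℕ) (X : L [⋀^Fin p]→ₗ[C] L) (l : List L),
    altFun p (c • X) l = c • altFun p X l
  | 0, _, [] => rfl
  | p + 1, X, w :: l => by
    simp only [altFun, AlternatingMap.curryLeft_smul, LinearMap.smul_apply, altFun_smul c p]
  | 0, _, _ :: _ => (smul_zero _).symm
  | _ + 1, _, [] => (smul_zero _).symm

theorem altFun_smul' (c : 𝕂) (p : ℕ) (X : L [⋀^Fin p]→ₗ[C] L) (l : List L) :
    altFun p (c • X) l = c • altFun p X l := by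
  have h : c • X = algebraMap 𝕂 C c • X :=
    AlternatingMap.ext fun v => (algebraMap_smul C c (X v)).symm
  rw [h, altFun_smul, algebraMap_smul]

theorem altFun_mem (p : ℕ) (X : L [⋀^Fin p]→ₗ[C] L) : altFun p X ∈ ListForm 𝕂 L L := by
  refine ⟨fun l₁ l₂ x y => ?_, fun l₁ l₂ c x => ?_, fun l₁ l₂ x => ?_⟩
  · induction l₁ generalizing p with
    | nil =>
      cases p with
      | zero => exact (add_zero _).symm
      | succ p => simp only [List.nil_append, altFun, map_add, altFun_add]
    | cons w l ih =>
      cases p with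
      | zero => exact (add_zero _).symm
      | succ p => exact ih p _
  · induction l₁ generalizing p with
    | nil =>
      cases p with
      | zero => exact (smul_zero _).symm
      | succ p =>
        have h : X.curryLeft (c • x) = c • X.curryLeft x := by
          rw [← algebraMap_smul C c x, map_smul]
          ext v
          exact algebraMap_smul C c (X.curryLeft x v)
        simp only [List.nil_append, altFun, h, altFun_smul']
    | cons w l ih =>
      cases p with
      | zero => exact (smul_zero _).symm
      | succ p => exact ih p _
  · induction l₁ generalizing p with
    | nil =>
      match p with
      | 0 => rfl
      | 1 => rfl
      | p + 2 =>
        have h := altFun_smul (0 : C) p 0 l₂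
        simpa only [List.nil_append, altFun, AlternatingMap.curryLeft_same, zero_smul] using h
    | cons w l ih =>
      cases p with
      | zero => rfl
      | succ p => exact ih p _

variable (𝕂) in
/-- An alternating map as a form on lists. -/
def altToList (p : ℕ) (X : L [⋀^Fin p]→ₗ[C] L) : ListForm 𝕂 L L := ⟨altFun p X, altFun_mem p X⟩

theorem hasDegree_altToList (p : ℕ) (X : L [⋀^Fin p]→ₗ[C] L) : HasDegree (altToList 𝕂 p X) p := by
  intro l hl
  induction l generalizing p with
  | nil =>
    cases p with
    | zero => exact absurd rfl hl
    | succ p => rfl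
  | cons w l ih =>
    cases p with
    | zero => rfl
    | succ p => exact ih p _ (by simpa using hl)

theorem isLin_altToList (p : ℕ) (X : L [⋀^Fin p]→ₗ[C] L) :
    SplitLie.IsLin (C := C) (altToList 𝕂 p X) := by
  intro c x l
  cases p with
  | zero => exact (smul_zero _).symm
  | succ p =>
    change altFun p (X.curryLeft (c • x)) l = c • altFun p (X.curryLeft x) l
    rw [map_smul, altFun_smul]

theorem altToList_ofFn (p : ℕ) (X : L [⋀^Fin p]→ₗ[C] L) (a : Fin p → L) :
    altToList 𝕂 p X (List.ofFn a) = X a := by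
  induction p with
  | zero => exact congrArg X (Subsingleton.elim _ _)
  | succ p ih =>
    rw [List.ofFn_succ]
    refine (ih (X.curryLeft (a 0)) fun i => a i.succ).trans ?_
    rw [AlternatingMap.curryLeft_apply_apply]
    exact congrArg X (Fin.cons_self_tail a)

theorem ofFn_update {α : Type*} {p : ℕ} (v : Fin p → α) (k : Fin p) (x : α) :
    List.ofFn (Function.update v k x) =
      (List.ofFn v).take k ++ x :: (List.ofFn v).drop (k + 1) := by
  have h : List.ofFn (Function.update v k x) = (List.ofFn v).set k x := by
    refine List.ext_getElem (by simp) fun i h₁ h₂ => ?_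
    rw [List.getElem_set]
    simp [Function.update_apply, Fin.ext_iff, eq_comm]
  rw [h, List.set_eq_take_append_cons_drop, if_pos (by simp)]

theorem isLin_append {f : ListForm 𝕂 L L} (hf : SplitLie.IsLin (C := C) f) (c : C) (x : L)
    (l₁ l₂ : List L) : f (l₁ ++ (c • x) :: l₂) = c • f (l₁ ++ x :: l₂) := by
  induction l₁ generalizing f with
  | nil => exact hf c x l₂
  | cons w l ih => exact ih (f := ListForm.iota w f) (hf.iota w)

theorem ListForm.map_mem_cons (f : ListForm 𝕂 L L) (x : L) (s t : List L) :
    f (x :: (s ++ x :: t)) = 0 := by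
  induction s generalizing f with
  | nil => exact map_cons_cons_self f x t
  | cons u s ih =>
    rw [List.cons_append, map_cons_cons_swap, neg_eq_zero]
    exact ih (ListForm.iota u f)

/-- Transpositions bring two equal entries next to each other. This gives the alternating property
for arbitrary pairs of slots. -/
theorem ListForm.map_of_not_nodup (f : ListForm 𝕂 L L) {l : List L} (hl : ¬ l.Nodup) :
    f l = 0 := by
  induction l generalizing f with
  | nil => exact absurd List.nodup_nil hl
  | cons w l ih =>
    by_cases hw : w ∈ l
    · obtain ⟨s, t, rfl⟩ := List.append_of_mem hw
      exact map_mem_cons f w s t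
    · exact ih (ListForm.iota w f) fun h => hl (List.nodup_cons.2 ⟨hw, h⟩)

/-- A `C`-linear form on lists, restricted to the lists of length `p`, as an alternating map. -/
def listToAlt (p : ℕ) (f : ListForm 𝕂 L L) (hf : SplitLie.IsLin (C := C) f) :
    L [⋀^Fin p]→ₗ[C] L where
  toFun a := f (List.ofFn a)
  map_update_add' {inst} v k x y := by
    rw [Subsingleton.elim inst (instDecidableEqFin p), ofFn_update, ofFn_update, ofFn_update]
    exact f.2.1 _ _ x y
  map_update_smul' {inst} v k c x := by
    rw [Subsingleton.elim inst (instDecidableEqFin p), ofFn_update, ofFn_update]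
    exact isLin_append hf c x _ _
  map_eq_zero_of_eq' v k m h hkm := map_of_not_nodup f fun hn =>
    hkm (List.nodup_ofFn.1 hn h)

/-- Turns insertion of an endomorphism into the sums over slots that occur in `ceDiff` and
`basicBracket`. -/
theorem comp_ofFn_of_degree_one (f : ListForm 𝕂 L L) {g : ListForm 𝕂 L L} (hg : HasDegree g 1)
    {p : ℕ} (v : Fin p → L) :
    comp f g (List.ofFn v) = ∑ k, f (List.ofFn (Function.update v k (g [v k]))) := by
  induction p generalizing f with
  | zero =>
    rw [List.ofFn_zero, comp_nil, hg [] (by simp), map_zero_cons]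
    simp
  | succ p ih =>
    rw [List.ofFn_succ, comp_cons_of_degree_one f hg, Fin.sum_univ_succ, ih]
    congr 1
    · rw [List.ofFn_succ]
      simp
    · refine Finset.sum_congr rfl fun k _ => ?_
      rw [List.ofFn_succ, iota_apply]
      have h : (fun m : Fin p => Function.update v k.succ (g [v k.succ]) m.succ) =
          Function.update (fun m => v m.succ) k (g [v k.succ]) := by
        funext m
        simp [Function.update_apply]
      rw [h, Function.update_of_ne (Fin.succ_ne_zero k).symm]

end Alternating

end LiePairs


namespace LiePairs

open ListForm

/-! ### The dg Lie algebra of a matched Lie pair -/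

namespace MatchedLiePair

variable {𝕂 : Type} [RCLike 𝕂] {n : ℕ} {M : Type u} [TopologicalSpace M]
  [ChartedSpace (EuclideanSpace ℝ (Fin n)) M] (P : MatchedLiePair.{u, v} 𝕂 n M)

theorem prA_i_sec (a : Sec P.A) : P.prA.onSec (P.i.onSec a) = a :=
  Subtype.ext (funext fun x => P.prA_i x (a.1 x))

theorem prB_j_sec (b : Sec P.B) : P.prB.onSec (P.j.onSec b) = b :=
  Subtype.ext (funext fun x => P.prB_j x (b.1 x))

theorem prA_j_sec (b : Sec P.B) : P.prA.onSec (P.j.onSec b) = 0 :=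
  Subtype.ext (funext fun x => P.prA_j x (b.1 x))

theorem prB_i_sec (a : Sec P.A) : P.prB.onSec (P.i.onSec a) = 0 :=
  Subtype.ext (funext fun x => P.prB_i x (a.1 x))

theorem add_eq_sec (l : Sec P.L) :
    P.i.onSec (P.prA.onSec l) + P.j.onSec (P.prB.onSec l) = l :=
  Subtype.ext (funext fun x => P.add_eq x (l.1 x))

/-- The Lie-Rinehart algebra of sections of `L`, split into the sections of `A` and of `B`. -/
noncomputable def split : SplitLie 𝕂 (SmoothFun 𝕂 n M) (Sec P.L) where
  bracket := P.lieL.bracket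
  lie_self := P.lieL.lie_self
  jacobi := P.lieL.jacobi
  anchor := vfAct ∘ₗ P.lieL.anchor.restrictScalars 𝕂
  leibniz x y c := P.lieL.leibniz x y c
  pA := P.i.onSec ∘ₗ P.prA.onSec
  pB := P.j.onSec ∘ₗ P.prB.onSec
  add_eq := P.add_eq_sec
  pA_pA x := by simp only [LinearMap.comp_apply, prA_i_sec]
  pB_bracket x y := by
    simp only [LinearMap.comp_apply]
    rw [← P.i_hom.map_bracket, prB_i_sec, map_zero]
  pA_bracket x y := by
    simp only [LinearMap.comp_apply]
    rw [← P.j_hom.map_bracket, prA_j_sec, map_zero]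

theorem split_bracket : P.split.bracket = P.lieL.bracket := rfl

theorem split_pA (x : Sec P.L) : P.split.pA x = P.i.onSec (P.prA.onSec x) := rfl

theorem split_pB (x : Sec P.L) : P.split.pB x = P.j.onSec (P.prB.onSec x) := rfl

/-- The extension of a form on `A` with values in `B` to a form on `L` with values in `L`. -/
def hat (p : ℕ) (X : BasicForm P p) : ListForm 𝕂 (Sec P.L) (Sec P.L) :=
  altToList 𝕂 p ((P.j.onSec.compAlternatingMap X).compLinearMap P.prA.onSec)

variable {P}

theorem hat_ofFn (p : ℕ) (X : BasicForm P p) (a : Fin p → Sec P.L) :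
    P.hat p X (List.ofFn a) = P.j.onSec (X fun k => P.prA.onSec (a k)) := altToList_ofFn p _ a

theorem hat_ofFn_i (p : ℕ) (X : BasicForm P p) (a : Fin p → Sec P.A) :
    P.hat p X (List.ofFn fun k => P.i.onSec (a k)) = P.j.onSec (X a) := by
  rw [hat_ofFn]
  simp only [prA_i_sec]

theorem eq_ofFn_of_length {α : Type*} {l : List α} {p : ℕ} (h : l.length = p) :
    ∃ a : Fin p → α, l = List.ofFn a := by
  subst h
  exact ⟨l.get, (List.ofFn_get l).symm⟩

theorem hat_mem (p : ℕ) (X : BasicForm P p) : P.hat p X ∈ P.split.basic p := by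
  refine ⟨hasDegree_altToList p _, fun x => ?_, fun l => ?_, isLin_altToList p _⟩
  · ext l
    by_cases hl : (P.split.pB x :: l).length = p
    · obtain ⟨a, ha⟩ := eq_ofFn_of_length hl
      rw [iota_apply, ha, hat_ofFn]
      have h0 : P.prA.onSec (P.split.pB x) = 0 := P.prA_j_sec _
      cases p with
      | zero => simp at hl
      | succ p =>
        rw [List.ofFn_succ, List.cons.injEq] at ha
        rw [X.map_coord_zero (0 : Fin (p + 1)) (by rw [← ha.1, h0]), map_zero, eval_zero]
    · have h : P.hat p X (P.split.pB x :: l) = 0 := hasDegree_altToList p _ _ hl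
      exact h
  · by_cases hl : l.length = p
    · obtain ⟨a, rfl⟩ := eq_ofFn_of_length hl
      rw [hat_ofFn, split_pA, prA_j_sec, map_zero]
    · have h : P.hat p X l = 0 := hasDegree_altToList p _ l hl
      rw [h, map_zero]

/-- A form that vanishes on `B` is determined by its values on `A`; `formEquiv` is surjective for
this reason. -/
theorem map_map_pA {f : ListForm 𝕂 (Sec P.L) (Sec P.L)} (hf : P.split.KillsB f)
    (l : List (Sec P.L)) : f (l.map P.split.pA) = f l := by
  induction l generalizing f with
  | nil => rfl
  | cons w l ih =>
    rw [hf.map_cons, List.map_cons]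
    exact ih (f := ListForm.iota (P.split.pA w) f) (hf.iota _)

variable (P) in
/-- The space `Ω_A^p(B)` as a space of forms on lists. -/
def formEquiv (p : ℕ) : BasicForm P p ≃ₗ[𝕂] P.split.basic p where
  toFun X := ⟨P.hat p X, hat_mem p X⟩
  map_add' X Y := by
    refine Subtype.ext (ListForm.ext fun l => ?_)
    change P.hat p (X + Y) l = P.hat p X l + P.hat p Y l
    by_cases hl : l.length = p
    · obtain ⟨a, rfl⟩ := eq_ofFn_of_length hl
      simp only [hat_ofFn, AlternatingMap.add_apply, map_add]
    · rw [(hat_mem p _).1 l hl, (hat_mem p _).1 l hl, (hat_mem p _).1 l hl, add_zero]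
  map_smul' c X := by
    refine Subtype.ext (ListForm.ext fun l => ?_)
    change P.hat p (c • X) l = c • P.hat p X l
    by_cases hl : l.length = p
    · obtain ⟨a, rfl⟩ := eq_ofFn_of_length hl
      rw [hat_ofFn, hat_ofFn, AlternatingMap.smul_apply]
      exact (P.j.onSec.restrictScalars 𝕂).map_smul c _
    · rw [(hat_mem p _).1 l hl, (hat_mem p _).1 l hl, smul_zero]
  invFun f := (P.prB.onSec.compAlternatingMap (listToAlt p f.1 f.2.2.2.2)).compLinearMap P.i.onSec
  left_inv X := by
    ext1 a
    change P.prB.onSec (P.hat p X (List.ofFn fun k => P.i.onSec (a k))) = X a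
    rw [hat_ofFn_i, prB_j_sec]
  right_inv f := by
    refine Subtype.ext (ListForm.ext fun l => ?_)
    by_cases hl : l.length = p
    · obtain ⟨a, rfl⟩ := eq_ofFn_of_length hl
      refine (hat_ofFn p _ a).trans ?_
      change P.j.onSec (P.prB.onSec (f.1 (List.ofFn fun k => P.i.onSec (P.prA.onSec (a k))))) = _
      rw [← split_pB, f.2.2.2.1.pB, ← map_map_pA f.2.2.1 (List.ofFn a), List.map_ofFn]
      rfl
    · exact ((hat_mem p _).1 l hl).trans (f.2.1 l hl).symm

variable (P) in
/-- The dg Lie algebra `Ω_A^•(B)`. -/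
noncomputable def dgLie : DGLieAlgebra 𝕂 (BasicForm P) := P.split.dgLie.transport P.formEquiv

/-! ### Comparison with the explicit differential and bracket. -/

theorem semi_i_j (a : Sec P.A) (b : Sec P.B) :
    P.split.semi (P.i.onSec a) (P.j.onSec b) = P.j.onSec (connA P a b) := by
  simp only [SplitLie.semi_apply, split_pA, split_pB, prA_i_sec, prB_i_sec, prA_j_sec, prB_j_sec,
    map_zero, zero_add, add_zero]
  rfl

theorem prA_semi_i_i (a b : Sec P.A) :
    P.prA.onSec (P.split.semi (P.i.onSec a) (P.i.onSec b)) = P.lieA.bracket a b := by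
  simp only [SplitLie.semi_apply, split_pA, split_pB, prA_i_sec, prB_i_sec,
    map_zero, LinearMap.zero_apply, add_zero]
  rw [split_bracket, ← P.i_hom.map_bracket, prA_i_sec]

theorem prA_semi_swap (b : Sec P.B) (a : Sec P.A) :
    P.prA.onSec (P.split.swap.semi (P.j.onSec b) (P.i.onSec a)) = connB P b a := by
  simp only [SplitLie.semi_apply, SplitLie.swap_bracket, SplitLie.swap_pA, SplitLie.swap_pB,
    split_pA, split_pB, prA_i_sec, prB_i_sec, prA_j_sec, prB_j_sec,
    map_zero, add_zero, zero_add]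
  rfl

theorem comp_hat_D (p : ℕ) (X : BasicForm P p) (x : Sec P.A) (v : Fin p → Sec P.A) :
    comp (P.hat p X) (iota (P.i.onSec x) P.split.D) (List.ofFn fun k => P.i.onSec (v k)) =
      P.j.onSec (∑ k, X (Function.update v k (P.lieA.bracket x (v k)))) := by
  rw [comp_ofFn_of_degree_one _ (P.split.hasDegree_D.iota _), map_sum]
  refine Finset.sum_congr rfl fun k _ => ?_
  rw [hat_ofFn, iota_apply, SplitLie.D_apply]
  congr 2
  funext m
  rw [Function.update_apply, Function.update_apply]
  split_ifs with h
  · exact prA_semi_i_i _ _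
  · exact P.prA_i_sec _

theorem comp_hat_swap_D (p : ℕ) (X : BasicForm P p) (b : Sec P.B) (v : Fin p → Sec P.A) :
    comp (P.hat p X) (iota (P.j.onSec b) P.split.swap.D) (List.ofFn fun k => P.i.onSec (v k)) =
      P.j.onSec (∑ k, X (Function.update v k (connB P b (v k)))) := by
  rw [comp_ofFn_of_degree_one _ (P.split.swap.hasDegree_D.iota _), map_sum]
  refine Finset.sum_congr rfl fun k _ => ?_
  rw [hat_ofFn, iota_apply, SplitLie.D_apply]
  congr 2
  funext m
  rw [Function.update_apply, Function.update_apply]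
  split_ifs with h
  · exact prA_semi_swap _ _
  · exact P.prA_i_sec _

/-- Cartan's formula for the explicit differential: the summand `i = 0` is the Lie derivative along
`a 0`, and the others form minus the differential of the contraction. -/
theorem ceDiff_succ (k : ℕ) (X : BasicForm P (k + 1)) (a : Fin (k + 2) → Sec P.A) :
    ceDiff P (k + 1) X a = connA P (a 0) (X (Fin.tail a)) -
      ∑ l, X (Function.update (Fin.tail a) l (P.lieA.bracket (a 0) (Fin.tail a l))) -
        ceDiff P k (X.curryLeft (a 0)) (Fin.tail a) := by
  have h0 : a ∘ (0 : Fin (k + 2)).succAbove = Fin.tail a := by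
    funext l
    simp [Fin.tail]
  have h1 : ∀ i : Fin (k + 1), a ∘ i.succ.succAbove =
      Matrix.vecCons (a 0) (Fin.tail a ∘ i.succAbove) := by
    intro i
    funext l
    refine Fin.cases ?_ (fun l => ?_) l
    · simp
    · simp [Fin.tail]
  rw [ceDiff, Fin.sum_univ_succ, sub_eq_add_neg _ (ceDiff P k _ _), ceDiff, 
    ← Finset.sum_neg_distrib (G := Sec P.B)]
  congr 1
  · rw [h0]
    simp [Fin.tail, Fin.succ_pos]
  · refine Finset.sum_congr rfl fun i _ => ?_
    rw [Fin.val_succ, pow_succ, mul_neg_one, neg_smul, h1, Fin.sum_univ_succ]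
    congr 3
    -- Slot `0` now holds `a 0`; its bracket with `a i.succ` has already been counted in the summand
    -- `i = 0`.
    have h2 : ¬ i.succ < i.succ.succAbove 0 := by simp
    rw [if_neg h2, zero_add]
    refine Finset.sum_congr rfl fun l _ => ?_
    rw [Fin.succ_succAbove_succ]
    simp only [Fin.succ_lt_succ_iff]
    split_ifs with h
    · rw [AlternatingMap.curryLeft_apply_apply]
      congr 1
      funext m
      refine Fin.cases ?_ (fun m => ?_) m
      · simp [Function.update_apply, Fin.tail, (Fin.succ_ne_zero l).symm]
      · simp [Function.update_apply, Fin.tail]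
    · rfl

/-- Both differentials obey the same Cartan recursion, so induction on the degree identifies them.
-/
theorem dForm_hat (k : ℕ) (X : BasicForm P k) (a : Fin (k + 1) → Sec P.A) :
    P.split.dForm (P.hat k X) (List.ofFn fun l => P.i.onSec (a l)) =
      P.j.onSec (ceDiff P k X a) := by
  induction k with
  | zero =>
    have h := hat_ofFn_i 0 X ![]
    rw [List.ofFn_zero] at h
    rw [List.ofFn_succ, List.ofFn_zero, SplitLie.dForm_cons, SplitLie.comp_iota_D_nil,
      SplitLie.dForm_nil, h, semi_i_j, ceDiff]
    simp
    congr 3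
    exact Subsingleton.elim _ _
  | succ k ih =>
    have h : ListForm.iota (P.i.onSec (a 0)) (P.hat (k + 1) X) = P.hat k (X.curryLeft (a 0)) := by
      ext l
      change altFun k _ l = altFun k _ l
      rw [AlternatingMap.curryLeft_compLinearMap, AlternatingMap.curryLeft_compAlternatingMap,
        prA_i_sec]
    rw [List.ofFn_succ, SplitLie.dForm_cons, h, ceDiff_succ, map_sub, map_sub]
    have h1 := ih (X.curryLeft (a 0)) (Fin.tail a)
    have h2 := comp_hat_D (k + 1) X (a 0) (Fin.tail a)
    have h3 := hat_ofFn_i (k + 1) X (Fin.tail a)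
    rw [← semi_i_j, ← h1, ← h2, ← h3]
    rfl

theorem dgLie_d (k : ℕ) (X : BasicForm P k) (a : Fin (k + 1) → Sec P.A) :
    P.dgLie.d k X a = ceDiff P k X a :=
  (congrArg P.prB.onSec (dForm_hat k X a)).trans (P.prB_j_sec _)

theorem brSummand_hat (p q : ℕ) (X : BasicForm P p) (Y : BasicForm P q) (a : Fin p → Sec P.A)
    (b : Fin q → Sec P.A) :
    P.split.brSummand (P.hat p X) (P.hat q Y) (List.ofFn fun k => P.i.onSec (a k))
      (List.ofFn fun k => P.i.onSec (b k)) = P.j.onSec (P.lieB.bracket (X a) (Y b)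
        - ∑ l : Fin q, Y (Function.update b l (connB P (X a) (b l)))
        + ∑ l : Fin p, X (Function.update a l (connB P (Y b) (a l)))) := by
  rw [SplitLie.brSummand, hat_ofFn_i, hat_ofFn_i, comp_hat_swap_D, comp_hat_swap_D, map_add,
    map_sub, P.j_hom.map_bracket]
  rfl

/-- All splittings of the wrong size drop out, so the sum over splittings reduces to `(p,
q)`-shuffles. -/
theorem brSummand_eq_zero {p q : ℕ} (X : BasicForm P p) (Y : BasicForm P q)
    {l₁ l₂ : List (Sec P.L)} (hl : l₁.length ≠ p) :
    P.split.brSummand (P.hat p X) (P.hat q Y) l₁ l₂ = 0 := by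
  have h : comp (P.hat p X) (iota (P.hat q Y l₂) P.split.swap.D) l₁ = 0 :=
    (hat_mem p X).1.comp (P.split.swap.hasDegree_D.iota _) (by omega) l₁ hl
  rw [SplitLie.brSummand, h, (hat_mem p X).1 l₁ hl]
  simp

theorem dgLie_br_apply {p q r : ℕ} (h : p + q = r) (X : BasicForm P p) (Y : BasicForm P q)
    (a : Fin r → Sec P.A) : P.dgLie.br h X Y a =
      P.prB.onSec (shuffleSum 𝕂 (List.ofFn fun k => P.i.onSec (a k))
        (P.split.brSummand (P.hat p X) (P.hat q Y))) :=
  congrArg P.prB.onSec (SplitLie.brForm_eq_shuffleSum (hat_mem p X) (hat_mem q Y) _)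

/-- The factorials in `basicBracket` cancel the multiplicity in `sum_perm_eq_shuffleSum`, whose
hypotheses are that each term is skew in either block and supported on first blocks of length `p`.
-/
theorem dgLie_br (p q : ℕ) (X : BasicForm P p) (Y : BasicForm P q)
    (a : Fin (p + q) → Sec P.A) : P.dgLie.br rfl X Y a = basicBracket P p q X Y a := by
  have key := sum_perm_eq_shuffleSum (𝕂 := 𝕂) p q rfl
    (P.split.brSummand (P.hat p X) (P.hat q Y)) ?_ ?_ ?_ fun k => P.i.onSec (a k)
  · rw [dgLie_br_apply]
    have hfac : ((p.factorial : 𝕂)⁻¹ * (q.factorial : 𝕂)⁻¹) *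
        ((p.factorial : 𝕂) * q.factorial) = 1 := by
      have := Nat.cast_ne_zero (R := 𝕂) |>.2 p.factorial_ne_zero
      have := Nat.cast_ne_zero (R := 𝕂) |>.2 q.factorial_ne_zero
      field_simp
    rw [← one_smul 𝕂 (shuffleSum 𝕂 _ _), ← hfac, mul_smul, ← key, basicBracket]
    have hsm : ∀ (c : 𝕂) (x : Sec P.L), P.prB.onSec (c • x) = c • P.prB.onSec x :=
      fun c x => (P.prB.onSec.restrictScalars 𝕂).map_smul c x
    rw [hsm, map_sum]
    congr 1
    refine Finset.sum_congr rfl fun σ _ => ?_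
    rw [hsm]
    have ht : (List.ofFn ((fun k => P.i.onSec (a k)) ∘ σ)) =
        (List.ofFn fun l => P.i.onSec (a (σ (Fin.castAdd q l)))) ++
          List.ofFn fun l => P.i.onSec (a (σ (Fin.natAdd p l))) := List.ofFn_add
    rw [ht, List.take_left' (by simp), List.drop_left' (by simp), brSummand_hat, prB_j_sec]
  · intro b l₁ x y l₂
    have h₁ : P.hat p X (l₁ ++ x :: y :: l₂) = -P.hat p X (l₁ ++ y :: x :: l₂) :=
      ListForm.isSkew (P.hat p X) l₁ x y l₂
    have h₂ := ListForm.isSkew (comp (P.hat p X) (iota (P.hat q Y b) P.split.swap.D)) l₁ x y l₂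
    simp only [SplitLie.brSummand, h₁, h₂, map_neg, LinearMap.neg_apply, eval_neg]
    abel
  · intro a l₁ x y l₂
    have h₁ : P.hat q Y (l₁ ++ x :: y :: l₂) = -P.hat q Y (l₁ ++ y :: x :: l₂) :=
      ListForm.isSkew (P.hat q Y) l₁ x y l₂
    have h₂ := ListForm.isSkew (comp (P.hat q Y) (iota (P.hat p X a) P.split.swap.D)) l₁ x y l₂
    simp only [SplitLie.brSummand, h₁, h₂, map_neg, LinearMap.neg_apply, eval_neg]
    abel
  · intro l₁ l₂ hl
    exact brSummand_eq_zero X Y hl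

end MatchedLiePair

end LiePairs


namespace LiePairs

/-! ### Modules over local Artinian algebras -/

section ArtinModules

variable {𝕂 : Type} [Field 𝕂] {R : ArtAlg.{w} 𝕂}
  {X Y Z X' Y' Z' : Type*} [AddCommGroup X] [Module 𝕂 X] [AddCommGroup Y] [Module 𝕂 Y]
  [AddCommGroup Z] [Module 𝕂 Z] [AddCommGroup X'] [Module 𝕂 X'] [AddCommGroup Y'] [Module 𝕂 Y']
  [AddCommGroup Z'] [Module 𝕂 Z']

/-- The quotient by the Jacobson radical is `𝕂`, and an Artinian ring has finite length over it. -/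
theorem ArtAlg.finite (R : ArtAlg.{w} 𝕂) : Module.Finite 𝕂 R := by
  have : Module.Finite 𝕂 (R ⧸ Ring.jacobson R) := by
    refine Module.Finite.of_surjective (Algebra.linearMap 𝕂 (R ⧸ Ring.jacobson R)) fun x => ?_
    obtain ⟨r, rfl⟩ := Ideal.Quotient.mk_surjective x
    refine ⟨R.ev r, ?_⟩
    have h : algebraMap 𝕂 R (R.ev r) - r ∈ Ring.jacobson R := by
      rw [IsLocalRing.ringJacobson_eq_maximalIdeal, ← R.ev_eq_zero_iff]
      simp
    exact Ideal.Quotient.eq.2 h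
  exact IsSemiprimaryRing.finite_of_isArtinian 𝕂 R R

theorem mem_maxPart_iff {z : R ⊗[𝕂] X} : z ∈ maxPart R X ↔ evMap R X z = 0 := by
  constructor
  · intro hz
    refine Submodule.smul_induction_on hz (fun r hr m _ => ?_) fun a b ha hb => ?_
    · rw [evMap_smul, (R.ev_eq_zero_iff r).2 hr, zero_smul]
    · rw [map_add, ha, hb, add_zero]
  · intro hz
    -- Modulo the maximal ideal every `r` is the scalar `R.ev r`, so `z` is congruent to its
    -- constant part.
    have key : ∀ z : R ⊗[𝕂] X, z - 1 ⊗ₜ evMap R X z ∈ maxPart R X := by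
      intro z
      induction z with
      | zero => simp
      | tmul r x =>
        have h : (r ⊗ₜ x : R ⊗[𝕂] X) - 1 ⊗ₜ evMap R X (r ⊗ₜ x) =
            (r - algebraMap 𝕂 R (R.ev r)) • ((1 : R) ⊗ₜ[𝕂] x) := by
          rw [evMap_tmul, TensorProduct.tmul_smul, tmul_eq_smul r,
            ← algebraMap_smul R (R.ev r) ((1 : R) ⊗ₜ[𝕂] x)]
          exact (sub_smul r (algebraMap 𝕂 R (R.ev r)) ((1 : R) ⊗ₜ[𝕂] x)).symm
        rw [h]
        refine Submodule.smul_mem_smul ?_ trivial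
        rw [← R.ev_eq_zero_iff]
        simp
      | add a b ha hb =>
        have h := add_mem ha hb
        rw [map_add, TensorProduct.tmul_add]
        convert h using 1
        abel
    simpa [hz] using key z

theorem evMap_baseChange (φ : X →ₗ[𝕂] Y) (z : R ⊗[𝕂] X) :
    evMap R Y (φ.baseChange R z) = φ (evMap R X z) := by
  induction z with
  | zero => simp
  | tmul r x => simp
  | add a b ha hb => simp [ha, hb]

theorem evMap_extBilin (β : X →ₗ[𝕂] Y →ₗ[𝕂] Z) (z : R ⊗[𝕂] X) (t : R ⊗[𝕂] Y) :
    evMap R Z (extBilin R β z t) = β (evMap R X z) (evMap R Y t) := by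
  induction z with
  | zero => simp
  | tmul r x =>
    induction t with
    | zero => simp
    | tmul s y => simp [mul_smul, smul_comm (R.ev r)]
    | add a b ha hb => simp only [map_add, ha, hb]
  | add a b ha hb => simp [ha, hb]

theorem evMap_eq_of_one_tmul {φ : R ⊗[𝕂] X →ₗ[R] R ⊗[𝕂] Y} {ψ : X →ₗ[𝕂] Y}
    (h : ∀ x, evMap R Y (φ (1 ⊗ₜ x)) = ψ x) (z : R ⊗[𝕂] X) :
    evMap R Y (φ z) = ψ (evMap R X z) := by
  induction z using one_tmul_induction with
  | h0 => simp
  | hadd a b ha hb => simp only [map_add, ha, hb]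
  | hsmul s a ha => rw [map_smul, evMap_smul, evMap_smul, ha, map_smul]
  | h1 x => simp [h]

theorem baseChange_extBilin (β : X →ₗ[𝕂] Y →ₗ[𝕂] Z) (γ : X' →ₗ[𝕂] Y' →ₗ[𝕂] Z') (φ : Z →ₗ[𝕂] Z')
    (ψ : X →ₗ[𝕂] X') (χ : Y →ₗ[𝕂] Y') (h : ∀ x y, φ (β x y) = γ (ψ x) (χ y))
    (z : R ⊗[𝕂] X) (t : R ⊗[𝕂] Y) :
    φ.baseChange R (extBilin R β z t) =
      extBilin R γ (ψ.baseChange R z) (χ.baseChange R t) := by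
  induction z with
  | zero => simp
  | tmul r x =>
    induction t with
    | zero => simp
    | tmul s y => simp [h]
    | add a b ha hb => simp only [map_add, ha, hb]
  | add a b ha hb => simp [ha, hb]

/-- An `R`-linear endomorphism that induces the identity modulo the maximal ideal is bijective. -/
theorem bijective_of_evMap {φ : R ⊗[𝕂] X →ₗ[R] R ⊗[𝕂] X}
    (h : ∀ z, evMap R X (φ z) = evMap R X z) : Function.Bijective φ := by
  obtain ⟨N, hN⟩ := R.isNilpotent_maximalIdeal
  set ν : Module.End R (R ⊗[𝕂] X) := φ - 1 with hν
  have key : ∀ (k : ℕ) (y : R ⊗[𝕂] X), (ν ^ k) y ∈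
      (IsLocalRing.maximalIdeal R ^ k • ⊤ : Submodule R (R ⊗[𝕂] X)) := by
    intro k
    induction k with
    | zero => intro y; simp
    | succ k ih =>
      intro y
      rw [pow_succ ν, Module.End.mul_apply]
      have hy : ν y ∈ maxPart R X := by
        rw [mem_maxPart_iff]
        simp [hν, h]
      -- The map `ν` takes values in `𝔪 ⊗ X` and is `R`-linear, so each further power gains a factor
      -- `𝔪`; nilpotency of `𝔪` then makes `φ = 1 + ν` invertible.
      have h2 : maxPart R X ≤ Submodule.comap (ν ^ k)
          (IsLocalRing.maximalIdeal R ^ (k + 1) • ⊤) := by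
        rw [maxPart, ← Submodule.map_le_iff_le_comap, Submodule.map_smul'', pow_succ',
          Submodule.mul_smul]
        refine Submodule.smul_mono le_rfl ?_
        rintro _ ⟨t, -, rfl⟩
        exact ih t
      exact h2 hy
  have hnil : ν ^ N = 0 := LinearMap.ext fun y => by simpa [hN] using key N y
  have hu : IsUnit φ := by
    have h2 := IsNilpotent.isUnit_one_add (R := Module.End R (R ⊗[𝕂] X)) (r := φ - 1) ⟨N, hnil⟩
    rwa [add_sub_cancel (1 : Module.End R (R ⊗[𝕂] X)) φ] at h2
  exact (Module.End.isUnit_iff φ).1 hu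

/-! ### Coordinates with respect to a basis of `R`. -/

section Coefficients

variable {ι : Type*} [DecidableEq ι] (e : Module.Basis ι 𝕂 R)

variable (X) in
/-- The coefficients of an element of `R ⊗ X` in a basis of `R`. -/
noncomputable def coeff (k : ι) : R ⊗[𝕂] X →ₗ[𝕂] X :=
  Finsupp.lapply k ∘ₗ (TensorProduct.equivFinsuppOfBasisLeft e).toLinearMap

theorem coeff_tmul (k : ι) (r : R) (x : X) : coeff X e k (r ⊗ₜ x) = e.repr r k • x :=
  TensorProduct.equivFinsuppOfBasisLeft_apply_tmul_apply e r x k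

theorem coeff_ext {z t : R ⊗[𝕂] X} (h : ∀ k, coeff X e k z = coeff X e k t) : z = t :=
  (TensorProduct.equivFinsuppOfBasisLeft e).injective (Finsupp.ext h)

theorem coeff_baseChange (φ : X →ₗ[𝕂] Y) (k : ι) (z : R ⊗[𝕂] X) :
    coeff Y e k (φ.baseChange R z) = φ (coeff X e k z) := by
  induction z with
  | zero => simp
  | tmul r x => simp [coeff_tmul]
  | add a b ha hb => simp [ha, hb]

theorem sum_coeff [Fintype ι] (z : R ⊗[𝕂] X) : ∑ k, e k ⊗ₜ coeff X e k z = z := by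
  refine coeff_ext e fun m => ?_
  simp [coeff_tmul, Finsupp.single_apply]

end Coefficients

/-- A jointly injective family of linear maps remains so after extension of scalars. -/
theorem ext_of_baseChange {ι : Type*} {Y : ι → Type*} [∀ k, AddCommGroup (Y k)]
    [∀ k, Module 𝕂 (Y k)] (φ : ∀ k, X →ₗ[𝕂] Y k)
    (h : ∀ x, (∀ k, φ k x = 0) → x = 0) {z t : R ⊗[𝕂] X}
    (hz : ∀ k, (φ k).baseChange R z = (φ k).baseChange R t) : z = t := by
  classical
  let e := Module.Basis.ofVectorSpace 𝕂 R
  refine coeff_ext e fun m => sub_eq_zero.1 (h _ fun k => ?_)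
  rw [map_sub, ← coeff_baseChange, ← coeff_baseChange, hz, sub_self]

end ArtinModules

/-! ### Exponentials -/

section Exponentials

variable {𝕂 : Type} [Field 𝕂] [CharZero 𝕂] {R : ArtAlg.{w} 𝕂}
  {X Y Z : Type*} [AddCommGroup X] [Module R X] [Module 𝕂 X] [SMulCommClass R 𝕂 X]
  [AddCommGroup Y] [Module R Y] [Module 𝕂 Y] [SMulCommClass R 𝕂 Y]
  [AddCommGroup Z] [Module R Z] [Module 𝕂 Z] [SMulCommClass R 𝕂 Z]

omit [CharZero 𝕂] in
theorem nilExp_zero : nilExp R (0 : Module.End R X) = 1 := by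
  rw [nilExp_eq_sum (N := 1) _ (by simp)]
  simp

omit [CharZero 𝕂] [Module 𝕂 X] [SMulCommClass R 𝕂 X] [Module 𝕂 Y] [SMulCommClass R 𝕂 Y]
  [Module 𝕂 Z] [SMulCommClass R 𝕂 Z] in
theorem pow_leibniz (β : X →ₗ[R] Y →ₗ[R] Z) {φ : Module.End R X} {ψ : Module.End R Y}
    {χ : Module.End R Z} (h : ∀ x y, χ (β x y) = β (φ x) y + β x (ψ y)) (k : ℕ) (x : X) (y : Y) :
    (χ ^ k) (β x y) = ∑ ij ∈ Finset.HasAntidiagonal.antidiagonal k,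
      k.choose ij.1 • β ((φ ^ ij.1) x) ((ψ ^ ij.2) y) := by
  induction k with
  | zero => simp
  | succ k ih =>
    rw [Finset.sum_antidiagonal_choose_succ_nsmul
      (fun i j => β ((φ ^ i) x) ((ψ ^ j) y)) k, pow_succ', Module.End.mul_apply, ih, map_sum,
      ← Finset.sum_add_distrib]
    refine Finset.sum_congr rfl fun ij hij => ?_
    rw [map_nsmul, h, smul_add, add_comm, pow_succ' φ, pow_succ' ψ, Module.End.mul_apply,
      Module.End.mul_apply, Nat.choose_symm_of_eq_add (Finset.HasAntidiagonal.mem_antidiagonal.1 hij).symm]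

/-- The exponential of a derivation is compatible with products. -/
theorem nilExp_bilin (β : X →ₗ[R] Y →ₗ[R] Z) (hβ₁ : ∀ (c : 𝕂) x y, β (c • x) y = c • β x y)
    (hβ₂ : ∀ (c : 𝕂) x y, β x (c • y) = c • β x y)
    {φ : Module.End R X} {ψ : Module.End R Y}
    {χ : Module.End R Z} (hφ : IsNilpotent φ) (hψ : IsNilpotent ψ) (hχ : IsNilpotent χ)
    (h : ∀ x y, χ (β x y) = β (φ x) y + β x (ψ y)) (x : X) (y : Y) :
    nilExp R χ (β x y) = β (nilExp R φ x) (nilExp R ψ y) := by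
  obtain ⟨a, ha⟩ := hφ
  obtain ⟨b, hb⟩ := hψ
  obtain ⟨c, hc⟩ := hχ
  have hφ' : ∀ i, a ≤ i → φ ^ i = 0 := fun i hi => pow_eq_zero_of_le hi ha
  have hψ' : ∀ i, b ≤ i → ψ ^ i = 0 := fun i hi => pow_eq_zero_of_le hi hb
  set N := a + b + c
  rw [nilExp_eq_sum φ (hφ' N (by omega)), nilExp_eq_sum ψ (hψ' N (by omega)),
    nilExp_eq_sum χ (pow_eq_zero_of_le (by omega : c ≤ N) hc)]
  let G : ℕ × ℕ → Z := fun ij =>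
    ((ij.1.factorial : 𝕂)⁻¹ * (ij.2.factorial : 𝕂)⁻¹) • β ((φ ^ ij.1) x) ((ψ ^ ij.2) y)
  have h1 : ∀ k, (k.factorial : 𝕂)⁻¹ • (χ ^ k) (β x y) = ∑ ij ∈ Finset.HasAntidiagonal.antidiagonal k, G ij := by
    intro k
    rw [pow_leibniz β h, Finset.smul_sum]
    refine Finset.sum_congr rfl fun ij hij => ?_
    rw [← Nat.cast_smul_eq_nsmul 𝕂, smul_smul]
    congr 1
    obtain rfl := Finset.HasAntidiagonal.mem_antidiagonal.1 hij
    rw [Nat.choose_symm_add, Nat.add_choose, Nat.cast_div (Nat.factorial_mul_factorial_dvd_factorial_add _ _)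
      (Nat.cast_ne_zero.2 (by positivity)), Nat.cast_mul]
    have := Nat.cast_ne_zero (R := 𝕂) |>.2 (ij.1 + ij.2).factorial_ne_zero
    field_simp
  -- Beyond the diagonal `i + j = N` one of the powers vanishes. The square of the double series
  -- therefore equals the triangle of the Cauchy product.
  have h2 : ∀ ij : ℕ × ℕ, N ≤ ij.1 + ij.2 → G ij = 0 := by
    intro ij hij
    by_cases hi : a ≤ ij.1
    · simp [G, hφ' _ hi]
    · simp [G, hψ' ij.2 (by omega)]
  simp only [LinearMap.sum_apply, LinearMap.smul_apply, map_sum, h1]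
  have h3 : ∑ i ∈ Finset.range N, ∑ j ∈ Finset.range N, G (i, j) =
      ∑ ij ∈ (Finset.range N ×ˢ Finset.range N).filter (fun ij => ij.1 + ij.2 < N), G ij := by
    rw [← Finset.sum_product', Finset.sum_filter_of_ne]
    intro ij _ hne
    by_contra hcon
    exact hne (h2 ij (not_lt.1 hcon))
  have h4 : ∑ k ∈ Finset.range N, ∑ ij ∈ Finset.HasAntidiagonal.antidiagonal k, G ij =
      ∑ ij ∈ (Finset.range N ×ˢ Finset.range N).filter (fun ij => ij.1 + ij.2 < N), G ij := by
    rw [← Finset.sum_fiberwise_of_maps_to (t := Finset.range N) (g := fun ij : ℕ × ℕ => ij.1 + ij.2)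
      (fun ij hij => by simpa using (Finset.mem_filter.1 hij).2)]
    refine Finset.sum_congr rfl fun k hk => Finset.sum_congr ?_ fun _ _ => rfl
    ext ij
    have := Finset.mem_range.1 hk
    simp only [Finset.HasAntidiagonal.mem_antidiagonal, Finset.mem_filter, Finset.mem_product, Finset.mem_range]
    omega
  rw [h4, ← h3, Finset.sum_comm]
  refine Finset.sum_congr rfl fun j _ => ?_
  refine Finset.sum_congr rfl fun i _ => ?_
  rw [hβ₂, hβ₁, smul_smul, mul_comm]

end Exponentials

end LiePairs


namespace LiePairs

namespace MatchedLiePair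

/-! ### Extension of scalars of a matched Lie pair -/

section Extension

variable {𝕂 : Type} [RCLike 𝕂] {n : ℕ} {M : Type u} [TopologicalSpace M]
  [ChartedSpace (EuclideanSpace ℝ (Fin n)) M] (P : MatchedLiePair.{u, v} 𝕂 n M)
  (R : ArtAlg.{w} 𝕂)

/-- The inclusion `Γ(A) ⊗ R → Γ(L) ⊗ R`. -/
noncomputable def inclA : R ⊗[𝕂] Sec P.A →ₗ[R] R ⊗[𝕂] Sec P.L :=
  (P.i.onSec.restrictScalars 𝕂).baseChange R

/-- The projection `Γ(L) ⊗ R → Γ(A) ⊗ R`. -/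
noncomputable def projA : R ⊗[𝕂] Sec P.L →ₗ[R] R ⊗[𝕂] Sec P.A :=
  (P.prA.onSec.restrictScalars 𝕂).baseChange R

/-- The projection `Γ(L) ⊗ R → Γ(B) ⊗ R`. -/
noncomputable def projB : R ⊗[𝕂] Sec P.L →ₗ[R] R ⊗[𝕂] Sec P.B :=
  (P.prB.onSec.restrictScalars 𝕂).baseChange R

/-- The bracket of `Γ(L) ⊗ R`. -/
noncomputable def brR : R ⊗[𝕂] Sec P.L →ₗ[R] R ⊗[𝕂] Sec P.L →ₗ[R] R ⊗[𝕂] Sec P.L :=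
  (P.lieL.cartesian R).bracket

variable {P R}

theorem inclA_tmul (r : R) (a : Sec P.A) : inclA P R (r ⊗ₜ a) = r ⊗ₜ P.i.onSec a := rfl

theorem inclB_tmul (r : R) (b : Sec P.B) : inclB P R (r ⊗ₜ b) = r ⊗ₜ P.j.onSec b := rfl

theorem projA_tmul (r : R) (x : Sec P.L) : projA P R (r ⊗ₜ x) = r ⊗ₜ P.prA.onSec x := rfl

theorem projB_tmul (r : R) (x : Sec P.L) : projB P R (r ⊗ₜ x) = r ⊗ₜ P.prB.onSec x := rfl

theorem brR_tmul (r s : R) (x y : Sec P.L) :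
    brR P R (r ⊗ₜ x) (s ⊗ₜ y) = (r * s) ⊗ₜ P.lieL.bracket x y := extBilin_tmul _ r s x y

theorem projA_inclA (z : R ⊗[𝕂] Sec P.A) : projA P R (inclA P R z) = z := by
  induction z with
  | zero => simp
  | tmul r x => rw [inclA_tmul, projA_tmul, prA_i_sec]
  | add a b ha hb => rw [map_add, map_add, ha, hb]

theorem projB_inclB (z : R ⊗[𝕂] Sec P.B) : projB P R (inclB P R z) = z := by
  induction z with
  | zero => simp
  | tmul r x => rw [inclB_tmul, projB_tmul, prB_j_sec]
  | add a b ha hb => rw [map_add, map_add, ha, hb]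

theorem projA_inclB (z : R ⊗[𝕂] Sec P.B) : projA P R (inclB P R z) = 0 := by
  induction z with
  | zero => simp
  | tmul r x => rw [inclB_tmul, projA_tmul, prA_j_sec, TensorProduct.tmul_zero]
  | add a b ha hb => rw [map_add, map_add, ha, hb, add_zero]

theorem projB_inclA (z : R ⊗[𝕂] Sec P.A) : projB P R (inclA P R z) = 0 := by
  induction z with
  | zero => simp
  | tmul r x => rw [inclA_tmul, projB_tmul, prB_i_sec, TensorProduct.tmul_zero]
  | add a b ha hb => rw [map_add, map_add, ha, hb, add_zero]

theorem inclA_add_inclB (z : R ⊗[𝕂] Sec P.L) :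
    inclA P R (projA P R z) + inclB P R (projB P R z) = z := by
  induction z with
  | zero => simp
  | tmul r x =>
    rw [projA_tmul, projB_tmul, inclA_tmul, inclB_tmul, ← TensorProduct.tmul_add, add_eq_sec]
  | add a b ha hb =>
    conv_rhs => rw [← ha, ← hb]
    simp only [map_add]
    abel

theorem projB_brR_inclA (x y : R ⊗[𝕂] Sec P.A) :
    projB P R (brR P R (inclA P R x) (inclA P R y)) = 0 := by
  induction x with
  | zero => simp
  | tmul r x =>
    induction y with
    | zero => simp
    | tmul s y =>
      rw [inclA_tmul, inclA_tmul, brR_tmul, projB_tmul, ← P.i_hom.map_bracket, prB_i_sec,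
        TensorProduct.tmul_zero]
    | add a b ha hb => rw [map_add, map_add, map_add, ha, hb, add_zero]
  | add a b ha hb => rw [map_add, map_add, LinearMap.add_apply, map_add, ha, hb, add_zero]

theorem projA_brR_inclB (x y : R ⊗[𝕂] Sec P.B) :
    projA P R (brR P R (inclB P R x) (inclB P R y)) = 0 := by
  induction x with
  | zero => simp
  | tmul r x =>
    induction y with
    | zero => simp
    | tmul s y =>
      rw [inclB_tmul, inclB_tmul, brR_tmul, projA_tmul, ← P.j_hom.map_bracket, prA_j_sec,
        TensorProduct.tmul_zero]
    | add a b ha hb => rw [map_add, map_add, map_add, ha, hb, add_zero]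
  | add a b ha hb => rw [map_add, map_add, LinearMap.add_apply, map_add, ha, hb, add_zero]

theorem brR_skew (x y : R ⊗[𝕂] Sec P.L) : brR P R x y = -brR P R y x := by
  have h := (P.lieL.cartesian R).lie_self (x + y)
  simp only [map_add, LinearMap.add_apply, (P.lieL.cartesian R).lie_self, zero_add, add_zero] at h
  exact eq_neg_iff_add_eq_zero.2 (by rw [add_comm]; exact h)

theorem map_fsmul {E F : SmoothVectorBundle.{u, v} 𝕂 n M}
    (φ : Sec E →ₗ[SmoothFun 𝕂 n M] Sec F) (f : R ⊗[𝕂] SmoothFun 𝕂 n M) (z : R ⊗[𝕂] Sec E) :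
    (φ.restrictScalars 𝕂).baseChange R (fsmul R f z) =
      fsmul R f ((φ.restrictScalars 𝕂).baseChange R z) := by
  have h := baseChange_extBilin (R := R) (funMul (𝕂 := 𝕂) (n := n) (M := M) (Sec E))
    (funMul (𝕂 := 𝕂) (n := n) (M := M) (Sec F)) (φ.restrictScalars 𝕂) LinearMap.id
    (φ.restrictScalars 𝕂) (fun f x => φ.map_smul f x) f z
  rwa [LinearMap.baseChange_id] at h

/-! #### Forms of degree one as linear maps -/

variable (P) in
/-- The evaluation of forms of degree zero. -/
noncomputable def formZero : BasicForm P 0 ≃ₗ[𝕂] Sec P.B where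
  toFun X := X ![]
  invFun b := AlternatingMap.constOfIsEmpty (SmoothFun 𝕂 n M) (Sec P.A) (Fin 0) b
  map_add' _ _ := rfl
  map_smul' _ _ := rfl
  left_inv X := AlternatingMap.ext fun _ => congrArg X (Subsingleton.elim _ _)
  right_inv _ := rfl

variable (P) in
/-- The evaluation of forms of degree one. -/
noncomputable def evalOne : BasicForm P 1 →ₗ[𝕂] Sec P.A →ₗ[𝕂] Sec P.B :=
  LinearMap.mk₂ 𝕂 (fun X a => X.curryLeft a ![])
    (fun X Y a => by rw [AlternatingMap.curryLeft_add]; rfl)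
    (fun c X a => rfl)
    (fun X a a' => by rw [map_add]; rfl)
    (fun c X a => by
      rw [← algebraMap_smul (SmoothFun 𝕂 n M) c a, map_smul, AlternatingMap.smul_apply,
        algebraMap_smul])

theorem evalOne_apply (X : BasicForm P 1) (a : Sec P.A) : evalOne P X a = X ![a] := rfl

theorem evalOne_smul (X : BasicForm P 1) (f : SmoothFun 𝕂 n M) (a : Sec P.A) :
    evalOne P X (f • a) = f • evalOne P X a := by
  change X.curryLeft (f • a) ![] = f • X.curryLeft a ![]
  rw [map_smul]
  rfl

theorem ext_evalOne {X : BasicForm P 1} (h : ∀ a, evalOne P X a = 0) : X = 0 := by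
  ext1 v
  rw [show v = ![v 0] from funext fun k => by fin_cases k; rfl]
  exact h (v 0)

variable (P) in
/-- The evaluation of forms of degree two at two sections. -/
noncomputable def evalTwo (a : Sec P.A × Sec P.A) : BasicForm P 2 →ₗ[𝕂] Sec P.B where
  toFun X := X ![a.1, a.2]
  map_add' _ _ := rfl
  map_smul' _ _ := rfl

theorem ext_evalTwo {X : BasicForm P 2} (h : ∀ a, evalTwo P a X = 0) : X = 0 := by
  ext1 v
  rw [show v = ![v 0, v 1] from funext fun k => by fin_cases k <;> rfl]
  exact h (v 0, v 1)

variable (P R) in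
/-- The `R`-linear map `Γ(A) ⊗ R → Γ(B) ⊗ R` given by an element of `Ω_A^1(B) ⊗ R`. -/
noncomputable def formMap : R ⊗[𝕂] BasicForm P 1 →ₗ[R] R ⊗[𝕂] Sec P.A →ₗ[R] R ⊗[𝕂] Sec P.B :=
  extBilin R (evalOne P)

theorem formMap_tmul (r s : R) (X : BasicForm P 1) (a : Sec P.A) :
    formMap P R (r ⊗ₜ X) (s ⊗ₜ a) = (r * s) ⊗ₜ evalOne P X a := extBilin_tmul _ r s X a

theorem formMap_fsmul (ξ : R ⊗[𝕂] BasicForm P 1) (f : R ⊗[𝕂] SmoothFun 𝕂 n M)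
    (z : R ⊗[𝕂] Sec P.A) : formMap P R ξ (fsmul R f z) = fsmul R f (formMap P R ξ z) := by
  induction ξ with
  | zero => simp
  | add a b ha hb => simp only [map_add, LinearMap.add_apply, ha, hb]
  | tmul r X =>
    induction f with
    | zero => simp
    | add a b ha hb => simp only [map_add, LinearMap.add_apply, ha, hb]
    | tmul s f =>
      induction z with
      | zero => simp
      | add a b ha hb => simp only [map_add, ha, hb]
      | tmul t a =>
        simp only [fsmul, formMap_tmul, extBilin_tmul]
        rw [mul_left_comm]
        congr 1
        exact evalOne_smul X f a

theorem formMap_one_tmul (ξ : R ⊗[𝕂] BasicForm P 1) (a : Sec P.A) :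
    formMap P R ξ (1 ⊗ₜ a) = ((evalOne P).flip a).baseChange R ξ := by
  induction ξ with
  | zero => simp
  | add a b ha hb => simp only [map_add, LinearMap.add_apply, ha, hb]
  | tmul r X => rw [formMap_tmul, mul_one]; rfl

theorem formMap_injective : Function.Injective (formMap P R) := by
  intro ξ η h
  refine ext_of_baseChange (fun a : Sec P.A => (evalOne P).flip a) (fun X hX => ext_evalOne hX)
    fun a => ?_
  rw [← formMap_one_tmul, ← formMap_one_tmul, h]

/-- As `R` is finite-dimensional, `η` is a finite sum of basis elements times coefficient maps `Γ(A)
→ Γ(B)`, and linearity of `η` over functions makes each coefficient a form of degree one. -/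
theorem exists_formMap_eq (η : R ⊗[𝕂] Sec P.A →ₗ[R] R ⊗[𝕂] Sec P.B)
    (hη : ∀ (f : R ⊗[𝕂] SmoothFun 𝕂 n M) z, η (fsmul R f z) = fsmul R f (η z)) : ∃ ξ, formMap P R ξ = η := by
  have := R.finite
  let e := Module.finBasis 𝕂 R
  let c : ∀ k, Sec P.A →ₗ[SmoothFun 𝕂 n M] Sec P.B := fun k =>
    { toFun := fun a => coeff _ e k (η (1 ⊗ₜ a))
      map_add' := fun a b => by rw [TensorProduct.tmul_add, map_add, map_add]
      map_smul' := fun f a => by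
        -- Multiplication by `1 ⊗ f` is an extension of scalars, so it commutes with taking
        -- coefficients.
        have h1 : ∀ {E : SmoothVectorBundle.{u, v} 𝕂 n M} (z : R ⊗[𝕂] Sec E),
            fsmul R (1 ⊗ₜ f) z =
              (funMul (𝕂 := 𝕂) (n := n) (M := M) (Sec E) f).baseChange R z := by
          intro E z
          induction z with
          | zero => simp
          | add a b ha hb => simp only [map_add, ha, hb]
          | tmul r a => rw [fsmul, extBilin_tmul, one_mul]; rfl
        have h2 : (1 : R) ⊗ₜ[𝕂] (f • a) = fsmul R ((1 : R) ⊗ₜ[𝕂] f) (1 ⊗ₜ a) := by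
          rw [h1]; rfl
        rw [h2, hη, h1, coeff_baseChange]
        rfl }
  let X : ∀ k, BasicForm P 1 := fun k =>
    AlternatingMap.ofSubsingleton (SmoothFun 𝕂 n M) (Sec P.A) (Sec P.B) (0 : Fin 1) (c k)
  refine ⟨∑ k, e k ⊗ₜ X k, LinearMap.ext fun z => ?_⟩
  induction z using one_tmul_induction with
  | h0 => simp
  | hadd a b ha hb => rw [map_add, map_add, ha, hb]
  | hsmul s a ha => rw [map_smul, map_smul, ha]
  | h1 a =>
    rw [map_sum, LinearMap.sum_apply]
    conv_rhs => rw [← sum_coeff e (η (1 ⊗ₜ a))]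
    refine Finset.sum_congr rfl fun k _ => ?_
    rw [formMap_tmul, mul_one]
    rfl

theorem evMap_formMap (ξ : R ⊗[𝕂] BasicForm P 1) (z : R ⊗[𝕂] Sec P.A) :
    evMap R _ (formMap P R ξ z) = evalOne P (evMap R _ ξ) (evMap R _ z) := evMap_extBilin _ ξ z

theorem mem_maxPart_iff_formMap {ξ : R ⊗[𝕂] BasicForm P 1} :
    ξ ∈ maxPart R (BasicForm P 1) ↔ ∀ z, evMap R _ (formMap P R ξ z) = 0 := by
  rw [mem_maxPart_iff]
  constructor
  · intro h z
    rw [evMap_formMap, h, map_zero, LinearMap.zero_apply]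
  · intro h
    refine ext_evalOne fun a => ?_
    have := h (1 ⊗ₜ a)
    rwa [evMap_formMap, evMap_tmul, map_one, one_smul] at this

end Extension

end MatchedLiePair

end LiePairs


namespace LiePairs

namespace MatchedLiePair

/-! ### The dg Lie algebra in low degrees -/

section LowDegrees

variable {𝕂 : Type} [RCLike 𝕂] {n : ℕ} {M : Type u} [TopologicalSpace M]
  [ChartedSpace (EuclideanSpace ℝ (Fin n)) M] {P : MatchedLiePair.{u, v} 𝕂 n M}
  {R : ArtAlg.{w} 𝕂}

theorem evalOne_d (X : BasicForm P 0) (a : Sec P.A) :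
    evalOne P (P.dgLie.d 0 X) a =
      P.prB.onSec (P.lieL.bracket (P.i.onSec a) (P.j.onSec (formZero P X))) := by
  rw [evalOne_apply, dgLie_d, ceDiff, Fin.sum_univ_succ]
  simp only [Finset.univ_eq_empty, Finset.sum_empty, sub_zero, add_zero, Fin.val_zero, pow_zero,
    one_smul, connA]
  rw [show (![a] ∘ Fin.succAbove (0 : Fin 1) : Fin 0 → Sec P.A) = ![] from Subsingleton.elim _ _]
  rfl

theorem evalTwo_d (X : BasicForm P 1) (a : Sec P.A × Sec P.A) :
    evalTwo P a (P.dgLie.d 1 X) =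
      P.prB.onSec (P.lieL.bracket (P.i.onSec a.1) (P.j.onSec (evalOne P X a.2))) -
      P.prB.onSec (P.lieL.bracket (P.i.onSec a.2) (P.j.onSec (evalOne P X a.1))) -
      evalOne P X (P.prA.onSec (P.lieL.bracket (P.i.onSec a.1) (P.i.onSec a.2))) := by
  change P.dgLie.d 1 X ![a.1, a.2] = _
  rw [dgLie_d, ceDiff_succ, ceDiff, ← P.i_hom.map_bracket, prA_i_sec, Fin.sum_univ_succ,
    Fin.sum_univ_succ]
  simp only [Finset.univ_eq_empty, Finset.sum_empty, sub_zero, add_zero, Fin.val_zero, pow_zero,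
    one_smul, connA, evalOne_apply]
  have h : Fin.tail ![a.1, a.2] = ![a.2] := rfl
  have h' : Function.update ![a.2] 0 (P.lieA.bracket a.1 a.2) = ![P.lieA.bracket a.1 a.2] := by
    funext k
    fin_cases k
    rfl
  rw [AlternatingMap.curryLeft_apply_apply, h]
  rw [show (![a.2] ∘ Fin.succAbove (0 : Fin 1) : Fin 0 → Sec P.A) = ![] from Subsingleton.elim _ _]
  simp only [Matrix.cons_val_zero, h']
  exact sub_right_comm _ _ _

/-- The contribution of one shuffle to the bracket of two forms of degree one. -/
noncomputable def brTerm (X Y : BasicForm P 1) (a a' : Sec P.A) : Sec P.B :=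
  P.prB.onSec (P.lieL.bracket (P.j.onSec (evalOne P X a)) (P.j.onSec (evalOne P Y a'))) -
    evalOne P Y (P.prA.onSec (P.lieL.bracket (P.j.onSec (evalOne P X a)) (P.i.onSec a'))) +
    evalOne P X (P.prA.onSec (P.lieL.bracket (P.j.onSec (evalOne P Y a')) (P.i.onSec a)))

theorem update_singleton {α : Type*} (a b : α) : Function.update ![a] 0 b = ![b] := by
  funext k
  fin_cases k
  rfl

theorem brSummand_one_one (X Y : BasicForm P 1) (a a' : Sec P.A) :
    P.prB.onSec (P.split.brSummand (P.hat 1 X) (P.hat 1 Y) [P.i.onSec a] [P.i.onSec a']) =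
      brTerm X Y a a' := by
  have h := brSummand_hat 1 1 X Y ![a] ![a']
  simp only [List.ofFn_succ, List.ofFn_zero, Matrix.cons_val_fin_one] at h
  rw [h, prB_j_sec, brTerm, ← P.j_hom.map_bracket, prB_j_sec]
  simp only [Finset.univ_unique, Fin.default_eq_zero, Finset.sum_singleton, update_singleton]
  rfl

theorem evalTwo_br (X Y : BasicForm P 1) (a : Sec P.A × Sec P.A) :
    evalTwo P a (P.dgLie.br (show 1 + 1 = 2 from rfl) X Y) =
      brTerm X Y a.1 a.2 - brTerm X Y a.2 a.1 := by
  change P.dgLie.br _ X Y ![a.1, a.2] = _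
  rw [dgLie_br_apply]
  have h : (List.ofFn fun k : Fin 2 => P.i.onSec (![a.1, a.2] k)) =
    [P.i.onSec a.1, P.i.onSec a.2] := rfl
  rw [h]
  simp only [shuffleSum]
  rw [brSummand_eq_zero X Y (l₁ := [_, _]) (by simp), brSummand_eq_zero X Y (l₁ := []) (by simp),
    ← brSummand_one_one, ← brSummand_one_one, ← map_sub]
  congr 1
  simp [sub_eq_add_neg]

theorem evalOne_br (X : BasicForm P 0) (Y : BasicForm P 1) (a : Sec P.A) :
    evalOne P (P.dgLie.br (zero_add 1) X Y) a =
      P.prB.onSec (P.lieL.bracket (P.j.onSec (formZero P X)) (P.j.onSec (evalOne P Y a))) -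
      evalOne P Y (P.prA.onSec (P.lieL.bracket (P.j.onSec (formZero P X)) (P.i.onSec a))) := by
  rw [evalOne_apply, dgLie_br_apply]
  have h : (List.ofFn fun k : Fin 1 => P.i.onSec (![a] k)) = [P.i.onSec a] := rfl
  rw [h]
  simp only [shuffleSum]
  rw [brSummand_eq_zero X Y (l₁ := [_]) (by simp), zero_add]
  have h := brSummand_hat 0 1 X Y ![] ![a]
  simp only [List.ofFn_succ, List.ofFn_zero, Matrix.cons_val_fin_one] at h
  rw [h, List.length_nil, pow_zero, one_smul, prB_j_sec, ← P.j_hom.map_bracket, prB_j_sec]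
  simp only [Finset.univ_unique, Fin.default_eq_zero, Finset.sum_singleton, update_singleton,
    Finset.univ_eq_empty, Finset.sum_empty, add_zero]
  rfl

/-! #### Extension of scalars -/

theorem evalTwo_baseChange_d (ξ : R ⊗[𝕂] BasicForm P 1) (a a' : Sec P.A) :
    (evalTwo P (a, a')).baseChange R ((P.dgLie.d 1).baseChange R ξ) =
      projB P R (brR P R (inclA P R (1 ⊗ₜ a)) (inclB P R (formMap P R ξ (1 ⊗ₜ a')))) -
      projB P R (brR P R (inclA P R (1 ⊗ₜ a')) (inclB P R (formMap P R ξ (1 ⊗ₜ a)))) -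
      formMap P R ξ (projA P R (brR P R (inclA P R (1 ⊗ₜ a)) (inclA P R (1 ⊗ₜ a')))) := by
  induction ξ with
  | zero => simp
  | add ξ η hξ hη =>
    simp only [map_add, LinearMap.add_apply, hξ, hη]
    abel
  | tmul r X =>
    simp only [LinearMap.baseChange_tmul, evalTwo_d, inclA_tmul, inclB_tmul, formMap_tmul,
      brR_tmul, projB_tmul, projA_tmul, mul_one, one_mul, TensorProduct.tmul_sub]

/-- The `R`-bilinear version of `brTerm`. -/
noncomputable def brTermR (ξ η : R ⊗[𝕂] BasicForm P 1) (a a' : R ⊗[𝕂] Sec P.A) :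
    R ⊗[𝕂] Sec P.B :=
  projB P R (brR P R (inclB P R (formMap P R ξ a)) (inclB P R (formMap P R η a'))) -
    formMap P R η (projA P R (brR P R (inclB P R (formMap P R ξ a)) (inclA P R a'))) +
    formMap P R ξ (projA P R (brR P R (inclB P R (formMap P R η a')) (inclA P R a)))

theorem evalTwo_baseChange_br (ξ η : R ⊗[𝕂] BasicForm P 1) (a a' : Sec P.A) :
    (evalTwo P (a, a')).baseChange R
        (extBilin R (P.dgLie.br (show 1 + 1 = 2 from rfl)) ξ η) =
      brTermR ξ η (1 ⊗ₜ a) (1 ⊗ₜ a') - brTermR ξ η (1 ⊗ₜ a') (1 ⊗ₜ a) := by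
  induction ξ with
  | zero => simp [brTermR]
  | add ξ ξ' hξ hξ' =>
    simp only [brTermR, map_add, LinearMap.add_apply] at hξ hξ' ⊢
    rw [hξ, hξ']
    abel
  | tmul r X =>
    induction η with
    | zero => simp [brTermR]
    | add ξ ξ' hξ hξ' =>
      simp only [brTermR, map_add, LinearMap.add_apply] at hξ hξ' ⊢
      rw [hξ, hξ']
      abel
    | tmul s Y =>
      simp only [LinearMap.baseChange_tmul, extBilin_tmul, evalTwo_br, inclA_tmul, inclB_tmul,
        formMap_tmul, brR_tmul, projB_tmul, projA_tmul, mul_one, mul_comm s r,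
        TensorProduct.tmul_sub, TensorProduct.tmul_add, brTermR, brTerm]

theorem formMap_d (b : R ⊗[𝕂] BasicForm P 0) (z : R ⊗[𝕂] Sec P.A) :
    formMap P R ((P.dgLie.d 0).baseChange R b) z =
      projB P R (brR P R (inclA P R z) (inclB P R ((formZero P).toLinearMap.baseChange R b))) := by
  induction b with
  | zero => simp
  | add b b' hb hb' => simp only [map_add, LinearMap.add_apply, hb, hb']
  | tmul r X =>
    induction z with
    | zero => simp
    | add b b' hb hb' => simp only [map_add, LinearMap.add_apply, hb, hb']
    | tmul s a =>
      simp only [LinearMap.baseChange_tmul, inclA_tmul, inclB_tmul, brR_tmul, projB_tmul,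
        mul_comm s r]
      refine (formMap_tmul r s _ a).trans ?_
      rw [evalOne_d]
      rfl

theorem formMap_br (b : R ⊗[𝕂] BasicForm P 0) (ξ : R ⊗[𝕂] BasicForm P 1)
    (z : R ⊗[𝕂] Sec P.A) :
    formMap P R (extBilin R (P.dgLie.br (zero_add 1)) b ξ) z =
      projB P R (brR P R (inclB P R ((formZero P).toLinearMap.baseChange R b))
        (inclB P R (formMap P R ξ z))) -
      formMap P R ξ (projA P R (brR P R (inclB P R ((formZero P).toLinearMap.baseChange R b))
        (inclA P R z))) := by
  induction b with
  | zero => simp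
  | add b b' hb hb' =>
    simp only [map_add, LinearMap.add_apply, hb, hb']
    abel
  | tmul r X =>
    induction ξ with
    | zero => simp
    | add b b' hb hb' =>
      simp only [map_add, LinearMap.add_apply, hb, hb']
      abel
    | tmul t Y =>
      induction z with
      | zero => simp
      | add b b' hb hb' =>
        simp only [map_add, hb, hb']
        abel
      | tmul s a =>
        simp only [LinearMap.baseChange_tmul, inclA_tmul, inclB_tmul, extBilin_tmul,
          formMap_tmul, brR_tmul, projB_tmul, projA_tmul, evalOne_br, mul_assoc,
          mul_left_comm t r s, TensorProduct.tmul_sub]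
        rfl

/-- Relates the term `[ξ, b]` in the gauge action to `ad_b ξ`; in degrees `0` and `1` the graded
sign is trivial. -/
theorem br_swap (b : R ⊗[𝕂] BasicForm P 0) (ξ : R ⊗[𝕂] BasicForm P 1) :
    extBilin R (P.dgLie.br (add_zero 1)) ξ b = -extBilin R (P.dgLie.br (zero_add 1)) b ξ := by
  induction b with
  | zero => simp
  | add b b' hb hb' =>
    simp only [map_add, LinearMap.add_apply, hb, hb', neg_add]
  | tmul r X =>
    induction ξ with
    | zero => simp
    | add b b' hb hb' => simp only [map_add, LinearMap.add_apply, hb, hb', neg_add]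
    | tmul t Y =>
      rw [extBilin_tmul, extBilin_tmul, P.dgLie.skew (add_zero 1) (zero_add 1), mul_comm t r,
        TensorProduct.tmul_neg]
      simp

end LowDegrees

end MatchedLiePair

end LiePairs


namespace LiePairs

namespace MatchedLiePair

/-! ### The deformation given by a Maurer-Cartan element -/

section Graph

variable {𝕂 : Type} [RCLike 𝕂] {n : ℕ} {M : Type u} [TopologicalSpace M]
  [ChartedSpace (EuclideanSpace ℝ (Fin n)) M] {P : MatchedLiePair.{u, v} 𝕂 n M}
  {R : ArtAlg.{w} 𝕂}

/-- The embedding of `Γ(A) ⊗ R` as the graph of a form of degree one. -/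
noncomputable def graphMap (ξ : R ⊗[𝕂] BasicForm P 1) : R ⊗[𝕂] Sec P.A →ₗ[R] R ⊗[𝕂] Sec P.L :=
  inclA P R + inclB P R ∘ₗ formMap P R ξ

theorem graphMap_apply (ξ : R ⊗[𝕂] BasicForm P 1) (z : R ⊗[𝕂] Sec P.A) :
    graphMap ξ z = inclA P R z + inclB P R (formMap P R ξ z) := rfl

theorem projA_graphMap (ξ : R ⊗[𝕂] BasicForm P 1) (z : R ⊗[𝕂] Sec P.A) :
    projA P R (graphMap ξ z) = z := by
  rw [graphMap_apply, map_add, projA_inclA, projA_inclB, add_zero]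

theorem projB_graphMap (ξ : R ⊗[𝕂] BasicForm P 1) (z : R ⊗[𝕂] Sec P.A) :
    projB P R (graphMap ξ z) = formMap P R ξ z := by
  rw [graphMap_apply, map_add, projB_inclA, projB_inclB, zero_add]

theorem eq_graphMap {ξ : R ⊗[𝕂] BasicForm P 1} {z : R ⊗[𝕂] Sec P.L}
    (h : projB P R z = formMap P R ξ (projA P R z)) : graphMap ξ (projA P R z) = z := by
  rw [graphMap_apply, ← h, inclA_add_inclB]

theorem graphMap_fsmul (ξ : R ⊗[𝕂] BasicForm P 1) (f : R ⊗[𝕂] SmoothFun 𝕂 n M)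
    (z : R ⊗[𝕂] Sec P.A) : graphMap ξ (fsmul R f z) = fsmul R f (graphMap ξ z) := by
  rw [graphMap_apply, graphMap_apply, formMap_fsmul, map_add]
  exact congrArg₂ (· + ·) (map_fsmul P.i.onSec f z) (map_fsmul P.j.onSec f _)

theorem projA_fsmul (f : R ⊗[𝕂] SmoothFun 𝕂 n M) (z : R ⊗[𝕂] Sec P.L) :
    projA P R (fsmul R f z) = fsmul R f (projA P R z) := map_fsmul P.prA.onSec f z

theorem projB_fsmul (f : R ⊗[𝕂] SmoothFun 𝕂 n M) (z : R ⊗[𝕂] Sec P.L) :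
    projB P R (fsmul R f z) = fsmul R f (projB P R z) := map_fsmul P.prB.onSec f z

/-- The two shuffles in the bracket of `ξ` with itself contribute equally; this compensates the
factor `1/2` in the Maurer-Cartan equation. -/
theorem brTermR_skew (ξ : R ⊗[𝕂] BasicForm P 1) (x y : R ⊗[𝕂] Sec P.A) :
    brTermR ξ ξ y x = -brTermR ξ ξ x y := by
  rw [brTermR, brTermR, brR_skew (inclB P R (formMap P R ξ y)), map_neg]
  abel

/-- The curvature of `ξ` measures how far the bracket of two elements of the graph is from the
graph. -/
theorem evalTwo_maurerCartan (ξ : R ⊗[𝕂] BasicForm P 1) (a a' : Sec P.A) :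
    (evalTwo P (a, a')).baseChange R ((P.dgLie.d 1).baseChange R ξ +
      (2 : 𝕂)⁻¹ • extBilin R (P.dgLie.br (show 1 + 1 = 2 from rfl)) ξ ξ) =
    projB P R (brR P R (graphMap ξ (1 ⊗ₜ a)) (graphMap ξ (1 ⊗ₜ a'))) -
      formMap P R ξ (projA P R (brR P R (graphMap ξ (1 ⊗ₜ a)) (graphMap ξ (1 ⊗ₜ a')))) := by
  rw [map_add, LinearMap.map_smul_of_tower, evalTwo_baseChange_d, evalTwo_baseChange_br,
    brTermR_skew ξ (1 ⊗ₜ a) (1 ⊗ₜ a'), sub_neg_eq_add, ← two_smul 𝕂, smul_smul,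
    inv_mul_cancel₀ two_ne_zero, one_smul, brTermR]
  simp only [graphMap_apply, map_add, LinearMap.add_apply, projB_brR_inclA, projA_brR_inclB]
  rw [brR_skew (inclB P R (formMap P R ξ (1 ⊗ₜ a'))) (inclA P R (1 ⊗ₜ a)),
    brR_skew (inclB P R (formMap P R ξ (1 ⊗ₜ a))) (inclA P R (1 ⊗ₜ a'))]
  simp only [map_neg, map_zero]
  abel

/-- By `R`-bilinearity it is enough to test on `1 ⊗ a` and `1 ⊗ a'`, and a form of degree two over
`R` is determined by these values. -/
theorem maurerCartan_iff (ξ : R ⊗[𝕂] BasicForm P 1) :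
    (P.dgLie.d 1).baseChange R ξ +
      (2 : 𝕂)⁻¹ • extBilin R (P.dgLie.br (show 1 + 1 = 2 from rfl)) ξ ξ = 0 ↔
    ∀ x y, projB P R (brR P R (graphMap ξ x) (graphMap ξ y)) =
      formMap P R ξ (projA P R (brR P R (graphMap ξ x) (graphMap ξ y))) := by
  constructor
  · intro h x y
    induction x using one_tmul_induction with
    | h0 => simp
    | hadd a b ha hb => simp only [map_add, LinearMap.add_apply, ha, hb]
    | hsmul s a ha => simp only [map_smul, LinearMap.smul_apply, ha]
    | h1 a =>
      induction y using one_tmul_induction with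
      | h0 => simp
      | hadd a b ha hb => simp only [map_add, ha, hb]
      | hsmul s a ha => simp only [map_smul, ha]
      | h1 a' =>
        rw [← sub_eq_zero, ← evalTwo_maurerCartan, h, map_zero]
  · intro h
    refine ext_of_baseChange (fun a => evalTwo P a) (fun X hX => ext_evalTwo hX) ?_
    rintro ⟨a, a'⟩
    rw [evalTwo_maurerCartan, h, sub_self, map_zero]

theorem graphMap_bracket (ξ : P.dgLie.MC R) (x y : R ⊗[𝕂] Sec P.A) :
    graphMap ξ.1 (projA P R (brR P R (graphMap ξ.1 x) (graphMap ξ.1 y))) =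
      brR P R (graphMap ξ.1 x) (graphMap ξ.1 y) :=
  eq_graphMap ((maurerCartan_iff ξ.1).1 ξ.2.2 x y)

/-- The ringed Lie algebroid given by a Maurer-Cartan element. -/
noncomputable def graphAlg (ξ : P.dgLie.MC R) : RingedLieAlgebroid P.A R where
  bracket := ((brR P R).compl₁₂ (graphMap ξ.1) (graphMap ξ.1)).compr₂ (projA P R)
  anchor := (P.lieL.cartesian R).anchor ∘ₗ graphMap ξ.1
  anchor_fsmul f a := by
    rw [LinearMap.comp_apply, LinearMap.comp_apply, graphMap_fsmul,
      (P.lieL.cartesian R).anchor_fsmul]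
  lie_self a := (congrArg (projA P R) ((P.lieL.cartesian R).lie_self _)).trans (map_zero _)
  jacobi a b c := by
    simp only [LinearMap.compr₂_apply, LinearMap.compl₁₂_apply, graphMap_bracket, ← map_add]
    exact congrArg (projA P R) ((P.lieL.cartesian R).jacobi _ _ _)
  leibniz a b f := by
    simp only [LinearMap.compr₂_apply, LinearMap.compl₁₂_apply, graphMap_fsmul,
      LinearMap.comp_apply]
    refine (congrArg (projA P R) ((P.lieL.cartesian R).leibniz _ _ f)).trans ?_
    rw [map_add, projA_fsmul, projA_fsmul, projA_graphMap]
    rfl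

theorem graphAlg_bracket (ξ : P.dgLie.MC R) (x y : R ⊗[𝕂] Sec P.A) :
    (graphAlg ξ).bracket x y = projA P R (brR P R (graphMap ξ.1 x) (graphMap ξ.1 y)) := rfl

theorem graphAlg_anchor (ξ : P.dgLie.MC R) (x : R ⊗[𝕂] Sec P.A) :
    (graphAlg ξ).anchor x = (P.lieL.cartesian R).anchor (graphMap ξ.1 x) := rfl

theorem evMap_inclA (z : R ⊗[𝕂] Sec P.A) :
    evMap R _ (inclA P R z) = P.i.onSec (evMap R _ z) := evMap_baseChange _ z

theorem evMap_inclB (z : R ⊗[𝕂] Sec P.B) :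
    evMap R _ (inclB P R z) = P.j.onSec (evMap R _ z) := evMap_baseChange _ z

theorem evMap_projA (z : R ⊗[𝕂] Sec P.L) :
    evMap R _ (projA P R z) = P.prA.onSec (evMap R _ z) := evMap_baseChange _ z

theorem evMap_projB (z : R ⊗[𝕂] Sec P.L) :
    evMap R _ (projB P R z) = P.prB.onSec (evMap R _ z) := evMap_baseChange _ z

theorem evMap_graphMap {ξ : R ⊗[𝕂] BasicForm P 1} (hξ : ξ ∈ maxPart R (BasicForm P 1))
    (z : R ⊗[𝕂] Sec P.A) : evMap R _ (graphMap ξ z) = P.i.onSec (evMap R _ z) := by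
  rw [graphMap_apply, map_add, evMap_inclA, evMap_inclB, mem_maxPart_iff_formMap.1 hξ, map_zero,
    add_zero]

theorem evMap_one_tmul {X : Type*} [AddCommGroup X] [Module 𝕂 X] (x : X) :
    evMap R X (1 ⊗ₜ x) = x := by
  rw [evMap_tmul, map_one, one_smul]

/-- The infinitesimal deformation given by a Maurer-Cartan element. -/
noncomputable def graphDef (ξ : P.dgLie.MC R) : InfDef P R where
  alg := graphAlg ξ
  center_bracket a b := by
    have h : ∀ x y : R ⊗[𝕂] Sec P.L,
      evMap R _ (brR P R x y) = P.lieL.bracket (evMap R _ x) (evMap R _ y) := evMap_extBilin _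
    rw [graphAlg_bracket, evMap_projA, h, evMap_graphMap ξ.2.1, evMap_graphMap ξ.2.1,
      evMap_one_tmul, evMap_one_tmul, ← P.i_hom.map_bracket, prA_i_sec]
  center_anchor a := by
    have h : ∀ x : R ⊗[𝕂] Sec P.L,
      evMap R _ ((P.lieL.cartesian R).anchor x) = P.lieL.anchor (evMap R _ x) :=
      evMap_baseChange _
    rw [graphAlg_anchor, h, evMap_graphMap ξ.2.1, evMap_one_tmul]
    exact Subtype.ext (funext fun x => P.i_hom.map_anchor x (a.1 x))
  I :=
    { toFun := graphMap ξ.1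
      -- The identity suffices here: any other base map can be moved into the isomorphism, see
      -- `iso_graphDef_mcOf`.
      base := AlgHom.id R _
      ev_base := fun _ => rfl
      map_fsmul := graphMap_fsmul ξ.1
      map_bracket := graphMap_bracket ξ
      map_anchor := fun _ _ => rfl }
  center_I a := by
    change evMap R _ (graphMap ξ.1 (1 ⊗ₜ a)) = _
    rw [evMap_graphMap ξ.2.1, evMap_one_tmul]

end Graph

/-! ### The Maurer-Cartan element of a deformation -/

section Classify

variable {𝕂 : Type} [RCLike 𝕂] {n : ℕ} {M : Type u} [TopologicalSpace M]
  [ChartedSpace (EuclideanSpace ℝ (Fin n)) M] {P : MatchedLiePair.{u, v} 𝕂 n M}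
  {R : ArtAlg.{w} 𝕂}

/-- The component `Γ(A) ⊗ R → Γ(A) ⊗ R` of a deformation. -/
noncomputable def diag (D : InfDef P R) : R ⊗[𝕂] Sec P.A →ₗ[R] R ⊗[𝕂] Sec P.A :=
  projA P R ∘ₗ D.I.toFun

theorem diag_apply (D : InfDef P R) (z : R ⊗[𝕂] Sec P.A) :
    diag D z = projA P R (D.I.toFun z) := rfl

theorem evMap_I (D : InfDef P R) (z : R ⊗[𝕂] Sec P.A) :
    evMap R _ (D.I.toFun z) = P.i.onSec (evMap R _ z) :=
  evMap_eq_of_one_tmul (ψ := P.i.onSec.restrictScalars 𝕂) D.center_I z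

theorem evMap_diag (D : InfDef P R) (z : R ⊗[𝕂] Sec P.A) :
    evMap R _ (diag D z) = evMap R _ z := by
  rw [diag_apply, evMap_projA, evMap_I, prA_i_sec]

theorem bijective_diag (D : InfDef P R) : Function.Bijective (diag D) :=
  bijective_of_evMap (evMap_diag D)

theorem diag_fsmul (D : InfDef P R) (f : R ⊗[𝕂] SmoothFun 𝕂 n M) (z : R ⊗[𝕂] Sec P.A) :
    diag D (fsmul R f z) = fsmul R (D.I.base f) (diag D z) := by
  rw [diag_apply, D.I.map_fsmul, projA_fsmul, diag_apply]

/-- The form is `pr_B ∘ I ∘ (pr_A ∘ I)⁻¹`. Both components are semilinear along the base map of `I`,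
and the semilinearity cancels. -/
theorem exists_formMap_diag (D : InfDef P R) :
    ∃ ξ, ∀ z, formMap P R ξ (diag D z) = projB P R (D.I.toFun z) := by
  let p := LinearEquiv.ofBijective (diag D) (bijective_diag D)
  have hp : ∀ z, p z = diag D z := fun _ => rfl
  obtain ⟨ξ, hξ⟩ := exists_formMap_eq (projB P R ∘ₗ D.I.toFun ∘ₗ p.symm.toLinearMap) (by
    intro f z
    obtain ⟨z, rfl⟩ := p.surjective z
    -- The base map is the identity modulo the maximal ideal, hence surjective: every function may
    -- be assumed to be of the form `D.I.base f`.
    obtain ⟨f, rfl⟩ := (bijective_of_evMap (φ := D.I.base.toLinearMap) D.I.ev_base).2 f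
    have h : fsmul R (D.I.base f) (p z) = p (fsmul R f z) := (diag_fsmul D f z).symm
    simp only [AlgHom.toLinearMap_apply, h, LinearMap.comp_apply, LinearEquiv.coe_coe,
      LinearEquiv.symm_apply_apply, D.I.map_fsmul, projB_fsmul])
  refine ⟨ξ, fun z => ?_⟩
  rw [hξ, ← hp]
  simp

theorem graphMap_diag {D : InfDef P R} {ξ : R ⊗[𝕂] BasicForm P 1}
    (h : ∀ z, formMap P R ξ (diag D z) = projB P R (D.I.toFun z)) (z : R ⊗[𝕂] Sec P.A) :
    graphMap ξ (diag D z) = D.I.toFun z := eq_graphMap (h z).symm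

/-- The graph is the image of `I`, which is closed under the bracket because `I` is a morphism;
smallness of `ξ` holds because the centre of `I` is the inclusion of `A`. -/
theorem exists_maurerCartan (D : InfDef P R) :
    ∃ ξ : P.dgLie.MC R, ∀ z, graphMap ξ.1 (diag D z) = D.I.toFun z := by
  obtain ⟨ξ, hξ⟩ := exists_formMap_diag D
  have hg := graphMap_diag hξ
  refine ⟨⟨ξ, mem_maxPart_iff_formMap.2 fun z => ?_, (maurerCartan_iff ξ).2 fun x y => ?_⟩, hg⟩
  · obtain ⟨z, rfl⟩ := (bijective_diag D).2 z
    rw [hξ, evMap_projB, evMap_I, prB_i_sec]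
  · obtain ⟨x, rfl⟩ := (bijective_diag D).2 x
    obtain ⟨y, rfl⟩ := (bijective_diag D).2 y
    have h : brR P R (D.I.toFun x) (D.I.toFun y) = D.I.toFun (D.alg.bracket x y) :=
      (D.I.map_bracket x y).symm
    rw [hg, hg, h, ← hξ, diag_apply]

theorem graphMap_injective : Function.Injective (graphMap (P := P) (R := R)) := by
  intro ξ η h
  refine formMap_injective (LinearMap.ext fun z => ?_)
  rw [← projB_graphMap, h, projB_graphMap]

/-- The Maurer-Cartan element of a deformation. -/
noncomputable def mcOf (D : InfDef P R) : P.dgLie.MC R := (exists_maurerCartan D).choose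

theorem graphMap_mcOf (D : InfDef P R) (z : R ⊗[𝕂] Sec P.A) :
    graphMap (mcOf D).1 (diag D z) = D.I.toFun z := (exists_maurerCartan D).choose_spec z

theorem diag_graphDef (ξ : P.dgLie.MC R) (z : R ⊗[𝕂] Sec P.A) : diag (graphDef ξ) z = z :=
  projA_graphMap ξ.1 z

theorem mcOf_graphDef (ξ : P.dgLie.MC R) : mcOf (graphDef ξ) = ξ := by
  refine Subtype.ext (graphMap_injective (LinearMap.ext fun z => ?_))
  have h := graphMap_mcOf (graphDef ξ) z
  rwa [diag_graphDef] at h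

/-- No automorphism of `L` is needed: take `b = 0` and let `pr_A ∘ I`, with the base map of `I`,
reparametrize the graph. -/
theorem iso_graphDef_mcOf (D : InfDef P R) : (graphDef (mcOf D)).Iso D := by
  refine ⟨0, zero_mem _,
    { toFun := diag D
      base := D.I.base
      ev_base := D.I.ev_base
      map_fsmul := diag_fsmul D
      map_bracket := fun a b => ?_
      map_anchor := fun a f => ?_ }, fun a => ?_, fun a => ?_, fun f => ?_⟩
  · change diag D (D.alg.bracket a b) = (graphAlg (mcOf D)).bracket (diag D a) (diag D b)
    rw [graphAlg_bracket, graphMap_mcOf, graphMap_mcOf, diag_apply, D.I.map_bracket]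
    rfl
  · change _ = pairing R ((graphAlg (mcOf D)).anchor (diag D a)) _
    rw [graphAlg_anchor, graphMap_mcOf, D.I.map_anchor]
  · exact (evMap_diag D _).trans (evMap_one_tmul a)
  · have h : innerB P R 0 = 0 := by rw [innerB, map_zero, map_zero]
    rw [h, nilExp_zero]
    exact (graphMap_mcOf D a).symm
  · have h : symbolB P R 0 = 0 := by rw [symbolB, map_zero, map_zero, map_zero]
    rw [h, nilExp_zero]
    rfl

end Classify

end MatchedLiePair

end LiePairs


namespace LiePairs

/-! ### Vector fields as derivations -/

section Derivations

variable {𝕂 : Type} [RCLike 𝕂] {n : ℕ} {M : Type u} [TopologicalSpace M]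
  [ChartedSpace (EuclideanSpace ℝ (Fin n)) M] {R : ArtAlg.{w} 𝕂}

theorem dirDeriv_mul {f g : M → 𝕂} {x : M} (hf : MDifferentiableAt (𝓡 n) 𝓘(ℝ, 𝕂) f x)
    (hg : MDifferentiableAt (𝓡 n) 𝓘(ℝ, 𝕂) g x) :
    dirDeriv (n := n) (f * g) x = f x • dirDeriv g x + g x • dirDeriv f x := by
  refine TensorProduct.AlgebraTensorModule.curry_injective (LinearMap.ext fun c =>
    LinearMap.ext fun y => ?_)
  change c * mvfderiv (𝓡 n) (f * g) x y =
    f x * (c * mvfderiv (𝓡 n) g x y) + g x * (c * mvfderiv (𝓡 n) f x y)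
  have h2 : mvfderiv (𝓡 n) (f * g) x y =
      f x * mvfderiv (𝓡 n) g x y + g x * mvfderiv (𝓡 n) f x y := by
    unfold mvfderiv
    rw [(hf.hasMFDerivAt.mul hg.hasMFDerivAt).mfderiv]
    rfl
  rw [h2]
  ring

theorem vfAct_mul (X : VF 𝕂 n M) (f g : SmoothFun 𝕂 n M) :
    vfAct X (f * g) = vfAct X f * g + f * vfAct X g := by
  refine Subtype.ext (funext fun x => ?_)
  refine (congrArg (fun φ => φ (X.1 x)) (dirDeriv_mul
    ((f.2.mdifferentiable (by simp)) x) ((g.2.mdifferentiable (by simp)) x))).trans ?_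
  change f.1 x * dirDeriv g.1 x (X.1 x) + g.1 x * dirDeriv f.1 x (X.1 x) =
    dirDeriv f.1 x (X.1 x) * g.1 x + f.1 x * dirDeriv g.1 x (X.1 x)
  ring

theorem pairing_mul (X : R ⊗[𝕂] VF 𝕂 n M) (f g : R ⊗[𝕂] SmoothFun 𝕂 n M) :
    pairing R X (f * g) = pairing R X f * g + f * pairing R X g := by
  induction X with
  | zero => simp
  | add a b ha hb =>
    simp only [map_add, LinearMap.add_apply, ha, hb, add_mul, mul_add]
    abel
  | tmul r X =>
    induction f with
    | zero => simp
    | add a b ha hb =>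
      simp only [map_add, ha, hb, add_mul]
      abel
    | tmul s f =>
      induction g with
      | zero => simp
      | add a b ha hb =>
        simp only [map_add, ha, hb, mul_add]
        abel
      | tmul t g =>
        simp only [pairing, Algebra.TensorProduct.tmul_mul_tmul, extBilin_tmul, vfAct_mul,
          TensorProduct.tmul_add, mul_assoc, mul_left_comm s r t]

theorem pairing_one (X : R ⊗[𝕂] VF 𝕂 n M) : pairing R X 1 = 0 := by
  have h := pairing_mul X 1 1
  rw [mul_one, mul_one, one_mul] at h
  exact left_eq_add.1 h

/-- Arranged as a Leibniz rule for the derivative along `x` of the pairing of `y` with `f`, the form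
in which it can be exponentiated. -/
theorem pairing_anchor_bracket {E : SmoothVectorBundle.{u, v} 𝕂 n M} (𝓔 : LieAlgebroid E)
    (x y : R ⊗[𝕂] Sec E) (f : R ⊗[𝕂] SmoothFun 𝕂 n M) :
    pairing R ((𝓔.cartesian R).anchor x) (pairing R ((𝓔.cartesian R).anchor y) f) =
      pairing R ((𝓔.cartesian R).anchor ((𝓔.cartesian R).bracket x y)) f +
        pairing R ((𝓔.cartesian R).anchor y) (pairing R ((𝓔.cartesian R).anchor x) f) := by
  induction x with
  | zero => simp
  | add a b ha hb =>
    simp only [map_add, LinearMap.add_apply, ha, hb]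
    abel
  | tmul r x =>
    induction y with
    | zero => simp
    | add a b ha hb =>
      simp only [map_add, LinearMap.add_apply, ha, hb]
      abel
    | tmul s y =>
      induction f with
      | zero => simp
      | add a b ha hb =>
        simp only [map_add, ha, hb]
        abel
      | tmul t f =>
        have h : vfAct (𝓔.anchor x) (vfAct (𝓔.anchor y) f) =
            vfAct (𝓔.anchor (𝓔.bracket x y)) f + vfAct (𝓔.anchor y) (vfAct (𝓔.anchor x) f) := by
          have h := 𝓔.anchor_bracket x y f
          exact (eq_sub_iff_add_eq.1 h).symm
        simp only [LieAlgebroid.cartesian, pairing, extBilin_tmul, LinearMap.baseChange_tmul,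
          LinearMap.coe_restrictScalars, h, TensorProduct.tmul_add, mul_assoc, mul_left_comm s r t]

end Derivations

namespace MatchedLiePair

/-! ### Exponentials of inner derivations -/

section Exp

variable {𝕂 : Type} [RCLike 𝕂] {n : ℕ} {M : Type u} [TopologicalSpace M]
  [ChartedSpace (EuclideanSpace ℝ (Fin n)) M] {P : MatchedLiePair.{u, v} 𝕂 n M}
  {R : ArtAlg.{w} 𝕂}

theorem evMap_nilExp {X : Type*} [AddCommGroup X] [Module 𝕂 X]
    {φ : Module.End R (R ⊗[𝕂] X)} (hφ : IsNilpotent φ) (h : ∀ z, evMap R X (φ z) = 0)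
    (z : R ⊗[𝕂] X) : evMap R X (nilExp R φ z) = evMap R X z := by
  obtain ⟨N, hN⟩ := hφ
  rw [nilExp_eq_sum φ (N := N + 1) (by rw [pow_succ, hN, zero_mul]), Finset.sum_range_succ',
    LinearMap.add_apply, map_add, LinearMap.sum_apply, map_sum, Finset.sum_eq_zero, zero_add]
  · simp
  · intro k _
    rw [LinearMap.smul_apply, pow_succ', Module.End.mul_apply, map_smul, h, smul_zero]

theorem bilin_smul_left {X Y Z : Type*} [AddCommGroup X] [Module R X] [Module 𝕂 X]
    [IsScalarTower 𝕂 R X] [AddCommGroup Y] [Module R Y] [AddCommGroup Z] [Module R Z] [Module 𝕂 Z]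
    [IsScalarTower 𝕂 R Z] (β : X →ₗ[R] Y →ₗ[R] Z) (c : 𝕂) (x : X) (y : Y) :
    β (c • x) y = c • β x y := by
  rw [← algebraMap_smul R c x, ← algebraMap_smul R c (β x y), map_smul, LinearMap.smul_apply]

theorem bilin_smul_right {X Y Z : Type*} [AddCommGroup X] [Module R X]
    [AddCommGroup Y] [Module R Y] [Module 𝕂 Y] [IsScalarTower 𝕂 R Y] [AddCommGroup Z] [Module R Z]
    [Module 𝕂 Z] [IsScalarTower 𝕂 R Z] (β : X →ₗ[R] Y →ₗ[R] Z) (c : 𝕂) (x : X) (y : Y) :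
    β x (c • y) = c • β x y := by
  rw [← algebraMap_smul R c y, ← algebraMap_smul R c (β x y), map_smul]

variable {b : R ⊗[𝕂] Sec P.B} (hb : b ∈ maxPart R (Sec P.B))

include hb

theorem evMap_exp_innerB (z : R ⊗[𝕂] Sec P.L) :
    evMap R _ (nilExp R (innerB P R b) z) = evMap R _ z := by
  refine evMap_nilExp (isNilpotent_innerB hb) (fun z => ?_) z
  have h := evMap_extBilin P.lieL.bracket (inclB P R b) z
  rw [evMap_inclB, mem_maxPart_iff.1 hb, map_zero, map_zero, LinearMap.zero_apply] at h
  exact h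

theorem evMap_exp_symbolB (f : R ⊗[𝕂] SmoothFun 𝕂 n M) :
    evMap R _ (nilExp R (symbolB P R b) f) = evMap R _ f := by
  refine evMap_nilExp (isNilpotent_symbolB hb) (fun f => ?_) f
  have h := evMap_extBilin (vfAct (𝕂 := 𝕂) (n := n) (M := M))
    ((P.lieL.cartesian R).anchor (inclB P R b)) f
  have h0 : evMap R _ ((P.lieL.cartesian R).anchor (inclB P R b)) = 0 :=
    mem_maxPart_iff.1 (map_mem_maxPart _ (map_mem_maxPart _ hb))
  rw [h0, map_zero, LinearMap.zero_apply] at h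
  exact h

/-- The Jacobi identity says that `[b, -]` is a derivation of the bracket; `nilExp_bilin`
exponentiates it. The next lemmas do the same with the Leibniz rule, the compatibility of anchor and
bracket, and the product rule for vector fields. -/
theorem exp_innerB_bracket (x y : R ⊗[𝕂] Sec P.L) :
    nilExp R (innerB P R b) (brR P R x y) =
      brR P R (nilExp R (innerB P R b) x) (nilExp R (innerB P R b) y) :=
  nilExp_bilin (brR P R) (bilin_smul_left _) (bilin_smul_right _) (isNilpotent_innerB hb)
    (isNilpotent_innerB hb) (isNilpotent_innerB hb)
    (fun x y => (P.lieL.cartesian R).jacobi (inclB P R b) x y) x y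

theorem exp_innerB_fsmul (f : R ⊗[𝕂] SmoothFun 𝕂 n M) (x : R ⊗[𝕂] Sec P.L) :
    nilExp R (innerB P R b) (fsmul R f x) =
      fsmul R (nilExp R (symbolB P R b) f) (nilExp R (innerB P R b) x) :=
  nilExp_bilin (fsmul R) (bilin_smul_left _) (bilin_smul_right _) (isNilpotent_symbolB hb)
    (isNilpotent_innerB hb) (isNilpotent_innerB hb)
    (fun f x => (P.lieL.cartesian R).leibniz (inclB P R b) x f) f x

theorem exp_symbolB_pairing (x : R ⊗[𝕂] Sec P.L) (f : R ⊗[𝕂] SmoothFun 𝕂 n M) :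
    nilExp R (symbolB P R b) (pairing R ((P.lieL.cartesian R).anchor x) f) =
      pairing R ((P.lieL.cartesian R).anchor (nilExp R (innerB P R b) x))
        (nilExp R (symbolB P R b) f) :=
  nilExp_bilin (pairing R ∘ₗ (P.lieL.cartesian R).anchor) (bilin_smul_left _)
    (bilin_smul_right _) (isNilpotent_innerB hb) (isNilpotent_symbolB hb) (isNilpotent_symbolB hb)
    (fun x f => pairing_anchor_bracket P.lieL (inclB P R b) x f) x f

theorem exp_symbolB_mul (f g : R ⊗[𝕂] SmoothFun 𝕂 n M) :
    nilExp R (symbolB P R b) (f * g) =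
      nilExp R (symbolB P R b) f * nilExp R (symbolB P R b) g :=
  nilExp_bilin (LinearMap.mul R (R ⊗[𝕂] SmoothFun 𝕂 n M)) (bilin_smul_left _)
    (bilin_smul_right _) (isNilpotent_symbolB hb) (isNilpotent_symbolB hb) (isNilpotent_symbolB hb)
    (fun f g => pairing_mul _ f g) f g

theorem exp_symbolB_one : nilExp R (symbolB P R b) 1 = 1 := by
  obtain ⟨N, hN⟩ := isNilpotent_symbolB hb
  rw [nilExp_eq_sum _ (N := N + 1) (by rw [pow_succ, hN, zero_mul]), Finset.sum_range_succ',
    LinearMap.add_apply, LinearMap.sum_apply, Finset.sum_eq_zero, zero_add]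
  · simp
  · intro k _
    have h : symbolB P R b 1 = 0 := pairing_one _
    rw [LinearMap.smul_apply, pow_succ, Module.End.mul_apply, h, map_zero, smul_zero]

/-- The automorphism `exp(ρ(b))` of the algebra of functions. -/
noncomputable def expSymbol : R ⊗[𝕂] SmoothFun 𝕂 n M →ₐ[R] R ⊗[𝕂] SmoothFun 𝕂 n M :=
  AlgHom.ofLinearMap (nilExp R (symbolB P R b)) (exp_symbolB_one hb) (exp_symbolB_mul hb)

end Exp

/-! ### The gauge action -/

section Gauge

variable {𝕂 : Type} [RCLike 𝕂] {n : ℕ} {M : Type u} [TopologicalSpace M]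
  [ChartedSpace (EuclideanSpace ℝ (Fin n)) M] {P : MatchedLiePair.{u, v} 𝕂 n M}
  {R : ArtAlg.{w} 𝕂}

/-- The infinitesimal generator of the gauge action on the affine hull of the space of forms of
degree one. -/
noncomputable def gaugeGen (b : R ⊗[𝕂] BasicForm P 0) :
    Module.End R ((R ⊗[𝕂] BasicForm P 1) × R) :=
  LinearMap.inl R _ R ∘ₗ ((P.dgLie.ad R b).coprod
    (LinearMap.toSpanSingleton R _ (-(P.dgLie.d 0).baseChange R b)))

theorem gaugeGen_apply (b : R ⊗[𝕂] BasicForm P 0) (ξ : R ⊗[𝕂] BasicForm P 1) (r : R) :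
    gaugeGen b (ξ, r) = (P.dgLie.ad R b ξ - r • (P.dgLie.d 0).baseChange R b, 0) := by
  simp [gaugeGen, sub_eq_add_neg]

theorem gaugeGen_pow_succ (b : R ⊗[𝕂] BasicForm P 0) (k : ℕ) (ξ : R ⊗[𝕂] BasicForm P 1) (r : R) :
    (gaugeGen b ^ (k + 1)) (ξ, r) =
      ((P.dgLie.ad R b ^ k) (P.dgLie.ad R b ξ - r • (P.dgLie.d 0).baseChange R b), 0) := by
  induction k with
  | zero => simp [gaugeGen_apply]
  | succ k ih =>
    rw [pow_succ' _ (k + 1), Module.End.mul_apply, ih, gaugeGen_apply, zero_smul, sub_zero,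
      pow_succ' _ k, Module.End.mul_apply]

theorem isNilpotent_ad {b : R ⊗[𝕂] BasicForm P 0} (hb : b ∈ maxPart R (BasicForm P 0)) :
    IsNilpotent (P.dgLie.ad R b) := isNilpotent_extBilin _ hb

/-- The first application kills the scalar coordinate, afterwards the generator is `ad_b`. The extra
power is the constant term of the series, so that the remaining range is the one in `gauge`. -/
theorem gaugeGen_pow_eq_zero {b : R ⊗[𝕂] BasicForm P 0} (hb : b ∈ maxPart R (BasicForm P 0)) :
    gaugeGen b ^ (nilpotencyClass (P.dgLie.ad R b) + 1) = 0 := by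
  refine LinearMap.ext fun x => ?_
  rw [gaugeGen_pow_succ, pow_nilpotencyClass (isNilpotent_ad hb)]
  rfl

/-- On the slice with scalar coordinate `1`, the linear generator restricts to the affine vector
field `ξ ↦ [b, ξ] - d b`, and its exponential series is that of the gauge action. -/
theorem nilExp_gaugeGen {b : R ⊗[𝕂] BasicForm P 0} (hb : b ∈ maxPart R (BasicForm P 0))
    (ξ : R ⊗[𝕂] BasicForm P 1) :
    nilExp R (gaugeGen b) (ξ, 1) = (P.dgLie.gauge R b ξ, 1) := by
  rw [nilExp_eq_sum _ (gaugeGen_pow_eq_zero hb), Finset.sum_range_succ', LinearMap.add_apply,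
    LinearMap.sum_apply, DGLieAlgebra.gauge]
  have h : (P.dgLie.d 0).baseChange R b + extBilin R (P.dgLie.br (add_zero 1)) ξ b =
      -(P.dgLie.ad R b ξ - (1 : R) • (P.dgLie.d 0).baseChange R b) := by
    rw [br_swap, one_smul, DGLieAlgebra.ad]
    abel
  have h' := fun k => gaugeGen_pow_succ b k ξ (1 : R)
  simp only [h, LinearMap.smul_apply, h', map_neg, smul_neg, Finset.sum_neg_distrib,
    sub_neg_eq_add]
  refine Prod.ext ?_ ?_
  · simp [Prod.fst_sum, add_comm]
  · simp [Prod.snd_sum]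

/-- The action of the affine hull of the space of forms of degree one on `Γ(L) ⊗ R`. -/
noncomputable def affineAct :
    ((R ⊗[𝕂] BasicForm P 1) × R) →ₗ[R] R ⊗[𝕂] Sec P.L →ₗ[R] R ⊗[𝕂] Sec P.L :=
  LinearMap.mk₂ R (fun x v => inclB P R (formMap P R x.1 (projA P R v)) +
      x.2 • inclA P R (projA P R v))
    (fun x y v => by
      simp only [Prod.fst_add, Prod.snd_add, map_add, LinearMap.add_apply, add_smul]
      abel)
    (fun c x v => by
      simp only [Prod.smul_fst, Prod.smul_snd, map_smul, LinearMap.smul_apply, smul_add,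
        smul_assoc])
    (fun x v w => by
      simp only [map_add, smul_add]
      abel)
    (fun c x v => by simp only [map_smul, smul_add, smul_comm c])

theorem affineAct_apply (ξ : R ⊗[𝕂] BasicForm P 1) (r : R) (v : R ⊗[𝕂] Sec P.L) :
    affineAct (ξ, r) v =
      inclB P R (formMap P R ξ (projA P R v)) + r • inclA P R (projA P R v) := rfl

theorem affineAct_one (ξ : R ⊗[𝕂] BasicForm P 1) (v : R ⊗[𝕂] Sec P.L) :
    affineAct (ξ, 1) v = graphMap ξ (projA P R v) := by
  rw [affineAct_apply, one_smul, add_comm, graphMap_apply]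

variable (P R) in
/-- Sections of `B` as forms of degree zero. -/
noncomputable def formZeroR : R ⊗[𝕂] BasicForm P 0 →ₗ[R] R ⊗[𝕂] Sec P.B :=
  (formZero P).toLinearMap.baseChange R

/-- The commutator of `[b, -]` with the operator attached to `x` is the operator attached to
`gaugeGen b x`. The components match because `[B, B]` lies in `B` and `d b`, `[b, ξ]` are
projections of brackets in `L`. -/
theorem innerB_affineAct (b : R ⊗[𝕂] BasicForm P 0) (x : (R ⊗[𝕂] BasicForm P 1) × R)
    (v : R ⊗[𝕂] Sec P.L) :
    innerB P R (formZeroR P R b) (affineAct x v) =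
      affineAct (gaugeGen b x) v + affineAct x (innerB P R (formZeroR P R b) v) := by
  obtain ⟨ξ, r⟩ := x
  have hi : ∀ z, innerB P R (formZeroR P R b) z = brR P R (inclB P R (formZeroR P R b)) z :=
    fun _ => rfl
  rw [gaugeGen_apply, affineAct_apply, affineAct_apply, affineAct_apply, hi, hi, map_sub,
    LinearMap.sub_apply, map_smul, LinearMap.smul_apply, formMap_d, DGLieAlgebra.ad, formMap_br]
  change _ = inclB P R (projB P R (brR P R (inclB P R (formZeroR P R b)) _) -
    formMap P R ξ (projA P R (brR P R (inclB P R (formZeroR P R b)) _)) -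
    r • projB P R (brR P R _ (inclB P R (formZeroR P R b)))) + _ + _
  set c := inclB P R (formZeroR P R b) with hc
  set a := projA P R v with ha
  have h1 : projA P R (brR P R c v) = projA P R (brR P R c (inclA P R a)) := by
    conv_lhs => rw [← inclA_add_inclB v, map_add, map_add, hc, projA_brR_inclB, add_zero]
  have h2 : brR P R c (inclB P R (formMap P R ξ a)) =
      inclB P R (projB P R (brR P R c (inclB P R (formMap P R ξ a)))) := by
    conv_lhs => rw [← inclA_add_inclB (brR P R c (inclB P R (formMap P R ξ a))), hc,
      projA_brR_inclB, map_zero, zero_add]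
  have h3 := inclA_add_inclB (brR P R c (inclA P R a))
  rw [map_add, map_smul, h1, h2, ← h3, brR_skew (inclA P R a) c]
  simp only [map_sub, map_add, map_neg, map_smul, projA_inclA, projA_inclB, projB_inclB,
    smul_add, smul_neg, zero_smul, add_zero]
  abel

/-- Exponentiates `innerB_affineAct` at `(ξ, 1)`, which acts as projection to `A` followed by the
graph of `ξ` and so fixes the points of this graph. -/
theorem exp_innerB_graphMap {b : R ⊗[𝕂] BasicForm P 0} (hb : b ∈ maxPart R (BasicForm P 0))
    (ξ : R ⊗[𝕂] BasicForm P 1) (z : R ⊗[𝕂] Sec P.A) :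
    nilExp R (innerB P R (formZeroR P R b)) (graphMap ξ z) =
      graphMap (P.dgLie.gauge R b ξ)
        (projA P R (nilExp R (innerB P R (formZeroR P R b)) (graphMap ξ z))) := by
  have hb' : formZeroR P R b ∈ maxPart R (Sec P.B) := map_mem_maxPart _ hb
  have h := nilExp_bilin (affineAct (P := P) (R := R)) (bilin_smul_left _) (bilin_smul_right _)
    ⟨_, gaugeGen_pow_eq_zero hb⟩ (isNilpotent_innerB hb') (isNilpotent_innerB hb')
    (innerB_affineAct b) (ξ, 1) (graphMap ξ z)
  rwa [nilExp_gaugeGen hb, affineAct_one, affineAct_one, projA_graphMap] at h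

end Gauge

end MatchedLiePair

end LiePairs


namespace LiePairs

namespace MatchedLiePair

/-! ### The isomorphism of deformation functors -/

section Classification

variable {𝕂 : Type} [RCLike 𝕂] {n : ℕ} {M : Type u} [TopologicalSpace M]
  [ChartedSpace (EuclideanSpace ℝ (Fin n)) M] {P : MatchedLiePair.{u, v} 𝕂 n M}
  {R S : ArtAlg.{w} 𝕂}

theorem exists_formZeroR {b : R ⊗[𝕂] Sec P.B} (hb : b ∈ maxPart R (Sec P.B)) :
    ∃ c ∈ maxPart R (BasicForm P 0), formZeroR P R c = b := by
  refine ⟨(formZero P).symm.toLinearMap.baseChange R b, map_mem_maxPart _ hb, ?_⟩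
  rw [formZeroR, ← LinearMap.comp_apply, ← LinearMap.baseChange_comp]
  simp

/-- The automorphism `exp([b, -])` carries one graph into the other. Read in the coordinate `A` it
is the map `T`, a morphism covering `exp(ρ(b))` because the exponential respects all structures. -/
theorem iso_graphDef {ξ η : P.dgLie.MC R} (h : P.dgLie.GaugeEquiv R ξ η) :
    (graphDef η).Iso (graphDef ξ) := by
  obtain ⟨c, hc, h⟩ := h
  have hb : formZeroR P R c ∈ maxPart R (Sec P.B) := map_mem_maxPart _ hc
  have key := exp_innerB_graphMap hc ξ.1
  rw [← h] at key
  set b := formZeroR P R c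
  let T : R ⊗[𝕂] Sec P.A →ₗ[R] R ⊗[𝕂] Sec P.A :=
    projA P R ∘ₗ nilExp R (innerB P R b) ∘ₗ graphMap ξ.1
  have hT : ∀ z, graphMap η.1 (T z) = nilExp R (innerB P R b) (graphMap ξ.1 z) :=
    fun z => (key z).symm
  refine ⟨b, hb,
    { toFun := T
      base := expSymbol hb
      ev_base := evMap_exp_symbolB hb
      map_fsmul := fun f a => ?_
      map_bracket := fun x y => ?_
      map_anchor := fun x f => ?_ }, fun a => ?_, fun z => (hT z).symm, fun f => rfl⟩
  · change projA P R (nilExp R (innerB P R b) (graphMap ξ.1 (fsmul R f a))) = _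
    rw [graphMap_fsmul, exp_innerB_fsmul hb, projA_fsmul]
    rfl
  · change projA P R (nilExp R (innerB P R b) (graphMap ξ.1 ((graphAlg ξ).bracket x y))) =
      (graphAlg η).bracket (T x) (T y)
    rw [graphAlg_bracket, graphMap_bracket, exp_innerB_bracket hb, graphAlg_bracket, hT, hT]
  · change nilExp R (symbolB P R b) (pairing R ((graphAlg ξ).anchor x) f) =
      pairing R ((graphAlg η).anchor (T x)) (nilExp R (symbolB P R b) f)
    rw [graphAlg_anchor, graphAlg_anchor, hT, exp_symbolB_pairing hb]
  · change evMap R _ (projA P R (nilExp R (innerB P R b) (graphMap ξ.1 (1 ⊗ₜ a)))) = a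
    rw [evMap_projA, evMap_exp_innerB hb, evMap_graphMap ξ.2.1, evMap_one_tmul, prA_i_sec]

/-- The exponential sends the image of `I'` into the image of `I`, and also onto the graph of the
gauge transform. Two graphs that share a point over every element of `A_R` are equal. -/
theorem gaugeEquiv_mcOf {D D' : InfDef P R} (h : D.Iso D') :
    P.dgLie.GaugeEquiv R (mcOf D') (mcOf D) := by
  obtain ⟨b, hb, Φ, -, h2, -⟩ := h
  obtain ⟨c, hc, rfl⟩ := exists_formZeroR hb
  refine ⟨c, hc, graphMap_injective (LinearMap.ext fun z => ?_)⟩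
  have key := exp_innerB_graphMap hc (mcOf D').1
  set b := formZeroR P R c
  let T : R ⊗[𝕂] Sec P.A →ₗ[R] R ⊗[𝕂] Sec P.A :=
    projA P R ∘ₗ nilExp R (innerB P R b) ∘ₗ graphMap (mcOf D').1
  have hT : ∀ z, nilExp R (innerB P R b) (graphMap (mcOf D').1 z) =
      graphMap (P.dgLie.gauge R c (mcOf D').1) (T z) := key
  -- Since `T` is the identity modulo the maximal ideal, every element of `A_R` is reached.
  have hbij : Function.Bijective T := bijective_of_evMap fun z => by
    change evMap R _ (projA P R (nilExp R (innerB P R b) (graphMap (mcOf D').1 z))) = _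
    rw [evMap_projA, evMap_exp_innerB hb, evMap_graphMap (mcOf D').2.1, prA_i_sec]
  obtain ⟨z, rfl⟩ := hbij.2 z
  obtain ⟨z, rfl⟩ := (bijective_diag D').2 z
  have h3 := h2 z
  rw [← graphMap_mcOf D', ← graphMap_mcOf D, hT] at h3
  have h4 := congrArg (projA P R) h3
  rw [projA_graphMap, projA_graphMap] at h4
  rw [h3, h4]

variable (P R) in
/-- Maurer-Cartan elements up to gauge equivalence are deformations up to isomorphism. -/
noncomputable def classEquiv :
    Quot (InfDef.Iso (P := P) (R := R)) ≃ Quot (P.dgLie.GaugeEquiv R) where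
  toFun := Quot.lift (fun D => Quot.mk _ (mcOf D)) fun _ _ h =>
    (Quot.sound (gaugeEquiv_mcOf h)).symm
  invFun := Quot.lift (fun ξ => Quot.mk _ (graphDef ξ)) fun _ _ h =>
    (Quot.sound (iso_graphDef h)).symm
  left_inv := by
    rintro ⟨D⟩
    exact Quot.sound (iso_graphDef_mcOf D)
  right_inv := by
    rintro ⟨ξ⟩
    exact congrArg (Quot.mk _) (mcOf_graphDef ξ)

/-! ### Naturality in the local Artinian algebra. -/

theorem graphMap_push (ϑ : R →ₐ[𝕂] S) (ξ : R ⊗[𝕂] BasicForm P 1) (z : R ⊗[𝕂] Sec P.A) :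
    graphMap (LiePairs.push _ ϑ ξ) (LiePairs.push _ ϑ z) = LiePairs.push _ ϑ (graphMap ξ z) := by
  have h1 : inclA P S (LiePairs.push _ ϑ z) = LiePairs.push _ ϑ (inclA P R z) :=
    baseChange_push ϑ _ z
  have h2 : formMap P S (LiePairs.push _ ϑ ξ) (LiePairs.push _ ϑ z) =
      LiePairs.push _ ϑ (formMap P R ξ z) := extBilin_push ϑ _ ξ z
  rw [graphMap_apply, graphMap_apply, h1, h2, inclB_push, map_add]

theorem graphDef_push (ϑ : R →ₐ[𝕂] S) (ξ : P.dgLie.MC R) :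
    (graphDef ξ).push ϑ = graphDef (ξ.map P.dgLie ϑ) := by
  have hg := graphMap_push ϑ ξ.1
  refine InfDef.ext' (LinearMap.ext fun x => LinearMap.ext fun y => ?_)
    (LinearMap.ext fun x => ?_) (LinearMap.ext fun x => ?_) (AlgHom.ext fun f => ?_)
  · change pushBilin ϑ (graphAlg ξ).bracket x y = (graphAlg (ξ.map P.dgLie ϑ)).bracket x y
    induction x using push_induction ϑ with
    | h0 => simp
    | hadd a b ha hb => simp only [map_add, LinearMap.add_apply, ha, hb]
    | hsmul s a ha => simp only [map_smul, LinearMap.smul_apply, ha]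
    | hpush x =>
      induction y using push_induction ϑ with
      | h0 => simp
      | hadd a b ha hb => simp only [map_add, ha, hb]
      | hsmul s a ha => simp only [map_smul, ha]
      | hpush y =>
        have h1 : ∀ z, projA P S (LiePairs.push _ ϑ z) = LiePairs.push _ ϑ (projA P R z) :=
          baseChange_push ϑ _
        have h2 : ∀ z t, brR P S (LiePairs.push _ ϑ z) (LiePairs.push _ ϑ t) =
            LiePairs.push _ ϑ (brR P R z t) := extBilin_push ϑ _
        rw [pushBilin_push, graphAlg_bracket, graphAlg_bracket]
        change _ = projA P S (brR P S (graphMap (LiePairs.push _ ϑ ξ.1) _)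
          (graphMap (LiePairs.push _ ϑ ξ.1) _))
        rw [hg, hg, h2, h1]
  · change pushHom ϑ (graphAlg ξ).anchor x = (graphAlg (ξ.map P.dgLie ϑ)).anchor x
    induction x using push_induction ϑ with
    | h0 => simp
    | hadd a b ha hb => simp only [map_add, ha, hb]
    | hsmul s a ha => simp only [map_smul, ha]
    | hpush x =>
      rw [pushHom_push, graphAlg_anchor, graphAlg_anchor]
      change _ = (P.lieL.cartesian S).anchor (graphMap (LiePairs.push _ ϑ ξ.1) _)
      rw [hg]
      exact (baseChange_push ϑ _ _).symm
  · change pushHom ϑ (graphMap ξ.1) x = graphMap (LiePairs.push _ ϑ ξ.1) x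
    induction x using push_induction ϑ with
    | h0 => simp
    | hadd a b ha hb => simp only [map_add, ha, hb]
    | hsmul s a ha => simp only [map_smul, ha]
    | hpush x => rw [pushHom_push, hg]
  · change pushAlg ϑ (AlgHom.id R _) f = f
    induction f using push_induction (X := SmoothFun 𝕂 n M) ϑ with
    | h0 => simp
    | hadd a b ha hb => simp only [map_add, ha, hb]
    | hsmul s a ha => simp only [map_smul, ha]
    | hpush f => rw [pushAlg_push]; rfl

variable (P) in
/-- The deformation functor of a matched Lie pair is the one of its dg Lie algebra. -/
noncomputable def hDefIso : hDef.{u, v, w} P ≅ P.dgLie.Def :=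
  -- Naturality is checked from Maurer-Cartan elements to deformations: `graphDef` commutes with
  -- extension of scalars strictly, so no isomorphisms have to be tracked.
  (NatIso.ofComponents (fun R => (classEquiv P R).symm.toIso) (by
    intro R S ϑ
    ext x
    obtain ⟨ξ, rfl⟩ := Quot.exists_rep x
    exact (congrArg (Quot.mk _) (graphDef_push (show R →ₐ[𝕂] S from ϑ) ξ)).symm)).symm

end Classification

end MatchedLiePair

end LiePairs

theorem mainTheorem3 {𝕂 : Type} [RCLike 𝕂] {n : ℕ} {M : Type u} [TopologicalSpace M]
    [T2Space M] [SecondCountableTopology M] [ChartedSpace (EuclideanSpace ℝ (Fin n)) M]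
    [IsManifold (𝓡 n) ∞ M] (P : MatchedLiePair.{u, v} 𝕂 n M) :
    ∃ g : DGLieAlgebra 𝕂 (BasicForm P),
      (∀ (k : ℕ) (X : BasicForm P k) (a : Fin (k + 1) → Sec P.A),
        g.d k X a = ceDiff P k X a) ∧
      (∀ (p q : ℕ) (X : BasicForm P p) (Y : BasicForm P q) (a : Fin (p + q) → Sec P.A),
        g.br rfl X Y a = basicBracket P p q X Y a) ∧
      Nonempty (hDef.{u, v, w} P ≅ g.Def) :=
  ⟨P.dgLie, MatchedLiePair.dgLie_d, MatchedLiePair.dgLie_br, ⟨P.hDefIso⟩⟩
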